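/- **Conventions.** Let $\mathsf B$ be a category and $\mathcal F$ a class of display maps of $\mathsf B$: the pullback of every map of $\mathcal F$ along every map of $\mathsf B$ exists and lies in $\mathcal F$. Assume that $\mathcal F$ contains all isomorphisms and is closed under composition. Let $\mathsf p:\mathsf E\to\mathsf B$ be a (Grothendieck) fibration, with fibres $\mathsf E_I$ and reindexing functors $u^*$. Maps in a fibre are called vertical. * $\mathsf p$ *has $\mathcal F$-coproducts* (resp. *$\mathcal F$-products*) if for each $u\in\mathcal F$ the functor $u^*$ has a left adjoint $\coprod_u$ (resp. a right adjoint $\prod_u$), and these satisfy the Beck–Chevalley condition for all pullback squares of maps of $\mathcal F$ along arbitrary maps. * $\mathsf B$ *has $\mathcal F$-dependent products* if for all $f:K\to I$ and $g:I\to J$ in $\mathcal F$ there are a map $h:T\to J$ in $\mathcal F$, a pullback $Z=I\times_J T$ and a map $e:Z\to K$ over $I$ such that for any other such data $(h':T'\to J,\ Z'=I\times_J T',\ e':Z'\to K)$ there is a unique pair $(w:Z'\to Z,\ k:T'\to T)$ compatible with all the projections to $I$, $J$, $T$ and with $e w=e'$. * $\Sigma_{\mathcal F}(\mathsf p)$ is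 the fibration over $\mathsf B$ whose objects over $I$ are pairs $(g:X\to I,\alpha)$ with $g\in\mathcal F$, $\alpha\in\mathsf E_X$. A map $(g:X\to I,\alpha)\to(h:Y\to J,\beta)$ over $f_0:I\to J$ is a map $f_1:X\to Y$ with $hf_1=f_0g$ together with a map $\alpha\to\beta$ of $\mathsf E$ over $f_1$. * $\Pi_{\mathcal F}(\mathsf p)$ has the same objects. A map $(g:X\to I,\alpha)\to(h:Y\to J,\beta)$ over $f_0:I\to J$ is a map $f_1:I\times_J Y\to X$ over $I$ together with a vertical map $f_1^*\alpha\to \mathrm{pr}_Y^*\beta$ over $I\times_JY$. Put $\mathfrak{Dial}_{\mathcal F}(\mathsf p)=\Sigma_{\mathcal F}\Pi_{\mathcal F}(\mathsf p)$. * Let $\mathsf p$ have $\mathcal F$-coproducts. An object $\alpha\in\mathsf E_A$ is *$(\mathcal F,\coprod)$-quantifier splitting* if for every $u:K\to A$ in $\mathcal F$, every $\beta\in\mathsf E_K$ and every vertical $h:\alpha\to\coprod_u\beta$ there are a unique section $g$ of $u$ and a unique vertical $\bar h:\alpha\to g^*\beta$ with $h=g^*(\eta_\beta)\circ\bar h$,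 where $\eta$ is the unit of $\coprod_u\dashv u^*$ and $g^*u^*\cong\mathrm{id}$ is used. It is *$(\mathcal F,\coprod)$-quantifier-free* if $f^*\alpha$ is $(\mathcal F,\coprod)$-quantifier splitting for every map $f:I\to A$ of $\mathsf B$. The fibration $\mathsf p$ *has enough $(\mathcal F,\coprod)$-quantifier-free objects* if it has $\mathcal F$-coproducts and each $\alpha\in\mathsf E_I$ is isomorphic in $\mathsf E_I$ to $\coprod_f\beta$ for some $f:A\to I$ in $\mathcal F$ and some $(\mathcal F,\coprod)$-quantifier-free $\beta\in\mathsf E_A$. * Dually, for $\mathsf p$ with $\mathcal F$-products, the $(\mathcal F,\prod)$-notions are defined with vertical maps $h:\prod_u\beta\to\alpha$ factored as $h=\bar h\circ g^*(\varepsilon_\beta)$, where $g$ is a unique section of $u$, $\bar h:g^*\beta\to\alpha$ is a unique vertical map and $\varepsilon$ is the counit of $u^*\dashv\prod_u$. * $\mathsf p$ is a *(dependent) Skolem fibration* if $\mathsf B$ has $\mathcal F$-dependent products, $\mathsf p$ has $\mathcal F$-products, $\mathcal F$-coproducts and enough $(\mathcal F,\coprod)$-quantifier-free objects, and $\prod_f\alpha$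 is $(\mathcal F,\coprod)$-quantifier-free whenever $\alpha$ is $(\mathcal F,\coprod)$-quantifier-free and $f\in\mathcal F$. It is a *(dependent) Gödel fibration* if moreover its full subfibration $\bar{\mathsf p}$ of $(\mathcal F,\coprod)$-quantifier-free objects has enough $(\mathcal F,\prod)$-quantifier-free objects. * $\mathsf q\simeq\mathsf p$ means that the fibrations $\mathsf q,\mathsf p$ are equivalent over $\mathsf B$: there are mutually quasi-inverse functors between their total categories that commute with the projections to $\mathsf B$ and preserve cartesian maps, with vertical unit and counit. **Theorem.** Let $\mathsf p:\mathsf E\to\mathsf B$ be a fibration with $\mathcal F$-products and $\mathcal F$-coproducts, and suppose that $\mathsf B$ has $\mathcal F$-dependent products. Then there exists a fibration $\mathsf p'$ over $\mathsf B$ with $\mathfrak{Dial}_{\mathcal F}(\mathsf p')\simeq\mathsf p$ if and only if $\mathsf p$ is a Gödel fibration. Moreover, if $\mathsf p$ is a Gödel fibration, then $\mathfrak{Dial}_{\mathcal F}(\mathsf p')\simeq\mathsf p$ holds when $\mathsf p'$ is the full subfibration of $\mathsf p$ on those $(\mathcal F,\coprod)$-quantifier-free objects that are $(\mathcal F,\prod)$-quantifier-free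 in $\bar{\mathsf p}$. -/

import Mathlib

open CategoryTheory CategoryTheory.Limits

universe v₁ v₂ v₃ u₁ u₂ u₃

namespace DepDialectica

section Reindexing

variable {B : Type u₁} [Category.{v₁} B] {E : Type u₂} [Category.{v₂} E]

variable (p : E ⥤ B) [p.IsFibered]

/-- The reindexing `u^* a` of an object `a` of the fibre over `J` along `u : I ⟶ J`
(for a chosen cleavage). -/
noncomputable def reindexObj {I J : B} (u : I ⟶ J) (a : p.Fiber J) : p.Fiber I :=
  ⟨Functor.IsPreFibered.pullbackObj a.2 u, Functor.IsPreFibered.pullbackObj_proj a.2 u⟩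

/-- The chosen cartesian lifting `u^* a ⟶ a` of `u`. -/
noncomputable def cartLift {I J : B} (u : I ⟶ J) (a : p.Fiber J) :
    (reindexObj p u a).1 ⟶ a.1 :=
  Functor.IsPreFibered.pullbackMap a.2 u

instance cartLift_isCartesian {I J : B} (u : I ⟶ J) (a : p.Fiber J) :
    p.IsCartesian u (cartLift p u a) :=
  inferInstanceAs (p.IsCartesian u (Functor.IsPreFibered.pullbackMap a.2 u))

/-- The vertical map `b ⟶ u^* a` corresponding to a map `b ⟶ a` over `u`. -/
noncomputable def vertLift {I J : B} (u : I ⟶ J) {a : p.Fiber J} {b : p.Fiber I}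
    (φ : b.1 ⟶ a.1) (hφ : p.IsHomLift u φ) : b ⟶ reindexObj p u a :=
  ⟨Functor.IsCartesian.map p u (cartLift p u a) φ, inferInstance⟩

variable {p} in
/-- The canonical map `b ⟶ a` over `u` corresponding to a vertical map `b ⟶ u^* a`. -/
noncomputable def total {I J : B} {u : I ⟶ J} {a : p.Fiber J} {b : p.Fiber I}
    (f : b ⟶ reindexObj p u a) : b.1 ⟶ a.1 :=
  f.1 ≫ cartLift p u a

instance fiber_hom_isHomLift {I : B} {a b : p.Fiber I} (f : a ⟶ b) :
    p.IsHomLift (𝟙 I) f.1 := f.2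

instance total_isHomLift {I J : B} {u : I ⟶ J} {a : p.Fiber J} {b : p.Fiber I}
    (f : b ⟶ reindexObj p u a) : p.IsHomLift u (total f) :=
  IsHomLift.comp_lift_id_left' p I f.1 u _

@[simp]
lemma total_vertLift {I J : B} (u : I ⟶ J) {a : p.Fiber J} {b : p.Fiber I}
    (φ : b.1 ⟶ a.1) (hφ : p.IsHomLift u φ) : total (vertLift p u φ hφ) = φ :=
  Functor.IsCartesian.fac p u (cartLift p u a) φ

variable {p} in
lemma total_ext {I J : B} {u : I ⟶ J} {a : p.Fiber J} {b : p.Fiber I}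
    {f g : b ⟶ reindexObj p u a} (h : total f = total g) : f = g :=
  Subtype.ext (Functor.IsCartesian.ext p u (cartLift p u a) f.1 g.1 h)

@[simp]
lemma comp_total {I J : B} {u : I ⟶ J} {a : p.Fiber J} {b c : p.Fiber I}
    (g : c ⟶ b) (f : b ⟶ reindexObj p u a) : total (g ≫ f) = g.1 ≫ total f :=
  Category.assoc _ _ _

/-- The reindexing functor `u^*` between the fibres. -/
noncomputable def reindex {I J : B} (u : I ⟶ J) : p.Fiber J ⥤ p.Fiber I where
  obj a := reindexObj p u a
  map {a b} φ := vertLift p u (cartLift p u a ≫ φ.1) inferInstance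
  map_id a := by
    apply total_ext
    rw [total_vertLift]
    change _ ≫ 𝟙 _ = 𝟙 _ ≫ _
    simp
  map_comp {a b c} φ ψ := by
    apply total_ext
    rw [total_vertLift, comp_total, total_vertLift, ← Category.assoc]
    change _ ≫ φ.1 ≫ ψ.1 = total (vertLift p u _ _) ≫ ψ.1
    rw [total_vertLift, Category.assoc]

@[simp]
lemma reindex_map_cartLift {I J : B} (u : I ⟶ J) {a b : p.Fiber J} (φ : a ⟶ b) :
    ((reindex p u).map φ).1 ≫ cartLift p u b = cartLift p u a ≫ φ.1 :=
  total_vertLift p u _ _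

/-- The canonical vertical isomorphism `u^* v^* a ≅ w^* a` for `w = u ≫ v`. -/
noncomputable def reindexCompObj {I J K : B} {u : I ⟶ J} {v : J ⟶ K} {w : I ⟶ K}
    (h : u ≫ v = w) (a : p.Fiber K) :
    reindexObj p u (reindexObj p v a) ≅ reindexObj p w a where
  hom := vertLift p w (cartLift p u (reindexObj p v a) ≫ cartLift p v a)
    (h ▸ IsHomLift.comp p u v _ _)
  inv := vertLift p u (Functor.IsStronglyCartesian.map p v (cartLift p v a) h.symm
    (cartLift p w a)) inferInstance
  hom_inv_id := by
    apply total_ext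
    rw [comp_total, total_vertLift]
    apply Functor.IsStronglyCartesian.ext p v (cartLift p v a) u
    rw [Category.assoc, Functor.IsStronglyCartesian.fac]
    change total (vertLift p w _ _) = (𝟙 _ ≫ _) ≫ _
    rw [total_vertLift, Category.id_comp]
  inv_hom_id := by
    apply total_ext
    rw [comp_total, total_vertLift, ← Category.assoc]
    change total (vertLift p u _ _) ≫ _ = 𝟙 _ ≫ _
    rw [total_vertLift, Functor.IsStronglyCartesian.fac, Category.id_comp]

/-- The canonical isomorphism `u^* v^* ≅ w^*` for `w = u ≫ v`. -/
noncomputable def reindexComp {I J K : B} {u : I ⟶ J} {v : J ⟶ K} {w : I ⟶ K}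
    (h : u ≫ v = w) : reindex p v ⋙ reindex p u ≅ reindex p w :=
  NatIso.ofComponents (reindexCompObj p h) (fun {a b} φ => by
    apply total_ext
    have h₁ := reindex_map_cartLift p u ((reindex p v).map φ)
    have h₂ := reindex_map_cartLift p v φ
    have h₃ (c : p.Fiber K) : (reindexCompObj p h c).hom.1 ≫ cartLift p w c =
      cartLift p u (reindexObj p v c) ≫ cartLift p v c := total_vertLift p w _ _
    have h₄ := reindex_map_cartLift p w φ
    change (((reindex p u).map ((reindex p v).map φ)).1 ≫ (reindexCompObj p h b).hom.1) ≫
        cartLift p w b = ((reindexCompObj p h a).hom.1 ≫ ((reindex p w).map φ).1) ≫ cartLift p w b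
    refine (Category.assoc _ _ _).trans ((congrArg _ (h₃ b)).trans ?_)
    refine (Category.assoc _ _ _).symm.trans ((congrArg (· ≫ _) h₁).trans ?_)
    refine (Category.assoc _ _ _).trans ((congrArg _ h₂).trans ?_)
    refine (Category.assoc _ _ _).symm.trans ((congrArg (· ≫ _) (h₃ a).symm).trans ?_)
    refine (Category.assoc _ _ _).trans ((congrArg _ h₄.symm).trans ?_)
    exact (Category.assoc _ _ _).symm)

/-- The canonical isomorphism `(𝟙 I)^* ≅ 𝟭`. -/
noncomputable def reindexId (I : B) : reindex p (𝟙 I) ≅ 𝟭 (p.Fiber I) :=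
  NatIso.ofComponents
    (fun a => show reindexObj p (𝟙 I) a ≅ a from
      { hom := ⟨cartLift p (𝟙 I) a, inferInstance⟩
        inv := vertLift p (𝟙 I) (𝟙 a.1) (IsHomLift.id a.2)
        hom_inv_id := by
          apply total_ext
          rw [comp_total, total_vertLift]
          change cartLift p _ a ≫ 𝟙 _ = 𝟙 _ ≫ cartLift p _ a
          simp
        inv_hom_id := Subtype.ext (total_vertLift p (𝟙 I) (𝟙 a.1) (IsHomLift.id a.2)) })
    (fun {a b} φ => Subtype.ext (reindex_map_cartLift p (𝟙 I) φ))

/-- For a commutative square `g ≫ v = u ≫ f`, the canonical isomorphism `g^* v^* ≅ u^* f^*`. -/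
noncomputable def reindexSquare {K L I J : B} {u : K ⟶ I} {g : K ⟶ L} {f : I ⟶ J} {v : L ⟶ J}
    (h : g ≫ v = u ≫ f) : reindex p v ⋙ reindex p g ≅ reindex p f ⋙ reindex p u :=
  reindexComp p h ≪≫ (reindexComp p rfl).symm

end Reindexing

section Base

variable {B : Type u₁} [Category.{v₁} B]

/-- `F` is a class of display maps: pullbacks of maps in `F` along arbitrary maps exist and belong
to `F`. -/
class IsDisplayMapClass (F : MorphismProperty B) : Prop extends
  F.HasPullbacks, F.IsStableUnderBaseChange

/-- `h : T ⟶ J`, together with the pullback square on `Z` and `e : Z ⟶ K`, is an `F`-dependent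
product of `f : K ⟶ I` along `g : I ⟶ J`. -/
structure IsDependentProduct (F : MorphismProperty B) {K I J T Z : B} (f : K ⟶ I) (g : I ⟶ J)
    (h : T ⟶ J) (t : Z ⟶ T) (z : Z ⟶ I) (e : Z ⟶ K) : Prop where
  display : F h
  isPullback : IsPullback t z h g
  fac : e ≫ f = z
  existsUnique : ∀ {T' Z' : B} (h' : T' ⟶ J) (t' : Z' ⟶ T') (z' : Z' ⟶ I) (e' : Z' ⟶ K),
    F h' → IsPullback t' z' h' g → e' ≫ f = z' →
      ∃! wk : (Z' ⟶ Z) × (T' ⟶ T),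
        wk.1 ≫ t = t' ≫ wk.2 ∧ wk.1 ≫ z = z' ∧ wk.2 ≫ h = h' ∧ wk.1 ≫ e = e'

/-- Every pair of composable maps of `F` has an `F`-dependent product. -/
def HasDependentProducts (F : MorphismProperty B) : Prop :=
  ∀ ⦃K I J : B⦄ (f : K ⟶ I) (g : I ⟶ J), F f → F g →
    ∃ (T Z : B) (h : T ⟶ J) (t : Z ⟶ T) (z : Z ⟶ I) (e : Z ⟶ K),
      IsDependentProduct F f g h t z e

end Base

section Quantifiers

variable {B : Type u₁} [Category.{v₁} B] {E : Type u₂} [Category.{v₂} E]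
  (p : E ⥤ B) [p.IsFibered]

/-- The comparison `∐_u g^* ⟶ f^* ∐_v` attached to a commutative square `g ≫ v = u ≫ f`: the mate
of `g^* v^* ≅ u^* f^*`. -/
noncomputable def leftComparison {K L I J : B} {u : K ⟶ I} {g : K ⟶ L} {f : I ⟶ J} {v : L ⟶ J}
    (h : g ≫ v = u ≫ f) {Sv : p.Fiber L ⥤ p.Fiber J} {Su : p.Fiber K ⥤ p.Fiber I}
    (adjv : Sv ⊣ reindex p v) (adju : Su ⊣ reindex p u) :
    reindex p g ⋙ Su ⟶ Sv ⋙ reindex p f :=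
  ((mateEquiv adjv adju).symm (.mk _ _ _ _ (reindexSquare p h).hom)).natTrans

/-- The comparison `f^* ∏_v ⟶ ∏_u g^*` attached to a commutative square `g ≫ v = u ≫ f`: the mate
of `u^* f^* ≅ g^* v^*`. -/
noncomputable def rightComparison {K L I J : B} {u : K ⟶ I} {g : K ⟶ L} {f : I ⟶ J} {v : L ⟶ J}
    (h : g ≫ v = u ≫ f) {Pv : p.Fiber L ⥤ p.Fiber J} {Pu : p.Fiber K ⥤ p.Fiber I}
    (adjv : reindex p v ⊣ Pv) (adju : reindex p u ⊣ Pu) :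
    Pv ⋙ reindex p f ⟶ reindex p g ⋙ Pu :=
  (mateEquiv adjv adju (.mk _ _ _ _ (reindexSquare p h).inv)).natTrans

/-- The fibration `p` has `F`-coproducts: `v^*` has a left adjoint for each `v` in `F`, and the
Beck-Chevalley condition holds (for one, equivalently any, choice of these adjoints). -/
structure HasFibredCoproducts (F : MorphismProperty B) : Prop where
  isRightAdjoint : ∀ ⦃L J : B⦄ (v : L ⟶ J), F v → (reindex p v).IsRightAdjoint
  beckChevalley : ∀ ⦃K L I J : B⦄ ⦃u : K ⟶ I⦄ ⦃g : K ⟶ L⦄ ⦃f : I ⟶ J⦄ ⦃v : L ⟶ J⦄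
    (sq : IsPullback u g f v), F v → F u →
    ∀ {Sv : p.Fiber L ⥤ p.Fiber J} {Su : p.Fiber K ⥤ p.Fiber I}
      (adjv : Sv ⊣ reindex p v) (adju : Su ⊣ reindex p u),
      IsIso (leftComparison p sq.w.symm adjv adju)

/-- The fibration `p` has `F`-products: `v^*` has a right adjoint for each `v` in `F`, and the
Beck-Chevalley condition holds (for one, equivalently any, choice of these adjoints). -/
structure HasFibredProducts (F : MorphismProperty B) : Prop where
  isLeftAdjoint : ∀ ⦃L J : B⦄ (v : L ⟶ J), F v → (reindex p v).IsLeftAdjoint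
  beckChevalley : ∀ ⦃K L I J : B⦄ ⦃u : K ⟶ I⦄ ⦃g : K ⟶ L⦄ ⦃f : I ⟶ J⦄ ⦃v : L ⟶ J⦄
    (sq : IsPullback u g f v), F v → F u →
    ∀ {Pv : p.Fiber L ⥤ p.Fiber J} {Pu : p.Fiber K ⥤ p.Fiber I}
      (adjv : reindex p v ⊣ Pv) (adju : reindex p u ⊣ Pu),
      IsIso (rightComparison p sq.w.symm adjv adju)

variable {p} {F : MorphismProperty B}

/-- The functor `∐_u`. -/
noncomputable def coprod (hC : HasFibredCoproducts p F) {K I : B} (u : K ⟶ I) (hu : F u) :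
    p.Fiber K ⥤ p.Fiber I :=
  haveI := hC.isRightAdjoint u hu
  (reindex p u).leftAdjoint

/-- The adjunction `∐_u ⊣ u^*`. -/
noncomputable def coprodAdj (hC : HasFibredCoproducts p F) {K I : B} (u : K ⟶ I) (hu : F u) :
    coprod hC u hu ⊣ reindex p u :=
  haveI := hC.isRightAdjoint u hu
  Adjunction.ofIsRightAdjoint (reindex p u)

/-- The functor `∏_u`. -/
noncomputable def prod (hP : HasFibredProducts p F) {K I : B} (u : K ⟶ I) (hu : F u) :
    p.Fiber K ⥤ p.Fiber I :=
  haveI := hP.isLeftAdjoint u hu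
  (reindex p u).rightAdjoint

/-- The adjunction `u^* ⊣ ∏_u`. -/
noncomputable def prodAdj (hP : HasFibredProducts p F) {K I : B} (u : K ⟶ I) (hu : F u) :
    reindex p u ⊣ prod hP u hu :=
  haveI := hP.isLeftAdjoint u hu
  Adjunction.ofIsLeftAdjoint (reindex p u)

/-- For a section `g` of `u`, the canonical isomorphism `g^* u^* ≅ 𝟭`. -/
noncomputable def reindexSection (p : E ⥤ B) [p.IsFibered] {A K : B} {u : K ⟶ A} {g : A ⟶ K}
    (h : g ≫ u = 𝟙 A) : reindex p u ⋙ reindex p g ≅ 𝟭 (p.Fiber A) :=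
  reindexComp p h ≪≫ reindexId p A

/-- `a` is `(F, ∐)`-quantifier splitting: every vertical `h : a ⟶ ∐_u b` with `u` in `F` factors
as `h = g^*(η_b) ∘ h'` for a unique section `g` of `u` and a unique vertical `h' : a ⟶ g^* b`. -/
def IsCoprodSplitting (hC : HasFibredCoproducts p F) {A : B} (a : p.Fiber A) : Prop :=
  ∀ ⦃K : B⦄ (u : K ⟶ A) (hu : F u) (b : p.Fiber K) (h : a ⟶ (coprod hC u hu).obj b),
    ∃! s : (Σ g : {g : A ⟶ K // g ≫ u = 𝟙 A}, a ⟶ (reindex p g.1).obj b),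
      h = s.2 ≫ (reindex p s.1.1).map ((coprodAdj hC u hu).unit.app b) ≫
        (reindexSection p s.1.2).hom.app ((coprod hC u hu).obj b)

/-- `a` is `(F, ∏)`-quantifier splitting: every vertical `h : ∏_u b ⟶ a` with `u` in `F` factors
as `h = h' ∘ g^*(ε_b)` for a unique section `g` of `u` and a unique vertical `h' : g^* b ⟶ a`. -/
def IsProdSplitting (hP : HasFibredProducts p F) {A : B} (a : p.Fiber A) : Prop :=
  ∀ ⦃K : B⦄ (u : K ⟶ A) (hu : F u) (b : p.Fiber K) (h : (prod hP u hu).obj b ⟶ a),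
    ∃! s : (Σ g : {g : A ⟶ K // g ≫ u = 𝟙 A}, (reindex p g.1).obj b ⟶ a),
      h = (reindexSection p s.1.2).inv.app ((prod hP u hu).obj b) ≫
        (reindex p s.1.1).map ((prodAdj hP u hu).counit.app b) ≫ s.2

/-- `a` is `(F, ∐)`-quantifier-free. -/
def IsCoprodQF (hC : HasFibredCoproducts p F) {A : B} (a : p.Fiber A) : Prop :=
  ∀ ⦃I : B⦄ (f : I ⟶ A), IsCoprodSplitting hC ((reindex p f).obj a)

/-- `a` is `(F, ∏)`-quantifier-free. -/
def IsProdQF (hP : HasFibredProducts p F) {A : B} (a : p.Fiber A) : Prop :=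
  ∀ ⦃I : B⦄ (f : I ⟶ A), IsProdSplitting hP ((reindex p f).obj a)

variable (p F) in
/-- The fibration `p` has enough `(F, ∐)`-quantifier-free objects. -/
def HasEnoughCoprodQF : Prop :=
  ∃ hC : HasFibredCoproducts p F, ∀ ⦃I : B⦄ (a : p.Fiber I),
    ∃ (A : B) (f : A ⟶ I) (hf : F f) (b : p.Fiber A),
      IsCoprodQF hC b ∧ Nonempty (a ≅ (coprod hC f hf).obj b)

variable (p F) in
/-- The fibration `p` has enough `(F, ∏)`-quantifier-free objects. -/
def HasEnoughProdQF : Prop :=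
  ∃ hP : HasFibredProducts p F, ∀ ⦃I : B⦄ (a : p.Fiber I),
    ∃ (A : B) (f : A ⟶ I) (hf : F f) (b : p.Fiber A),
      IsProdQF hP b ∧ Nonempty (a ≅ (prod hP f hf).obj b)

lemma IsCoprodSplitting.of_iso {hC : HasFibredCoproducts p F} {A : B} {a a' : p.Fiber A}
    (i : a ≅ a') (ha : IsCoprodSplitting hC a) : IsCoprodSplitting hC a' := by
  intro K u hu b h
  obtain ⟨⟨g, k⟩, hk, huniq⟩ := ha u hu b (i.hom ≫ h)
  refine ⟨⟨g, i.inv ≫ k⟩, ?_, ?_⟩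
  · dsimp only at hk ⊢
    rw [Category.assoc, ← hk, Iso.inv_hom_id_assoc]
  · rintro ⟨g', k'⟩ hk'
    have := huniq ⟨g', i.hom ≫ k'⟩ (by
      dsimp only at hk' ⊢
      rw [Category.assoc, ← hk'])
    cases this
    simp

lemma IsProdSplitting.of_iso {hP : HasFibredProducts p F} {A : B} {a a' : p.Fiber A}
    (i : a ≅ a') (ha : IsProdSplitting hP a) : IsProdSplitting hP a' := by
  intro K u hu b h
  obtain ⟨⟨g, k⟩, hk, huniq⟩ := ha u hu b (h ≫ i.inv)
  refine ⟨⟨g, k ≫ i.hom⟩, ?_, ?_⟩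
  · dsimp only at hk ⊢
    rw [← Category.assoc, ← Category.assoc, Category.assoc _ _ k, ← hk, Category.assoc,
      Iso.inv_hom_id, Category.comp_id]
  · rintro ⟨g', k'⟩ hk'
    have := huniq ⟨g', k' ≫ i.inv⟩ (by
      dsimp only at hk' ⊢
      rw [hk', Category.assoc, Category.assoc])
    cases this
    simp

lemma IsCoprodQF.reindex {hC : HasFibredCoproducts p F} {A I : B} {a : p.Fiber A}
    (ha : IsCoprodQF hC a) (f : I ⟶ A) : IsCoprodQF hC ((reindex p f).obj a) :=
  fun _ g => (ha (g ≫ f)).of_iso ((reindexComp p rfl).app a).symm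

lemma IsProdQF.reindex {hP : HasFibredProducts p F} {A I : B} {a : p.Fiber A}
    (ha : IsProdQF hP a) (f : I ⟶ A) : IsProdQF hP ((reindex p f).obj a) :=
  fun _ g => (ha (g ≫ f)).of_iso ((reindexComp p rfl).app a).symm

end Quantifiers

section Subfibrations

variable {B : Type u₁} [Category.{v₁} B] {E : Type u₂} [Category.{v₂} E]

/-- The restriction of `p` to the full subcategory of the objects satisfying `P`. -/
def restrict (p : E ⥤ B) (P : ObjectProperty E) : P.FullSubcategory ⥤ B :=
  P.ι ⋙ p

lemma restrict_isHomLift {p : E ⥤ B} {P : ObjectProperty E} {I J : B} {f : I ⟶ J}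
    {X Y : P.FullSubcategory} (φ : X ⟶ Y) :
    (restrict p P).IsHomLift f φ ↔ p.IsHomLift f φ.hom := by
  constructor
  · intro h
    exact IsHomLift.of_fac p f φ.hom (IsHomLift.domain_eq (restrict p P) f φ)
      (IsHomLift.codomain_eq (restrict p P) f φ) (IsHomLift.fac (restrict p P) f φ)
  · intro h
    exact IsHomLift.of_fac (restrict p P) f φ (IsHomLift.domain_eq p f φ.hom)
      (IsHomLift.codomain_eq p f φ.hom) (IsHomLift.fac p f φ.hom)

lemma restrict_isFibered {p : E ⥤ B} [p.IsFibered] {P : ObjectProperty E}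
    (hP : ∀ {I J : B} (f : I ⟶ J) (a : p.Fiber J), P a.1 → P ((reindex p f).obj a).1) :
    (restrict p P).IsFibered := by
  apply Functor.IsFibered.of_exists_isStronglyCartesian
  intro X R f
  let a : p.Fiber (p.obj X.1) := ⟨X.1, rfl⟩
  let Y : P.FullSubcategory := ⟨(reindexObj p f a).1, hP f a X.2⟩
  let c : Y ⟶ X := P.homMk (cartLift p f a)
  have : p.IsCartesian f c.hom := cartLift_isCartesian p f a
  refine ⟨Y, c, ?_⟩
  exact
    { toIsHomLift := (restrict_isHomLift c).2 inferInstance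
      universal_property' := by
        intro Z g φ hφ
        have := (restrict_isHomLift φ).1 hφ
        obtain ⟨χ, ⟨hχ, hχ'⟩, huniq⟩ :=
          Functor.IsStronglyCartesian.universal_property p f c.hom g (g ≫ f) rfl φ.hom
        refine ⟨P.homMk χ, ⟨(restrict_isHomLift _).2 hχ, ?_⟩, ?_⟩
        · ext
          exact hχ'
        · rintro ψ ⟨hψ, hψ'⟩
          ext
          exact huniq ψ.hom ⟨(restrict_isHomLift ψ).1 hψ, by rw [← hψ']; rfl⟩ }

variable {p : E ⥤ B} [p.IsFibered] {F : MorphismProperty B}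

/-- The `(F, ∐)`-quantifier-free objects of the total category. -/
def coprodQFProp (hC : HasFibredCoproducts p F) : ObjectProperty E :=
  fun X => IsCoprodQF hC (⟨X, rfl⟩ : p.Fiber (p.obj X))

/-- The `(F, ∏)`-quantifier-free objects of the total category. -/
def prodQFProp (hP : HasFibredProducts p F) : ObjectProperty E :=
  fun X => IsProdQF hP (⟨X, rfl⟩ : p.Fiber (p.obj X))

lemma coprodQFProp_iff (hC : HasFibredCoproducts p F) {I : B} (a : p.Fiber I) :
    coprodQFProp hC a.1 ↔ IsCoprodQF hC a := by
  obtain ⟨a, rfl⟩ := a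
  rfl

lemma prodQFProp_iff (hP : HasFibredProducts p F) {I : B} (a : p.Fiber I) :
    prodQFProp hP a.1 ↔ IsProdQF hP a := by
  obtain ⟨a, rfl⟩ := a
  rfl

/-- The full subfibration of `(F, ∐)`-quantifier-free objects. -/
def coprodQFSub (hC : HasFibredCoproducts p F) : (coprodQFProp hC).FullSubcategory ⥤ B :=
  restrict p (coprodQFProp hC)

/-- The full subfibration of `(F, ∏)`-quantifier-free objects. -/
def prodQFSub (hP : HasFibredProducts p F) : (prodQFProp hP).FullSubcategory ⥤ B :=
  restrict p (prodQFProp hP)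

instance coprodQFSub_isFibered (hC : HasFibredCoproducts p F) : (coprodQFSub hC).IsFibered :=
  restrict_isFibered fun f a ha =>
    (coprodQFProp_iff hC _).2 (((coprodQFProp_iff hC a).1 ha).reindex f)

instance prodQFSub_isFibered (hP : HasFibredProducts p F) : (prodQFSub hP).IsFibered :=
  restrict_isFibered fun f a ha =>
    (prodQFProp_iff hP _).2 (((prodQFProp_iff hP a).1 ha).reindex f)

variable (p F) in
/-- `p` is a (dependent) Skolem fibration. -/
structure IsSkolem : Prop where
  hasDependentProducts : HasDependentProducts F
  hasProducts : HasFibredProducts p F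
  hasCoproducts : HasFibredCoproducts p F
  enough : HasEnoughCoprodQF p F
  stable : ∀ ⦃I J : B⦄ (f : I ⟶ J) (hf : F f) (a : p.Fiber I),
    IsCoprodQF hasCoproducts a → IsCoprodQF hasCoproducts ((prod hasProducts f hf).obj a)

variable (p F) in
/-- `p` is a (dependent) Gödel fibration: it is Skolem, and its full subfibration of
`(F, ∐)`-quantifier-free objects has enough `(F, ∏)`-quantifier-free objects. -/
structure IsGoedel : Prop extends IsSkolem p F where
  enoughProd : HasEnoughProdQF (coprodQFSub hasCoproducts) F

lemma IsGoedel.sub_hasProducts (h : IsGoedel p F) :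
    HasFibredProducts (coprodQFSub h.hasCoproducts) F :=
  h.enoughProd.1

/-- For a Gödel fibration `p`, the full subfibration of those `(F, ∐)`-quantifier-free objects of
`p` that are `(F, ∏)`-quantifier-free in the subfibration of `(F, ∐)`-quantifier-free objects. -/
def IsGoedel.quantifierFree (h : IsGoedel p F) :
    (prodQFProp h.sub_hasProducts).FullSubcategory ⥤ B :=
  prodQFSub h.sub_hasProducts

instance IsGoedel.quantifierFree_isFibered (h : IsGoedel p F) : h.quantifierFree.IsFibered :=
  prodQFSub_isFibered h.sub_hasProducts

end Subfibrations
section Pullbacks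

variable {B : Type u₁} [Category.{v₁} B] {F : MorphismProperty B} [IsDisplayMapClass F]

/-- The chosen pullback of a display map `h : Y ⟶ J` along `f : I ⟶ J`. -/
noncomputable def pb {I J Y : B} {h : Y ⟶ J} (hh : F h) (f : I ⟶ J) : B :=
  haveI := MorphismProperty.HasPullbacks.hasPullback (P := F) f hh
  pullback h f

/-- The projection of the chosen pullback to the domain of the display map. -/
noncomputable def pbTop {I J Y : B} {h : Y ⟶ J} (hh : F h) (f : I ⟶ J) : pb hh f ⟶ Y :=
  haveI := MorphismProperty.HasPullbacks.hasPullback (P := F) f hh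
  pullback.fst h f

/-- The projection of the chosen pullback to the new base; it is again a display map. -/
noncomputable def pbBase {I J Y : B} {h : Y ⟶ J} (hh : F h) (f : I ⟶ J) : pb hh f ⟶ I :=
  haveI := MorphismProperty.HasPullbacks.hasPullback (P := F) f hh
  pullback.snd h f

lemma pb_isPullback {I J Y : B} {h : Y ⟶ J} (hh : F h) (f : I ⟶ J) :
    IsPullback (pbTop hh f) (pbBase hh f) h f :=
  haveI := MorphismProperty.HasPullbacks.hasPullback (P := F) f hh
  IsPullback.of_hasPullback h f

lemma pbBase_mem {I J Y : B} {h : Y ⟶ J} (hh : F h) (f : I ⟶ J) : F (pbBase hh f) :=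
  F.of_isPullback (pb_isPullback hh f) hh

/-- The map into the chosen pullback. -/
noncomputable def pbLift {I J Y T : B} {h : Y ⟶ J} (hh : F h) (f : I ⟶ J) (s : T ⟶ Y)
    (t : T ⟶ I) (w : s ≫ h = t ≫ f) : T ⟶ pb hh f :=
  (pb_isPullback hh f).lift s t w

@[simp]
lemma pbLift_top {I J Y T : B} {h : Y ⟶ J} (hh : F h) (f : I ⟶ J) (s : T ⟶ Y)
    (t : T ⟶ I) (w : s ≫ h = t ≫ f) : pbLift hh f s t w ≫ pbTop hh f = s :=
  (pb_isPullback hh f).lift_fst s t w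

@[simp]
lemma pbLift_top_assoc {I J Y T Z : B} {h : Y ⟶ J} (hh : F h) (f : I ⟶ J) (s : T ⟶ Y)
    (t : T ⟶ I) (w : s ≫ h = t ≫ f) (k : Y ⟶ Z) :
    pbLift hh f s t w ≫ pbTop hh f ≫ k = s ≫ k := by
  rw [← Category.assoc, pbLift_top]

@[simp]
lemma pbLift_base {I J Y T : B} {h : Y ⟶ J} (hh : F h) (f : I ⟶ J) (s : T ⟶ Y)
    (t : T ⟶ I) (w : s ≫ h = t ≫ f) : pbLift hh f s t w ≫ pbBase hh f = t :=
  (pb_isPullback hh f).lift_snd s t w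

lemma pb_hom_ext {I J Y T : B} {h : Y ⟶ J} {hh : F h} {f : I ⟶ J} {k l : T ⟶ pb hh f}
    (h₁ : k ≫ pbTop hh f = l ≫ pbTop hh f) (h₂ : k ≫ pbBase hh f = l ≫ pbBase hh f) : k = l :=
  (pb_isPullback hh f).hom_ext h₁ h₂

lemma pb_w {I J Y : B} {h : Y ⟶ J} (hh : F h) (f : I ⟶ J) :
    pbTop hh f ≫ h = pbBase hh f ≫ f :=
  (pb_isPullback hh f).w

end Pullbacks

section Sigma

variable {B : Type u₁} [Category.{v₁} B] {E : Type u₂} [Category.{v₂} E]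

/-- Objects of the `Σ_F`-completion: pairs of a display map `map : dom ⟶ base` and an object of the
fibre over `dom`. -/
structure SigmaCat (p : E ⥤ B) (F : MorphismProperty B) where
  {base : B}
  {dom : B}
  map : dom ⟶ base
  mem : F map
  fib : p.Fiber dom

variable {p : E ⥤ B} {F : MorphismProperty B}

/-- Morphisms of the `Σ_F`-completion: commutative squares in the base together with a map
over the top side. -/
@[ext]
structure SigmaHom (X Y : SigmaCat p F) where
  base : X.base ⟶ Y.base
  top : X.dom ⟶ Y.dom
  w : X.map ≫ base = top ≫ Y.map
  fib : X.fib.1 ⟶ Y.fib.1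
  isHomLift : p.IsHomLift top fib

instance : Category (SigmaCat p F) where
  Hom := SigmaHom
  id X := ⟨𝟙 _, 𝟙 _, by simp, 𝟙 _, IsHomLift.id X.fib.2⟩
  comp f g := ⟨f.base ≫ g.base, f.top ≫ g.top, by rw [← Category.assoc, f.w, Category.assoc, g.w,
    Category.assoc], f.fib ≫ g.fib, by
      have := f.isHomLift
      have := g.isHomLift
      exact IsHomLift.comp p _ _ _ _⟩
  id_comp f := SigmaHom.ext (Category.id_comp _) (Category.id_comp _) (Category.id_comp _)
  comp_id f := SigmaHom.ext (Category.comp_id _) (Category.comp_id _) (Category.comp_id _)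
  assoc f g h := SigmaHom.ext (Category.assoc _ _ _) (Category.assoc _ _ _) (Category.assoc _ _ _)

variable (p F) in
/-- The `Σ_F`-completion of `p`. -/
def sigmaFib : SigmaCat p F ⥤ B where
  obj X := X.base
  map f := SigmaHom.base f

instance sigmaFib_isFibered [p.IsFibered] [IsDisplayMapClass F] : (sigmaFib p F).IsFibered := by
  apply Functor.IsFibered.of_exists_isStronglyCartesian
  intro X R f
  let f' : R ⟶ X.base := f
  let Y : SigmaCat p F := ⟨pbBase X.mem f', pbBase_mem X.mem f', reindexObj p (pbTop X.mem f') X.fib⟩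
  let c : Y ⟶ X := SigmaHom.mk f' (pbTop X.mem f') (pb_w X.mem f').symm
    (cartLift p (pbTop X.mem f') X.fib) inferInstance
  refine ⟨Y, c, ?_⟩
  exact
    { toIsHomLift := IsHomLift.map (sigmaFib p F) c
      universal_property' := by
        intro Z g φ hφ
        have hb : g ≫ f' = SigmaHom.base φ :=
          IsHomLift.eq_of_isHomLift (sigmaFib p F) (g ≫ f') φ
        have := SigmaHom.isHomLift φ
        have hw : SigmaHom.top φ ≫ X.map = (Z.map ≫ g) ≫ f' := by
          rw [← SigmaHom.w φ, ← hb]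
          exact (Category.assoc _ _ _).symm
        let k := pbLift X.mem f' (SigmaHom.top φ) (Z.map ≫ g) hw
        have hk : SigmaHom.top φ = k ≫ pbTop X.mem f' := (pbLift_top _ _ _ _ _).symm
        obtain ⟨χ, ⟨hχ, hχ'⟩, huniq⟩ := Functor.IsStronglyCartesian.universal_property p
          (pbTop X.mem f') (cartLift p (pbTop X.mem f') X.fib) k _ hk (SigmaHom.fib φ)
        let d : Z ⟶ Y := SigmaHom.mk g k (pbLift_base _ _ _ _ _).symm χ hχ
        refine ⟨d, ⟨IsHomLift.map (sigmaFib p F) d, SigmaHom.ext hb hk.symm hχ'⟩, ?_⟩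
        rintro ψ ⟨hψ, rfl⟩
        have hg : g = SigmaHom.base ψ := @IsHomLift.eq_of_isHomLift _ _ _ _ (sigmaFib p F) _ _ g ψ hψ
        have ht : SigmaHom.top ψ = k := by
          apply pb_hom_ext
          · exact hk
          · rw [pbLift_base, hg]
            exact (SigmaHom.w ψ).symm
        exact SigmaHom.ext hg.symm ht (huniq _ ⟨ht ▸ SigmaHom.isHomLift ψ, rfl⟩) }

end Sigma

section Pi

variable {B : Type u₁} [Category.{v₁} B] {E : Type u₂} [Category.{v₂} E]

/-- Objects of the `Π_F`-completion: pairs of a display map `map : dom ⟶ base` and an object of the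
fibre over `dom`. -/
structure PiCat (p : E ⥤ B) (F : MorphismProperty B) where
  {base : B}
  {dom : B}
  map : dom ⟶ base
  mem : F map
  fib : p.Fiber dom

variable {p : E ⥤ B} [p.IsFibered] {F : MorphismProperty B} [IsDisplayMapClass F]

/-- Morphisms `(g : X ⟶ I, α) ⟶ (h : Y ⟶ J, β)` of the `Π_F`-completion: a map `base : I ⟶ J`, a
map `idx : I ×_J Y ⟶ X` over `I`, and a vertical map `idx^* α ⟶ pr^* β` over `I ×_J Y`, where
`pr : I ×_J Y ⟶ Y` is the projection. -/
structure PiHom (X Y : PiCat p F) where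
  base : X.base ⟶ Y.base
  idx : pb Y.mem base ⟶ X.dom
  w : idx ≫ X.map = pbBase Y.mem base
  fib : reindexObj p idx X.fib ⟶ reindexObj p (pbTop Y.mem base) Y.fib

namespace PiHom

variable {X Y Z W : PiCat p F}

/-- The map `T ⟶ X.dom` induced by `f.idx` and a map `(s, t) : T ⟶ I ×_J Y.dom`. -/
noncomputable def idxAt (f : PiHom X Y) {T : B} (s : T ⟶ Y.dom) (t : T ⟶ X.base)
    (w : s ≫ Y.map = t ≫ f.base) : T ⟶ X.dom :=
  pbLift Y.mem f.base s t w ≫ f.idx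

lemma idxAt_map (f : PiHom X Y) {T : B} (s : T ⟶ Y.dom) (t : T ⟶ X.base)
    (w : s ≫ Y.map = t ≫ f.base) : f.idxAt s t w ≫ X.map = t := by
  rw [idxAt, Category.assoc, f.w, pbLift_base]

lemma idxAt_self (f : PiHom X Y) : f.idxAt (pbTop _ _) (pbBase _ _) (pb_w _ _) = f.idx := by
  have : pbLift Y.mem f.base (pbTop _ _) (pbBase _ _) (pb_w _ _) = 𝟙 _ :=
    pb_hom_ext (by simp) (by simp)
  rw [idxAt, this, Category.id_comp]

lemma idxAt_natural (f : PiHom X Y) {T T' : B} (k : T' ⟶ T) (s : T ⟶ Y.dom) (t : T ⟶ X.base)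
    (w : s ≫ Y.map = t ≫ f.base) {s' : T' ⟶ Y.dom} {t' : T' ⟶ X.base} (hs : s' = k ≫ s)
    (ht : t' = k ≫ t) (w' : s' ≫ Y.map = t' ≫ f.base) :
    f.idxAt s' t' w' = k ≫ f.idxAt s t w := by
  subst hs ht
  have : pbLift Y.mem f.base (k ≫ s) (k ≫ t) w' = k ≫ pbLift Y.mem f.base s t w :=
    pb_hom_ext (by simp) (by simp)
  rw [idxAt, this, Category.assoc, idxAt]

lemma idxAt_congr (f : PiHom X Y) {T : B} {s s' : T ⟶ Y.dom} {t t' : T ⟶ X.base}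
    (hs : s = s') (ht : t = t') (w : s ≫ Y.map = t ≫ f.base) (w' : s' ≫ Y.map = t' ≫ f.base) :
    f.idxAt s t w = f.idxAt s' t' w' := by
  subst hs ht
  rfl

/-- The map `c ⟶ Y.fib` obtained from `α : c ⟶ X.fib` over `f.idxAt s t w`, by factoring `α`
through the cartesian lifting of `f.idx` and composing with `f.fib`. -/
noncomputable def actAt (f : PiHom X Y) {T : B} (s : T ⟶ Y.dom) (t : T ⟶ X.base)
    (w : s ≫ Y.map = t ≫ f.base) {c : E} (α : c ⟶ X.fib.1)
    (hα : p.IsHomLift (f.idxAt s t w) α) : c ⟶ Y.fib.1 :=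
  Functor.IsStronglyCartesian.map p f.idx (cartLift p f.idx X.fib)
    (g := pbLift Y.mem f.base s t w) (f' := f.idxAt s t w) rfl α ≫ total f.fib

lemma actAt_isHomLift (f : PiHom X Y) {T : B} (s : T ⟶ Y.dom) (t : T ⟶ X.base)
    (w : s ≫ Y.map = t ≫ f.base) {c : E} (α : c ⟶ X.fib.1)
    (hα : p.IsHomLift (f.idxAt s t w) α) : p.IsHomLift s (f.actAt s t w α hα) := by
  have h₁ := total_isHomLift p f.fib
  have h₂ := Functor.IsStronglyCartesian.map_isHomLift p f.idx (cartLift p f.idx X.fib)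
    (g := pbLift Y.mem f.base s t w) (f' := f.idxAt s t w) rfl α
  have := @IsHomLift.comp _ _ _ _ p _ _ _ _ _ _ _ _ _ _ h₂ h₁
  rwa [pbLift_top] at this

lemma actAt_congr (f : PiHom X Y) {T : B} {s s' : T ⟶ Y.dom} {t t' : T ⟶ X.base}
    (hs : s = s') (ht : t = t') (w : s ≫ Y.map = t ≫ f.base) (w' : s' ≫ Y.map = t' ≫ f.base)
    {c : E} {α α' : c ⟶ X.fib.1} (h : α = α') (hα : p.IsHomLift (f.idxAt s t w) α)
    (hα' : p.IsHomLift (f.idxAt s' t' w') α') :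
    f.actAt s t w α hα = f.actAt s' t' w' α' hα' := by
  subst hs ht h
  rfl

lemma actAt_eq (f : PiHom X Y) {T : B} (s : T ⟶ Y.dom) (t : T ⟶ X.base)
    (w : s ≫ Y.map = t ≫ f.base) {c : E} (α : c ⟶ X.fib.1)
    (hα : p.IsHomLift (f.idxAt s t w) α) (β : c ⟶ (reindexObj p f.idx X.fib).1)
    (hβ : p.IsHomLift (pbLift Y.mem f.base s t w) β) (h : β ≫ cartLift p f.idx X.fib = α) :
    f.actAt s t w α hα = β ≫ total f.fib :=
  congrArg (· ≫ total f.fib) (Functor.IsStronglyCartesian.map_uniq p f.idx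
    (cartLift p f.idx X.fib) (f' := f.idxAt s t w) rfl α β h).symm

lemma exists_actAt (f : PiHom X Y) {T : B} (s : T ⟶ Y.dom) (t : T ⟶ X.base)
    (w : s ≫ Y.map = t ≫ f.base) {c : E} (α : c ⟶ X.fib.1)
    (hα : p.IsHomLift (f.idxAt s t w) α) : ∃ β : c ⟶ (reindexObj p f.idx X.fib).1,
      p.IsHomLift (pbLift Y.mem f.base s t w) β ∧ β ≫ cartLift p f.idx X.fib = α ∧
      f.actAt s t w α hα = β ≫ total f.fib := by
  obtain ⟨β, ⟨h₁, h₂⟩, -⟩ := Functor.IsStronglyCartesian.universal_property p f.idx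
    (cartLift p f.idx X.fib) (pbLift Y.mem f.base s t w) (f.idxAt s t w) rfl α
  exact ⟨β, h₁, h₂, f.actAt_eq s t w α hα β h₁ h₂⟩

lemma actAt_natural (f : PiHom X Y) {T T' : B} (k : T' ⟶ T) (s : T ⟶ Y.dom) (t : T ⟶ X.base)
    (w : s ≫ Y.map = t ≫ f.base) {c c' : E} (β : c' ⟶ c) (hβ : p.IsHomLift k β)
    (α : c ⟶ X.fib.1) (hα : p.IsHomLift (f.idxAt s t w) α)
    {s' : T' ⟶ Y.dom} {t' : T' ⟶ X.base} (hs : s' = k ≫ s)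
    (ht : t' = k ≫ t) (w' : s' ≫ Y.map = t' ≫ f.base) {α' : c' ⟶ X.fib.1} (h : α' = β ≫ α)
    (hα' : p.IsHomLift (f.idxAt s' t' w') α') :
    f.actAt s' t' w' α' hα' = β ≫ f.actAt s t w α hα := by
  subst hs ht h
  have : pbLift Y.mem f.base (k ≫ s) (k ≫ t) w' = k ≫ pbLift Y.mem f.base s t w :=
    pb_hom_ext (by simp) (by simp)
  obtain ⟨γ, hγ, h₁, h₂⟩ := f.exists_actAt s t w α hα
  rw [h₂, ← Category.assoc]
  refine f.actAt_eq _ _ _ _ _ _ (this ▸ IsHomLift.comp p _ _ _ _) ?_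
  exact (Category.assoc _ _ _).trans (congrArg (β ≫ ·) h₁)

lemma actAt_self (f : PiHom X Y) {α : (reindexObj p f.idx X.fib).1 ⟶ X.fib.1}
    (h : α = cartLift p f.idx X.fib)
    (hα : p.IsHomLift (f.idxAt (pbTop Y.mem f.base) (pbBase Y.mem f.base) (pb_w _ _)) α) :
    f.actAt (pbTop Y.mem f.base) (pbBase Y.mem f.base) (pb_w _ _) α hα = total f.fib := by
  subst h
  have e : pbLift Y.mem f.base (pbTop Y.mem f.base) (pbBase Y.mem f.base) (pb_w _ _) = 𝟙 _ :=
    pb_hom_ext (by simp) (by simp)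
  have h₁ : p.IsHomLift
      (pbLift Y.mem f.base (pbTop Y.mem f.base) (pbBase Y.mem f.base) (pb_w _ _))
      (𝟙 (reindexObj p f.idx X.fib).1) := by
    rw [e]
    exact IsHomLift.id (reindexObj p f.idx X.fib).2
  rw [f.actAt_eq _ _ _ _ hα _ h₁ (Category.id_comp _)]
  exact Category.id_comp _

lemma ext_at {f g : PiHom X Y} (hb : f.base = g.base)
    (hi : ∀ {T : B} (s : T ⟶ Y.dom) (t : T ⟶ X.base) (w : s ≫ Y.map = t ≫ f.base)
      (w' : s ≫ Y.map = t ≫ g.base), f.idxAt s t w = g.idxAt s t w')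
    (hact : ∀ {T : B} (s : T ⟶ Y.dom) (t : T ⟶ X.base) (w : s ≫ Y.map = t ≫ f.base)
      (w' : s ≫ Y.map = t ≫ g.base) {c : E} (α : c ⟶ X.fib.1)
      (hα : p.IsHomLift (f.idxAt s t w) α) (hα' : p.IsHomLift (g.idxAt s t w') α),
      f.actAt s t w α hα = g.actAt s t w' α hα') : f = g := by
  have hi' := hi (pbTop _ _) (pbBase _ _) (pb_w Y.mem f.base)
  obtain ⟨b, i, w, φ⟩ := f
  obtain ⟨b', i', w', φ'⟩ := g
  obtain rfl : b = b' := hb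
  obtain rfl : i = i' :=
    ((idxAt_self ⟨b, i, w, φ⟩).symm.trans (hi' (pb_w _ _))).trans (idxAt_self ⟨b, i', w', φ'⟩)
  congr 1
  have h₁ : p.IsHomLift
      ((⟨b, i, w, φ⟩ : PiHom X Y).idxAt (pbTop Y.mem b) (pbBase Y.mem b) (pb_w _ _))
      (cartLift p i X.fib) := by
    rw [idxAt_self]
    infer_instance
  have := hact (pbTop _ _) (pbBase _ _) (pb_w _ _) (pb_w _ _) (cartLift p i X.fib) h₁ h₁
  exact total_ext (((actAt_self ⟨b, i, w, φ⟩ rfl h₁).symm.trans this).trans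
    (actAt_self ⟨b, i, w, φ'⟩ rfl h₁))

/-- The identity. -/
noncomputable def id (X : PiCat p F) : PiHom X X where
  base := 𝟙 _
  idx := pbTop X.mem _
  w := by rw [pb_w, Category.comp_id]
  fib := 𝟙 _

lemma id_idxAt {T : B} (s : T ⟶ X.dom) (t : T ⟶ X.base) (w : s ≫ X.map = t ≫ 𝟙 X.base) :
    (id X).idxAt s t w = s :=
  pbLift_top _ _ _ _ _

lemma id_actAt {T : B} (s : T ⟶ X.dom) (t : T ⟶ X.base) (w : s ≫ X.map = t ≫ 𝟙 X.base)
    {c : E} (α : c ⟶ X.fib.1) (hα : p.IsHomLift ((id X).idxAt s t w) α) :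
    (id X).actAt s t w α hα = α := by
  have : total (id X).fib = cartLift p (pbTop X.mem _) X.fib := Category.id_comp _
  unfold actAt
  rw [this]
  exact Functor.IsStronglyCartesian.fac p _ _ _ _

lemma comp_w (f : PiHom X Y) (g : PiHom Y Z) {T : B} {s : T ⟶ Z.dom} {t : T ⟶ X.base}
    (w : s ≫ Z.map = t ≫ f.base ≫ g.base) : s ≫ Z.map = (t ≫ f.base) ≫ g.base :=
  w.trans (Category.assoc _ _ _).symm

/-- Composition, over `I ⟶ J ⟶ K`. With `P = I ×_K Z.dom`, the map `P ⟶ X.dom` is induced by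
`g.idx : J ×_K Z.dom ⟶ Y.dom` and `f.idx : I ×_J Y.dom ⟶ X.dom`, and the vertical part is the
composite of the reindexings to `P` of `f.fib` and `g.fib`: it corresponds to the map to `Z.fib`
over `P ⟶ Z.dom` obtained from the cartesian lifting at `X.fib` by acting with `f` and then
with `g`. -/
noncomputable def comp (f : PiHom X Y) (g : PiHom Y Z) : PiHom X Z where
  base := f.base ≫ g.base
  idx := f.idxAt (g.idxAt (pbTop _ _) (pbBase _ _ ≫ f.base) (comp_w f g (pb_w _ _))) (pbBase _ _)
    (idxAt_map _ _ _ _)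
  w := idxAt_map _ _ _ _
  fib := vertLift p _
    (g.actAt (pbTop _ _) (pbBase _ _ ≫ f.base) (comp_w f g (pb_w _ _))
      (f.actAt _ (pbBase _ _) (idxAt_map _ _ _ _) (cartLift p _ X.fib) inferInstance)
      (actAt_isHomLift _ _ _ _ _ _))
    (actAt_isHomLift _ _ _ _ _ _)

lemma comp_idxAt (f : PiHom X Y) (g : PiHom Y Z) {T : B} (s : T ⟶ Z.dom) (t : T ⟶ X.base)
    (w : s ≫ Z.map = t ≫ f.base ≫ g.base) :
    (comp f g).idxAt s t w =
      f.idxAt (g.idxAt s (t ≫ f.base) (comp_w f g w)) t (idxAt_map _ _ _ _) := by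
  have h₁ : pbLift Z.mem (f.base ≫ g.base) s t w ≫ pbTop _ _ = s := pbLift_top _ _ _ _ _
  have h₂ : pbLift Z.mem (f.base ≫ g.base) s t w ≫ pbBase _ _ = t := pbLift_base _ _ _ _ _
  symm
  refine f.idxAt_natural (pbLift Z.mem (f.base ≫ g.base) s t w) _ _ _ ?_ h₂.symm _
  exact g.idxAt_natural (pbLift Z.mem (f.base ≫ g.base) s t w) _ _ _ h₁.symm
    (by rw [← Category.assoc, h₂]) _

lemma comp_actAt (f : PiHom X Y) (g : PiHom Y Z) {T : B} (s : T ⟶ Z.dom) (t : T ⟶ X.base)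
    (w : s ≫ Z.map = t ≫ f.base ≫ g.base) {c : E} (α : c ⟶ X.fib.1)
    (hα : p.IsHomLift ((comp f g).idxAt s t w) α)
    (hα' : p.IsHomLift (f.idxAt (g.idxAt s (t ≫ f.base) (comp_w f g w)) t
      (idxAt_map _ _ _ _)) α) :
    (comp f g).actAt s t w α hα =
      g.actAt s (t ≫ f.base) (comp_w f g w)
        (f.actAt (g.idxAt s (t ≫ f.base) (comp_w f g w)) t (idxAt_map _ _ _ _) α hα')
        (actAt_isHomLift _ _ _ _ _ _) := by
  have h₁ : pbLift Z.mem (f.base ≫ g.base) s t w ≫ pbTop _ _ = s := pbLift_top _ _ _ _ _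
  have h₂ : pbLift Z.mem (f.base ≫ g.base) s t w ≫ pbBase _ _ = t := pbLift_base _ _ _ _ _
  have ht : total (comp f g).fib = _ := total_vertLift p _ _ _
  obtain ⟨β, hβ, h₃, h₄⟩ := (comp f g).exists_actAt s t w α hα
  rw [h₄, ht]
  have h₂' : t ≫ f.base = pbLift Z.mem (f.base ≫ g.base) s t w ≫ pbBase _ _ ≫ f.base := by
    rw [← Category.assoc, h₂]
  symm
  refine g.actAt_natural _ _ _ _ β hβ _ _ h₁.symm h₂' _ ?_ _
  refine f.actAt_natural _ _ _ _ β hβ _ _ ?_ h₂.symm _ h₃.symm _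
  exact g.idxAt_natural _ _ _ _ h₁.symm h₂' _

/-- The domain of the cartesian lifting of `f : R ⟶ Y.base` in the `Π_F`-completion. -/
noncomputable def liftDom (Y : PiCat p F) {R : B} (f : R ⟶ Y.base) : PiCat p F :=
  ⟨pbBase Y.mem f, pbBase_mem Y.mem f, reindexObj p (pbTop Y.mem f) Y.fib⟩

/-- The cartesian lifting of `f : R ⟶ Y.base` in the `Π_F`-completion. -/
noncomputable def lift (Y : PiCat p F) {R : B} (f : R ⟶ Y.base) : PiHom (liftDom Y f) Y where
  base := f
  idx := 𝟙 (pb Y.mem f)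
  w := Category.id_comp _
  fib := ⟨cartLift p (𝟙 (pb Y.mem f)) (reindexObj p (pbTop Y.mem f) Y.fib),
    (cartLift_isCartesian p (𝟙 (pb Y.mem f)) _).toIsHomLift⟩

lemma lift_idxAt {R : B} (f : R ⟶ Y.base) {T : B} (s : T ⟶ Y.dom) (t : T ⟶ R)
    (w : s ≫ Y.map = t ≫ f) : (lift Y f).idxAt s t w = pbLift Y.mem f s t w :=
  Category.comp_id _

lemma lift_actAt {R : B} (f : R ⟶ Y.base) {T : B} (s : T ⟶ Y.dom) (t : T ⟶ R)
    (w : s ≫ Y.map = t ≫ f) {c : E} (α : c ⟶ (reindexObj p (pbTop Y.mem f) Y.fib).1)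
    (hα : p.IsHomLift ((lift Y f).idxAt s t w) α) :
    (lift Y f).actAt s t w α hα = α ≫ cartLift p (pbTop Y.mem f) Y.fib := by
  obtain ⟨β, h₁, h₂, h₃⟩ := (lift Y f).exists_actAt s t w α hα
  rw [h₃]
  exact (Category.assoc _ _ _).symm.trans (congrArg (· ≫ cartLift p (pbTop Y.mem f) Y.fib) h₂)

lemma lift_w {R : B} (f : R ⟶ Y.base) {g : W.base ⟶ R} {T : B} {s : T ⟶ pb Y.mem f}
    {t : T ⟶ W.base} (w : s ≫ pbBase Y.mem f = t ≫ g) :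
    (s ≫ pbTop Y.mem f) ≫ Y.map = t ≫ g ≫ f := by
  rw [Category.assoc, pb_w, ← Category.assoc, w, Category.assoc]

lemma idxAt_eq_comp_lift {R : B} (f : R ⟶ Y.base) (χ : PiHom W (liftDom Y f)) {T : B}
    (s : T ⟶ pb Y.mem f) (t : T ⟶ W.base) (w : s ≫ pbBase Y.mem f = t ≫ χ.base) :
    χ.idxAt s t w = (comp χ (lift Y f)).idxAt (s ≫ pbTop Y.mem f) t (lift_w f w) := by
  refine Eq.trans ?_ (comp_idxAt χ (lift Y f) _ _ _).symm
  refine χ.idxAt_congr ?_ rfl _ _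
  refine Eq.trans ?_ (lift_idxAt f _ _ _).symm
  exact pb_hom_ext (pbLift_top _ _ _ _ _).symm (w.trans (pbLift_base _ _ _ _ _).symm)

lemma actAt_eq_comp_lift {R : B} (f : R ⟶ Y.base) (χ : PiHom W (liftDom Y f)) {T : B}
    (s : T ⟶ pb Y.mem f) (t : T ⟶ W.base) (w : s ≫ pbBase Y.mem f = t ≫ χ.base) {c : E}
    (α : c ⟶ W.fib.1) (hα : p.IsHomLift (χ.idxAt s t w) α)
    (hα' : p.IsHomLift ((comp χ (lift Y f)).idxAt (s ≫ pbTop Y.mem f) t (lift_w f w)) α) :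
    χ.actAt s t w α hα ≫ cartLift p (pbTop Y.mem f) Y.fib =
      (comp χ (lift Y f)).actAt (s ≫ pbTop Y.mem f) t (lift_w f w) α hα' := by
  refine Eq.trans ?_ (comp_actAt χ (lift Y f) _ _ _ α _
    (comp_idxAt χ (lift Y f) _ _ (lift_w f w) ▸ hα')).symm
  refine Eq.trans ?_ (lift_actAt f _ _ _ _ _).symm
  refine congrArg (· ≫ cartLift p (pbTop Y.mem f) Y.fib) ?_
  refine χ.actAt_congr ?_ rfl _ _ rfl _ _
  refine Eq.trans ?_ (lift_idxAt f _ _ _).symm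
  exact pb_hom_ext (pbLift_top _ _ _ _ _).symm (w.trans (pbLift_base _ _ _ _ _).symm)

lemma idxAt_of_eq {f g : PiHom X Y} (h : f = g) {T : B} (s : T ⟶ Y.dom) (t : T ⟶ X.base)
    (w : s ≫ Y.map = t ≫ f.base) (w' : s ≫ Y.map = t ≫ g.base) :
    f.idxAt s t w = g.idxAt s t w' := by
  subst h
  rfl

lemma actAt_of_eq {f g : PiHom X Y} (h : f = g) {T : B} (s : T ⟶ Y.dom) (t : T ⟶ X.base)
    (w : s ≫ Y.map = t ≫ f.base) (w' : s ≫ Y.map = t ≫ g.base) {c : E} (α : c ⟶ X.fib.1)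
    (hα : p.IsHomLift (f.idxAt s t w) α) (hα' : p.IsHomLift (g.idxAt s t w') α) :
    f.actAt s t w α hα = g.actAt s t w' α hα' := by
  subst h
  rfl

lemma lift_hom_ext {R : B} (f : R ⟶ Y.base) {χ χ' : PiHom W (liftDom Y f)}
    (hb : χ.base = χ'.base) (h : comp χ (lift Y f) = comp χ' (lift Y f)) : χ = χ' := by
  refine ext_at hb (fun s t w w' => ?_) (fun s t w w' c α hα hα' => ?_)
  · rw [idxAt_eq_comp_lift f χ s t w, idxAt_eq_comp_lift f χ' s t w']
    exact idxAt_of_eq h _ _ _ _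
  · have h₁ := actAt_isHomLift _ _ _ _ _ hα
    have h₂ := actAt_isHomLift _ _ _ _ _ hα'
    refine @Functor.IsStronglyCartesian.ext _ _ _ _ p _ _ _ _ (pbTop Y.mem f)
      (cartLift p (pbTop Y.mem f) Y.fib) inferInstance _ _ s _ _ h₁ h₂ ?_
    refine (actAt_eq_comp_lift f χ s t w α hα (idxAt_eq_comp_lift f χ s t w ▸ hα)).trans ?_
    refine Eq.trans ?_
      (actAt_eq_comp_lift f χ' s t w' α hα' (idxAt_eq_comp_lift f χ' s t w' ▸ hα')).symm
    exact actAt_of_eq h _ _ _ _ _ _ _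

lemma exists_lift {R : B} (f : R ⟶ Y.base) (ψ : PiHom W Y) (g : W.base ⟶ R)
    (hb : ψ.base = g ≫ f) : ∃ χ : PiHom W (liftDom Y f), χ.base = g ∧ comp χ (lift Y f) = ψ := by
  have w₀ {T : B} {s : T ⟶ pb Y.mem f} {t : T ⟶ W.base} (w : s ≫ pbBase Y.mem f = t ≫ g) :
      (s ≫ pbTop Y.mem f) ≫ Y.map = t ≫ ψ.base := hb ▸ lift_w f w
  have w₁ := w₀ (pb_w (pbBase_mem Y.mem f) g)
  let i := ψ.idxAt (pbTop (pbBase_mem Y.mem f) g ≫ pbTop Y.mem f) (pbBase (pbBase_mem Y.mem f) g) w₁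
  have hφ := ψ.actAt_isHomLift _ _ w₁ (cartLift p i W.fib) inferInstance
  obtain ⟨φ, ⟨h₁, h₂⟩, -⟩ := Functor.IsStronglyCartesian.universal_property p (pbTop Y.mem f)
    (cartLift p (pbTop Y.mem f) Y.fib) (pbTop (pbBase_mem Y.mem f) g) _ rfl
    (ψ.actAt _ _ w₁ (cartLift p i W.fib) inferInstance)
  let χ : PiHom W (liftDom Y f) := ⟨g, i, idxAt_map _ _ _ _, vertLift p _ φ h₁⟩
  have hχ : total χ.fib = φ := total_vertLift p _ _ _
  have hi {T : B} (s : T ⟶ pb Y.mem f) (t : T ⟶ W.base) (w : s ≫ pbBase Y.mem f = t ≫ g) :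
      χ.idxAt s t w = ψ.idxAt (s ≫ pbTop Y.mem f) t (w₀ w) := by
    refine (ψ.idxAt_natural (pbLift (pbBase_mem Y.mem f) g s t w) _ _ w₁ ?_ ?_ _).symm
    · rw [pbLift_top_assoc]
    · rw [pbLift_base]
  have ha {T : B} (s : T ⟶ pb Y.mem f) (t : T ⟶ W.base) (w : s ≫ pbBase Y.mem f = t ≫ g) {c : E}
      (α : c ⟶ W.fib.1) (hα : p.IsHomLift (χ.idxAt s t w) α)
      (hα' : p.IsHomLift (ψ.idxAt (s ≫ pbTop Y.mem f) t (w₀ w)) α) :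
      χ.actAt s t w α hα ≫ cartLift p (pbTop Y.mem f) Y.fib =
        ψ.actAt (s ≫ pbTop Y.mem f) t (w₀ w) α hα' := by
    obtain ⟨β, k₁, k₂, k₃⟩ := χ.exists_actAt s t w α hα
    rw [k₃, hχ]
    refine (Category.assoc _ _ _).trans ((congrArg (β ≫ ·) h₂).trans ?_)
    symm
    refine ψ.actAt_natural (pbLift (pbBase_mem Y.mem f) g s t w) _ _ w₁ β k₁ _ _
      ?_ ?_ _ k₂.symm _
    · rw [pbLift_top_assoc]
    · rw [pbLift_base]
  have hs {T : B} (s : T ⟶ Y.dom) (t : T ⟶ W.base) (w : s ≫ Y.map = t ≫ g ≫ f) :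
      (lift Y f).idxAt s (t ≫ g) (comp_w χ (lift Y f) w) ≫ pbTop Y.mem f = s :=
    (congrArg (· ≫ pbTop Y.mem f) (lift_idxAt f _ _ _)).trans (pbLift_top _ _ _ _ _)
  refine ⟨χ, rfl, ?_⟩
  refine ext_at hb.symm (fun s t w w' => ?_) (fun s t w w' c α hα hα' => ?_)
  · refine (comp_idxAt χ (lift Y f) s t w).trans ((hi _ _ _).trans ?_)
    exact ψ.idxAt_congr (hs s t w) rfl _ _
  · have e₁ := comp_idxAt χ (lift Y f) s t w
    have e₂ := hi ((lift Y f).idxAt s (t ≫ g) (comp_w χ (lift Y f) w)) t (idxAt_map _ _ _ _)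
    refine (comp_actAt χ (lift Y f) s t w α hα (e₁ ▸ hα)).trans ?_
    refine (lift_actAt f _ _ _ _ _).trans ?_
    refine (ha _ _ _ α _ (e₂ ▸ e₁ ▸ hα)).trans ?_
    exact ψ.actAt_congr (hs s t w) rfl _ _ rfl _ _

end PiHom

noncomputable instance : Category (PiCat p F) where
  Hom := PiHom
  id := PiHom.id
  comp := PiHom.comp
  id_comp {X Y} f := by
    have hi {T : B} (s : T ⟶ Y.dom) (t : T ⟶ X.base) (w : s ≫ Y.map = t ≫ 𝟙 X.base ≫ f.base)
        (w' : s ≫ Y.map = t ≫ f.base) :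
        f.idxAt s (t ≫ 𝟙 X.base) (PiHom.comp_w (PiHom.id X) f w) = f.idxAt s t w' :=
      f.idxAt_congr rfl (Category.comp_id _) _ _
    refine PiHom.ext_at (Category.id_comp _) (fun s t w w' => ?_)
      (fun s t w w' c α hα hα' => ?_)
    · rw [PiHom.comp_idxAt (PiHom.id X) f s t w]
      exact (PiHom.id_idxAt _ _ _).trans (hi s t w w')
    · have e := PiHom.comp_idxAt (PiHom.id X) f s t w
      refine (PiHom.comp_actAt (PiHom.id X) f s t w α hα (e ▸ hα)).trans ?_
      exact f.actAt_congr rfl (Category.comp_id _) _ _ (PiHom.id_actAt _ _ _ _ _) _ _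
  comp_id {X Y} f := by
    refine PiHom.ext_at (Category.comp_id _) (fun s t w w' => ?_)
      (fun s t w w' c α hα hα' => ?_)
    · refine (PiHom.comp_idxAt f (PiHom.id Y) s t w).trans ?_
      exact f.idxAt_congr (PiHom.id_idxAt _ _ _) rfl _ _
    · have e := PiHom.comp_idxAt f (PiHom.id Y) s t w
      refine (PiHom.comp_actAt f (PiHom.id Y) s t w α hα (e ▸ hα)).trans ?_
      refine (PiHom.id_actAt _ _ _ _ _).trans ?_
      exact f.actAt_congr (PiHom.id_idxAt _ _ _) rfl _ _ rfl _ _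
  assoc {W X Y Z} f g h := by
    have w₁ {T : B} {s : T ⟶ Z.dom} {t : T ⟶ W.base}
        (w : s ≫ Z.map = t ≫ (f.base ≫ g.base) ≫ h.base) :
        s ≫ Z.map = (t ≫ f.base) ≫ g.base ≫ h.base := by simpa using w
    have hk {T : B} (s : T ⟶ Z.dom) (t : T ⟶ W.base)
        (w : s ≫ Z.map = t ≫ (f.base ≫ g.base) ≫ h.base) :
        h.idxAt s (t ≫ f.base ≫ g.base) (PiHom.comp_w (PiHom.comp f g) h w) =
          h.idxAt s ((t ≫ f.base) ≫ g.base) (PiHom.comp_w g h (w₁ w)) :=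
      h.idxAt_congr rfl (Category.assoc _ _ _).symm _ _
    have e₁ {T : B} (s : T ⟶ Z.dom) (t : T ⟶ W.base)
        (w : s ≫ Z.map = t ≫ (f.base ≫ g.base) ≫ h.base) :=
      PiHom.comp_idxAt (PiHom.comp f g) h s t w
    have e₂ {T : B} (s : T ⟶ Z.dom) (t : T ⟶ W.base)
        (w : s ≫ Z.map = t ≫ (f.base ≫ g.base) ≫ h.base) :=
      PiHom.comp_idxAt f g (h.idxAt s (t ≫ f.base ≫ g.base) (PiHom.comp_w (PiHom.comp f g) h w)) t
        (PiHom.idxAt_map _ _ _ _)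
    have e₃ {T : B} (s : T ⟶ Z.dom) (t : T ⟶ W.base)
        (w : s ≫ Z.map = t ≫ f.base ≫ g.base ≫ h.base) :=
      PiHom.comp_idxAt f (PiHom.comp g h) s t w
    have e₄ {T : B} (s : T ⟶ Z.dom) (t : T ⟶ W.base)
        (w : s ≫ Z.map = t ≫ f.base ≫ g.base ≫ h.base) :=
      PiHom.comp_idxAt g h s (t ≫ f.base) (PiHom.comp_w f (PiHom.comp g h) w)
    refine PiHom.ext_at (Category.assoc _ _ _) (fun s t w w' => ?_)
      (fun s t w w' c α hα hα' => ?_)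
    · refine (e₁ s t w).trans ((e₂ s t w).trans ?_)
      refine Eq.trans ?_ (e₃ s t w').symm
      refine f.idxAt_congr ?_ rfl _ _
      refine Eq.trans ?_ (e₄ s t w').symm
      exact g.idxAt_congr (hk s t w) rfl _ _
    · refine (PiHom.comp_actAt (PiHom.comp f g) h s t w α hα (e₁ s t w ▸ hα)).trans ?_
      refine Eq.trans ?_ (PiHom.comp_actAt f (PiHom.comp g h) s t w' α hα'
        (e₃ s t w' ▸ hα')).symm
      refine Eq.trans ?_ (PiHom.comp_actAt g h s (t ≫ f.base) _ _ _ (e₄ s t w' ▸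
        PiHom.actAt_isHomLift _ _ _ _ _ _)).symm
      refine h.actAt_congr rfl (Category.assoc _ _ _).symm _ _ ?_ _ _
      refine (PiHom.comp_actAt f g _ t _ α _ (e₂ s t w ▸ e₁ s t w ▸ hα)).trans ?_
      refine g.actAt_congr (hk s t w) rfl _ _ ?_ _ _
      refine f.actAt_congr ?_ rfl _ _ rfl _ _
      refine Eq.trans ?_ (e₄ s t w').symm
      exact g.idxAt_congr (hk s t w) rfl _ _

variable (p F) in
/-- The `Π_F`-completion of `p`. -/
noncomputable def piFib : PiCat p F ⥤ B where
  obj X := X.base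
  map f := PiHom.base f

instance piFib_isFibered : (piFib p F).IsFibered := by
  apply Functor.IsFibered.of_exists_isStronglyCartesian
  intro Y R f
  let c : PiHom.liftDom Y f ⟶ Y := PiHom.lift Y f
  refine ⟨PiHom.liftDom Y f, c, ?_⟩
  exact
    { toIsHomLift := IsHomLift.map (piFib p F) c
      universal_property' := by
        intro W g ψ hψ
        have hb : g ≫ f = PiHom.base ψ := IsHomLift.eq_of_isHomLift (piFib p F) (g ≫ f) ψ
        obtain ⟨χ, hχ, hχ'⟩ := PiHom.exists_lift f ψ g hb.symm
        let d : W ⟶ PiHom.liftDom Y f := χ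
        refine ⟨d, ⟨hχ ▸ IsHomLift.map (piFib p F) d, hχ'⟩, ?_⟩
        rintro χ' ⟨h₁, h₂⟩
        have hg : g = PiHom.base χ' := @IsHomLift.eq_of_isHomLift _ _ _ _ (piFib p F) _ _ g χ' h₁
        exact PiHom.lift_hom_ext f (hg.symm.trans hχ.symm) (h₂.trans hχ'.symm) }

end Pi
section Dialectica

variable {B : Type u₁} [Category.{v₁} B] {E : Type u₂} [Category.{v₂} E]

/-- The (dependent) Dialectica fibration `Dial_F(p) = Σ_F Π_F(p)`. -/
noncomputable def dial (p : E ⥤ B) [p.IsFibered] (F : MorphismProperty B) [IsDisplayMapClass F] :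
    SigmaCat (piFib p F) F ⥤ B :=
  sigmaFib (piFib p F) F

instance dial_isFibered (p : E ⥤ B) [p.IsFibered] (F : MorphismProperty B) [IsDisplayMapClass F] :
    (dial p F).IsFibered :=
  sigmaFib_isFibered

/-- An equivalence between fibrations `p` and `q` over `B`: mutually quasi-inverse functors over
`B` that preserve cartesian maps, with vertical unit and counit. -/
structure FibredEquivalence {E' : Type u₃} [Category.{v₃} E'] (p : E ⥤ B) (q : E' ⥤ B) where
  functor : E ⥤ E'
  inverse : E' ⥤ E
  functor_comp : functor ⋙ q = p
  inverse_comp : inverse ⋙ p = q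
  map_cartesian : ∀ {I J : B} (u : I ⟶ J) {X Y : E} (φ : X ⟶ Y),
    p.IsStronglyCartesian u φ → q.IsStronglyCartesian u (functor.map φ)
  inverse_map_cartesian : ∀ {I J : B} (u : I ⟶ J) {X Y : E'} (φ : X ⟶ Y),
    q.IsStronglyCartesian u φ → p.IsStronglyCartesian u (inverse.map φ)
  unitIso : 𝟭 E ≅ functor ⋙ inverse
  counitIso : inverse ⋙ functor ≅ 𝟭 E'
  unit_vertical : ∀ X : E, p.IsHomLift (𝟙 (p.obj X)) (unitIso.hom.app X)
  counit_vertical : ∀ Y : E', q.IsHomLift (𝟙 (q.obj Y)) (counitIso.hom.app Y)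

end Dialectica

end DepDialectica

namespace DepDialectica

/-! ### Functors and equivalences over a fixed base category. -/

section Over

variable {B : Type u₁} [Category.{v₁} B] {E : Type u₂} [Category.{v₂} E]

/-! `Σ_F(q)` is a free completion of `q` under `F`-coproducts and `Π_F(q)` one under `F`-products. A
free completion can be recognised from inside: there is a supply of generators such that every map
from a generator into a coproduct picks a unique index and a unique component, and such that every
object is a coproduct of generators. Quantifier-freeness together with "enough" is exactly this
condition. The theorem is the recognition principle applied twice, for `Σ` to `p` and for `Π` to the
subfibration of quantifier-free objects.

To be invariant under equivalence, the notions are moved from the fibres to the total category,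
where neither a cleavage nor adjoints are chosen. A coproduct of `b` along `u` is a cocartesian map
`b ⟶ c` over `u`, and Beck-Chevalley says that such maps are stable under pullback
(`HasFibredCoproducts.base_change`). Splitting becomes unique lifting against these maps,
`CoprodOrth` (`isCoprodSplitting_iff`); the section is the base map under the lift. A product of `b`
along `v` is a pair `IsProdCone` with Beck-Chevalley built in, and splitting becomes `ProdOrth`
(`isProdSplitting_iff`).

If `p` is Gödel: the functors sending `(g, α)` to the coproduct, respectively product, of `α` along
`g` are fully faithful by orthogonality and essentially surjective by generation
(`exists_sigma_isOverEquivalence`, `exists_pi_isOverEquivalence`). The second identifies the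
quantifier-free subfibration with `Π_F(p')`, and the first then identifies `p` with `Σ_F Π_F(p')`.

Conversely, in either completion the objects over identity maps are orthogonal, and `(g, α)` is the
coproduct or product along `g` of `α` placed over an identity (`SigmaCat.coprodOrth_unit`,
`PiCat.prodOrth_unit`). This transports along the given equivalence. Moreover a quantifier-free `Y`
is itself isomorphic to a generator: the identity of `Y` lifts through a presentation of `Y` as a
coproduct, and the section so obtained makes `Y` a reindexing of the generator
(`GeneratesCoprod.exists_iso_of_coprodQFProp`). Hence the quantifier-free subfibration is equivalent
to `Π_F(p')`, with its products and quantifier-free objects. Products formed there remain products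
in `p`, since every test object is a coproduct of quantifier-free ones (`IsProdCone.of_restrict`);
so quantifier-free objects are closed under the products of `p`. -/

lemma isHomLift_unique (p : E ⥤ B) {I J : B} {f g : I ⟶ J} {X Y : E} (φ : X ⟶ Y)
    (hf : p.IsHomLift f φ) (hg : p.IsHomLift g φ) : f = g := by
  rw [IsHomLift.fac p f φ, IsHomLift.fac p g φ]

lemma exists_isHomLift (p : E ⥤ B) {I J : B} {X Y : E} (hX : p.obj X = I) (hY : p.obj Y = J)
    (φ : X ⟶ Y) : ∃ f : I ⟶ J, p.IsHomLift f φ := by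
  subst hX hY
  exact ⟨p.map φ, inferInstance⟩

lemma exists_isStronglyCartesian (p : E ⥤ B) [p.IsFibered] {I J : B} (f : I ⟶ J) {Y : E}
    (hY : p.obj Y = J) : ∃ (X : E) (φ : X ⟶ Y), p.IsStronglyCartesian f φ :=
  haveI := cartLift_isCartesian p f ⟨Y, hY⟩
  ⟨_, cartLift p f ⟨Y, hY⟩, Functor.IsFibered.isStronglyCartesian_of_isCartesian p f _⟩

lemma IsHomLift.of_comp_eq {p : E ⥤ B} {I J K : B} {f : I ⟶ J} {g : J ⟶ K} {h : I ⟶ K}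
    (w : f ≫ g = h) {X Y Z : E} (φ : X ⟶ Y) (ψ : Y ⟶ Z) (hφ : p.IsHomLift f φ)
    (hψ : p.IsHomLift g ψ) : p.IsHomLift h (φ ≫ ψ) :=
  w ▸ inferInstance

variable {D : Type u₃} [Category.{v₃} D]

lemma isHomLift_map_iff {K : D ⥤ E} {p : E ⥤ B} {q : D ⥤ B} (h : K ⋙ p = q) {I J : B}
    {f : I ⟶ J} {X Y : D} (φ : X ⟶ Y) : p.IsHomLift f (K.map φ) ↔ q.IsHomLift f φ := by
  subst h
  constructor
  · intro h
    exact IsHomLift.of_fac (K ⋙ p) f φ (IsHomLift.domain_eq p f (K.map φ))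
      (IsHomLift.codomain_eq p f (K.map φ)) (IsHomLift.fac p f (K.map φ))
  · intro h
    exact IsHomLift.of_fac p f (K.map φ) (IsHomLift.domain_eq (K ⋙ p) f φ)
      (IsHomLift.codomain_eq (K ⋙ p) f φ) (IsHomLift.fac (K ⋙ p) f φ)

/-- The relation `IsHomLift` contains the equalities of the end points, so a strict equality of
functors follows from a condition on maps alone; the identity maps give the equality on objects. -/
lemma comp_eq_of_isHomLift {K : D ⥤ E} {p : E ⥤ B} {q : D ⥤ B}
    (h : ∀ {X Y : D} (φ : X ⟶ Y), p.IsHomLift (q.map φ) (K.map φ)) : K ⋙ p = q :=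
  CategoryTheory.Functor.ext (fun X => IsHomLift.domain_eq p (q.map (𝟙 X)) (K.map (𝟙 X)))
    (fun _ _ φ => haveI := h φ; IsHomLift.fac' p (q.map φ) (K.map φ))

/-- `K` is an equivalence over the base category: a fully faithful functor over `B` that is
essentially surjective up to vertical isomorphisms. -/
structure IsOverEquivalence (K : D ⥤ E) (q : D ⥤ B) (p : E ⥤ B) : Prop where
  comp : K ⋙ p = q
  full : K.Full
  faithful : K.Faithful
  surj : ∀ Y : E, ∃ (X : D) (i : K.obj X ≅ Y), p.IsHomLift (𝟙 (p.obj Y)) i.hom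

lemma isHomLift_id_of_obj_eq {p : E ⥤ B} {X Y : E} {I : B} (φ : X ⟶ Y) (hY : p.obj Y = I)
    (h : p.IsHomLift (𝟙 (p.obj Y)) φ) : p.IsHomLift (𝟙 I) φ := by
  subst hY
  exact h

lemma IsHomLift.inv_vertical {p : E ⥤ B} {I : B} {X Y : E} (i : X ≅ Y)
    (h : p.IsHomLift (𝟙 I) i.hom) : p.IsHomLift (𝟙 I) i.inv :=
  inferInstance

/-- A full functor over `B` is surjective on the maps over a given map of `B`. -/
lemma IsOverEquivalence.exists_preimage {K : D ⥤ E} {q : D ⥤ B} {p : E ⥤ B} (hc : K ⋙ p = q)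
    [K.Full] {I J : B} {f : I ⟶ J} {X Y : D} (ψ : K.obj X ⟶ K.obj Y) (h : p.IsHomLift f ψ) :
    ∃ φ : X ⟶ Y, q.IsHomLift f φ ∧ K.map φ = ψ := by
  obtain ⟨φ, rfl⟩ := K.map_surjective ψ
  exact ⟨φ, (isHomLift_map_iff hc φ).1 h, rfl⟩

/-- Every test object is vertically isomorphic to a value of `K`, and between values of `K` the
universal property is the one upstairs, by full faithfulness. Preservation of cartesian maps is thus
automatic for equivalences over `B`. -/
lemma IsOverEquivalence.map_isStronglyCartesian {K : D ⥤ E} {q : D ⥤ B} {p : E ⥤ B}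
    (hK : IsOverEquivalence K q p) {I J : B} {f : I ⟶ J} {X Y : D} (φ : X ⟶ Y)
    (h : q.IsStronglyCartesian f φ) : p.IsStronglyCartesian f (K.map φ) := by
  have := hK.full
  have := hK.faithful
  exact
    { toIsHomLift := (isHomLift_map_iff hK.comp φ).2 inferInstance
      universal_property' := by
        intro Z g ψ hψ
        obtain ⟨W, i, hi⟩ := hK.surj Z
        obtain ⟨ψ', hψ', hψe⟩ := exists_preimage hK.comp (i.hom ≫ ψ)
          (IsHomLift.of_comp_eq (Category.id_comp _) _ _ hi hψ)
        obtain ⟨χ, ⟨hχ, hχ'⟩, hu⟩ := Functor.IsStronglyCartesian.universal_property q f φ g _ rfl ψ'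
        refine ⟨i.inv ≫ K.map χ, ⟨IsHomLift.of_comp_eq (Category.id_comp _) _ _
          (IsHomLift.inv_vertical i hi) ((isHomLift_map_iff hK.comp _).2 hχ), ?_⟩, ?_⟩
        · rw [Category.assoc, ← K.map_comp, hχ', hψe, Iso.inv_hom_id_assoc]
        · rintro χ' ⟨h₁, h₂⟩
          obtain ⟨χ'', h₃, h₄⟩ := exists_preimage hK.comp (i.hom ≫ χ')
            (IsHomLift.of_comp_eq (Category.id_comp _) _ _ hi h₁)
          rw [Iso.eq_inv_comp, ← h₄, hu χ'' ⟨h₃, K.map_injective ?_⟩]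
          rw [K.map_comp, h₄, Category.assoc, h₂, hψe] }

lemma IsOverEquivalence.map_isStronglyCocartesian {K : D ⥤ E} {q : D ⥤ B} {p : E ⥤ B}
    (hK : IsOverEquivalence K q p) {I J : B} {f : I ⟶ J} {X Y : D} (φ : X ⟶ Y)
    (h : q.IsStronglyCocartesian f φ) : p.IsStronglyCocartesian f (K.map φ) := by
  have := hK.full
  have := hK.faithful
  exact
    { toIsHomLift := (isHomLift_map_iff hK.comp φ).2 inferInstance
      universal_property' := by
        intro Z g ψ hψ
        obtain ⟨W, i, hi⟩ := hK.surj Z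
        have hi' := IsHomLift.inv_vertical i hi
        obtain ⟨ψ', hψ', hψe⟩ := exists_preimage hK.comp (ψ ≫ i.inv)
          (IsHomLift.of_comp_eq (Category.comp_id _) _ _ hψ hi')
        obtain ⟨χ, ⟨hχ, hχ'⟩, hu⟩ :=
          Functor.IsStronglyCocartesian.universal_property q f φ g _ rfl ψ'
        refine ⟨K.map χ ≫ i.hom, ⟨IsHomLift.of_comp_eq (Category.comp_id _) _ _
          ((isHomLift_map_iff hK.comp _).2 hχ) hi, ?_⟩, ?_⟩
        · rw [← Category.assoc, ← K.map_comp, hχ', hψe, Category.assoc, Iso.inv_hom_id,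
            Category.comp_id]
        · rintro χ' ⟨h₁, h₂⟩
          obtain ⟨χ'', h₃, h₄⟩ := exists_preimage hK.comp (χ' ≫ i.inv)
            (IsHomLift.of_comp_eq (Category.comp_id _) _ _ h₁ hi')
          rw [← Iso.comp_inv_eq, ← h₄, hu χ'' ⟨h₃, K.map_injective ?_⟩]
          rw [K.map_comp, h₄, ← Category.assoc, h₂, hψe] }

lemma IsOverEquivalence.of_iso {G : E ⥤ D} {K : D ⥤ E} {q : D ⥤ B} {p : E ⥤ B}
    (hK : K ⋙ p = q) (i : 𝟭 D ≅ K ⋙ G) (j : G ⋙ K ≅ 𝟭 E)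
    (hj : ∀ Y, p.IsHomLift (𝟙 (p.obj Y)) (j.hom.app Y)) : IsOverEquivalence K q p := by
  have : K.IsEquivalence := (CategoryTheory.Equivalence.mk K G i j).isEquivalence_functor
  exact ⟨hK, inferInstance, inferInstance, fun Y => ⟨G.obj Y, j.app Y, hj Y⟩⟩

lemma FibredEquivalence.isOverEquivalence {q : D ⥤ B} {p : E ⥤ B} (e : FibredEquivalence q p) :
    IsOverEquivalence e.functor q p :=
  .of_iso e.functor_comp e.unitIso e.counitIso e.counit_vertical

lemma FibredEquivalence.inverse_isOverEquivalence {q : D ⥤ B} {p : E ⥤ B}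
    (e : FibredEquivalence q p) : IsOverEquivalence e.inverse p q :=
  .of_iso e.inverse_comp e.counitIso.symm e.unitIso.symm
    (fun X => IsHomLift.inv_vertical (e.unitIso.app X) (e.unit_vertical X))

/-- The usual quasi-inverse, built from chosen isomorphisms. That these are vertical is what makes
the inverse lie over `B` strictly and the unit and counit vertical. -/
lemma IsOverEquivalence.exists_inverse {K : D ⥤ E} {q : D ⥤ B} {p : E ⥤ B}
    (hK : IsOverEquivalence K q p) : ∃ (G : E ⥤ D) (_ : G ⋙ q = p) (i : 𝟭 D ≅ K ⋙ G)
      (j : G ⋙ K ≅ 𝟭 E), (∀ X, q.IsHomLift (𝟙 (q.obj X)) (i.hom.app X)) ∧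
        ∀ Y, p.IsHomLift (𝟙 (p.obj Y)) (j.hom.app Y) := by
  have := hK.full
  have := hK.faithful
  choose obj iso hiso using hK.surj
  let G : E ⥤ D :=
    { obj := obj
      map := fun {X Y} φ => K.preimage ((iso X).hom ≫ φ ≫ (iso Y).inv)
      map_id := fun X => K.map_injective (by simp)
      map_comp := fun {X Y Z} φ ψ => K.map_injective (by simp) }
  have hmap {X Y : E} (φ : X ⟶ Y) : K.map (G.map φ) = (iso X).hom ≫ φ ≫ (iso Y).inv :=
    K.map_preimage _
  have hG : G ⋙ q = p := comp_eq_of_isHomLift fun {X Y} φ => by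
    rw [← isHomLift_map_iff hK.comp, hmap]
    refine IsHomLift.of_comp_eq (Category.id_comp _) _ _ (hiso X) ?_
    exact IsHomLift.of_comp_eq (Category.comp_id _) _ _ inferInstance
      (IsHomLift.inv_vertical _ (hiso Y))
  let j : G ⋙ K ≅ 𝟭 E := NatIso.ofComponents iso (fun {X Y} φ => by
    change K.map (G.map φ) ≫ _ = _ ≫ φ
    rw [hmap]
    simp)
  let i : 𝟭 D ≅ K ⋙ G := NatIso.ofComponents (fun X => (K.preimageIso (iso (K.obj X))).symm)
    (fun {X Y} φ => K.map_injective (by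
      change K.map (φ ≫ K.preimage _) = K.map (K.preimage _ ≫ G.map (K.map φ))
      rw [K.map_comp, K.map_comp, hmap]
      simp))
  refine ⟨G, hG, i, j, fun X => ?_, hiso⟩
  rw [← isHomLift_map_iff hK.comp]
  have h : K.map (i.hom.app X) = (iso (K.obj X)).inv := K.map_preimage _
  have e : p.obj (K.obj X) = q.obj X := Functor.congr_obj hK.comp X
  rw [h, ← e]
  exact IsHomLift.inv_vertical _ (hiso _)

lemma IsOverEquivalence.nonempty_fibredEquivalence {K : D ⥤ E} {q : D ⥤ B} {p : E ⥤ B}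
    (hK : IsOverEquivalence K q p) : Nonempty (FibredEquivalence q p) := by
  obtain ⟨G, hG, i, j, hi, hj⟩ := hK.exists_inverse
  have hG' : IsOverEquivalence G p q := .of_iso hG j.symm i.symm
    (fun X => IsHomLift.inv_vertical (i.app X) (hi X))
  exact ⟨⟨K, G, hK.comp, hG, fun _ _ _ φ => hK.map_isStronglyCartesian φ,
    fun _ _ _ φ => hG'.map_isStronglyCartesian φ, i, j, hi, hj⟩⟩

end Over

/-! ### Cartesian and cocartesian maps in the total category. -/

section Cartesian

variable {B : Type u₁} [Category.{v₁} B] {E : Type u₂} [Category.{v₂} E] {p : E ⥤ B}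

/-- By cancellation `i` is cartesian over an identity, hence invertible. -/
lemma isIso_of_comp_isStronglyCartesian {I J : B} {f : I ⟶ J} {X X' Y : E} (i : X ⟶ X')
    (φ : X ⟶ Y) (φ' : X' ⟶ Y) (hi : p.IsHomLift (𝟙 I) i) (hφ : p.IsStronglyCartesian f φ)
    (hφ' : p.IsStronglyCartesian f φ') (w : i ≫ φ' = φ) : IsIso i := by
  have : p.IsStronglyCartesian (𝟙 I ≫ f) (i ≫ φ') := by rwa [Category.id_comp, w]
  have := Functor.IsStronglyCartesian.of_comp p (f := 𝟙 I) (g := f) (φ := i) (ψ := φ')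
  exact Functor.IsStronglyCartesian.isIso_of_base_isIso p (𝟙 I) i

lemma isIso_of_isStronglyCocartesian_comp {I J : B} {f : I ⟶ J} {X Y Y' : E} (i : Y ⟶ Y')
    (φ : X ⟶ Y) (φ' : X ⟶ Y') (hi : p.IsHomLift (𝟙 J) i) (hφ : p.IsStronglyCocartesian f φ)
    (hφ' : p.IsStronglyCocartesian f φ') (w : φ ≫ i = φ') : IsIso i := by
  have : p.IsStronglyCocartesian (f ≫ 𝟙 J) (φ ≫ i) := by rwa [Category.comp_id, w]
  have := Functor.IsStronglyCocartesian.of_comp p (f := f) (g := 𝟙 J) (φ := φ) (ψ := i)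
  exact Functor.IsStronglyCocartesian.isIso_of_base_isIso p (𝟙 J) i

lemma isStronglyCartesian_comp {I J K : B} {f : I ⟶ J} {g : J ⟶ K} {h : I ⟶ K} (w : f ≫ g = h)
    {X Y Z : E} {φ : X ⟶ Y} {ψ : Y ⟶ Z} (hφ : p.IsStronglyCartesian f φ)
    (hψ : p.IsStronglyCartesian g ψ) : p.IsStronglyCartesian h (φ ≫ ψ) :=
  w ▸ inferInstance

lemma isStronglyCocartesian_comp {I J K : B} {f : I ⟶ J} {g : J ⟶ K} {h : I ⟶ K} (w : f ≫ g = h)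
    {X Y Z : E} {φ : X ⟶ Y} {ψ : Y ⟶ Z} (hφ : p.IsStronglyCocartesian f φ)
    (hψ : p.IsStronglyCocartesian g ψ) : p.IsStronglyCocartesian h (φ ≫ ψ) :=
  w ▸ inferInstance

lemma exists_vertical_iso_of_isStronglyCartesian {I J : B} {f : I ⟶ J} {X X' Y : E} (φ : X ⟶ Y)
    (φ' : X' ⟶ Y) (hφ : p.IsStronglyCartesian f φ) (hφ' : p.IsStronglyCartesian f φ') :
    ∃ i : X ≅ X', p.IsHomLift (𝟙 I) i.hom ∧ i.hom ≫ φ' = φ := by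
  obtain ⟨i, ⟨h₁, h₂⟩, -⟩ := Functor.IsStronglyCartesian.universal_property p f φ' (𝟙 I) f
    (Category.id_comp _).symm φ
  have := isIso_of_comp_isStronglyCartesian i φ φ' h₁ hφ hφ' h₂
  exact ⟨asIso i, h₁, h₂⟩

lemma exists_vertical_iso_of_isStronglyCocartesian {I J : B} {f : I ⟶ J} {X Y Y' : E} (φ : X ⟶ Y)
    (φ' : X ⟶ Y') (hφ : p.IsStronglyCocartesian f φ) (hφ' : p.IsStronglyCocartesian f φ') :
    ∃ i : Y ≅ Y', p.IsHomLift (𝟙 J) i.hom ∧ φ ≫ i.hom = φ' := by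
  obtain ⟨i, ⟨h₁, h₂⟩, -⟩ := Functor.IsStronglyCocartesian.universal_property p f φ (𝟙 J) f
    (Category.comp_id _).symm φ'
  have := isIso_of_isStronglyCocartesian_comp i φ φ' h₁ hφ hφ' h₂
  exact ⟨asIso i, h₁, h₂⟩

/-- A vertical isomorphism between objects of a fibre. -/
def fiberIso {I : B} {a b : p.Fiber I} (i : a.1 ≅ b.1) (hi : p.IsHomLift (𝟙 I) i.hom) : a ≅ b where
  hom := ⟨i.hom, hi⟩
  inv := ⟨i.inv, inferInstance⟩
  hom_inv_id := Subtype.ext i.hom_inv_id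
  inv_hom_id := Subtype.ext i.inv_hom_id

/-- The isomorphism of the total category underlying an isomorphism of a fibre. -/
def isoOfFiberIso {I : B} {a b : p.Fiber I} (i : a ≅ b) : a.1 ≅ b.1 where
  hom := i.hom.1
  inv := i.inv.1
  hom_inv_id := congrArg Subtype.val i.hom_inv_id
  inv_hom_id := congrArg Subtype.val i.inv_hom_id

variable [p.IsFibered]

instance cartLift_isStronglyCartesian {I J : B} (u : I ⟶ J) (a : p.Fiber J) :
    p.IsStronglyCartesian u (cartLift p u a) :=
  haveI := cartLift_isCartesian p u a
  Functor.IsFibered.isStronglyCartesian_of_isCartesian p u _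

lemma total_comp_map {I J : B} {u : I ⟶ J} {a b : p.Fiber J} {c : p.Fiber I}
    (f : c ⟶ (reindex p u).obj a) (k : a ⟶ b) :
    total (a := b) (f ≫ (reindex p u).map k) = total (a := a) f ≫ k.1 := by
  refine (comp_total p f ((reindex p u).map k)).trans ?_
  refine (congrArg (f.1 ≫ ·) (reindex_map_cartLift p u k)).trans ?_
  exact (Category.assoc _ _ _).symm

/-- The coherence isomorphisms of the cleavage are used below only through their composites with
cartesian liftings, which determine them. This and the next lemmas record these composites. -/
lemma reindexComp_hom_cartLift {I J K : B} {u : I ⟶ J} {v : J ⟶ K} {w : I ⟶ K}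
    (h : u ≫ v = w) (a : p.Fiber K) : ((reindexComp p h).hom.app a).1 ≫ cartLift p w a =
      cartLift p u (reindexObj p v a) ≫ cartLift p v a :=
  total_vertLift p w _ _

lemma reindexComp_inv_cartLift {I J K : B} {u : I ⟶ J} {v : J ⟶ K} {w : I ⟶ K}
    (h : u ≫ v = w) (a : p.Fiber K) : ((reindexComp p h).inv.app a).1 ≫
      cartLift p u (reindexObj p v a) ≫ cartLift p v a = cartLift p w a := by
  refine (congrArg (((reindexComp p h).inv.app a).1 ≫ ·) (reindexComp_hom_cartLift h a).symm).trans
    ((Category.assoc _ _ _).symm.trans ?_)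
  have := congrArg Subtype.val ((reindexComp p h).inv_hom_id_app a)
  exact (congrArg (· ≫ cartLift p w a) this).trans (Category.id_comp _)

lemma reindexSquare_hom_cartLift {K L I J : B} {u : K ⟶ I} {g : K ⟶ L} {f : I ⟶ J} {v : L ⟶ J}
    (h : g ≫ v = u ≫ f) (a : p.Fiber J) : ((reindexSquare p h).hom.app a).1 ≫
      cartLift p u (reindexObj p f a) ≫ cartLift p f a =
        cartLift p g (reindexObj p v a) ≫ cartLift p v a := by
  refine (Category.assoc _ _ _).trans ?_
  refine (congrArg (_ ≫ ·) (reindexComp_inv_cartLift rfl a)).trans ?_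
  exact reindexComp_hom_cartLift h a

lemma reindexSquare_inv_cartLift {K L I J : B} {u : K ⟶ I} {g : K ⟶ L} {f : I ⟶ J} {v : L ⟶ J}
    (h : g ≫ v = u ≫ f) (a : p.Fiber J) : ((reindexSquare p h).inv.app a).1 ≫
      cartLift p g (reindexObj p v a) ≫ cartLift p v a =
        cartLift p u (reindexObj p f a) ≫ cartLift p f a := by
  refine (congrArg (((reindexSquare p h).inv.app a).1 ≫ ·)
    (reindexSquare_hom_cartLift h a).symm).trans ((Category.assoc _ _ _).symm.trans ?_)
  have := congrArg Subtype.val ((reindexSquare p h).inv_hom_id_app a)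
  exact (congrArg (· ≫ _) this).trans (Category.id_comp _)

lemma reindexSection_hom_val {A K : B} {u : K ⟶ A} {g : A ⟶ K} (h : g ≫ u = 𝟙 A)
    (a : p.Fiber A) : ((reindexSection p h).hom.app a).1 =
      cartLift p g (reindexObj p u a) ≫ cartLift p u a :=
  reindexComp_hom_cartLift h a

lemma reindexSection_inv_cartLift {A K : B} {u : K ⟶ A} {g : A ⟶ K} (h : g ≫ u = 𝟙 A)
    (a : p.Fiber A) : ((reindexSection p h).inv.app a).1 ≫
      cartLift p g (reindexObj p u a) ≫ cartLift p u a = 𝟙 a.1 := by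
  refine (congrArg (((reindexSection p h).inv.app a).1 ≫ ·)
    (reindexSection_hom_val h a).symm).trans ?_
  exact congrArg Subtype.val ((reindexSection p h).inv_hom_id_app a)

end Cartesian

/-! ### Coproducts as cocartesian maps, and splitting as orthogonality. -/

section Coproducts

variable {B : Type u₁} [Category.{v₁} B] {E : Type u₂} [Category.{v₂} E] {p : E ⥤ B}
  [p.IsFibered] {F : MorphismProperty B}

/-- The map `b ⟶ S b` over `u` corresponding to the unit of an adjunction `S ⊣ u^*`. -/
noncomputable def unitMap {K I : B} {u : K ⟶ I} {S : p.Fiber K ⥤ p.Fiber I}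
    (adj : S ⊣ reindex p u) (b : p.Fiber K) : b.1 ⟶ (S.obj b).1 :=
  total (a := S.obj b) (b := b) (adj.unit.app b)

/-- The adjunction only speaks of vertical maps out of `S b`. A map over `u ≫ w` is first factored
through the cartesian lifting of `w`, which leaves a map over `u` into an object of the fibre over
`I`; this one can be transposed. -/
lemma unitMap_isStronglyCocartesian {K I : B} {u : K ⟶ I} {S : p.Fiber K ⥤ p.Fiber I}
    (adj : S ⊣ reindex p u) (b : p.Fiber K) : p.IsStronglyCocartesian u (unitMap adj b) where
  toIsHomLift := total_isHomLift p _
  universal_property' := by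
    intro d w φ hφ
    let d' : p.Fiber (p.obj d) := ⟨d, rfl⟩
    obtain ⟨φ', ⟨h₁, h₂⟩, -⟩ := Functor.IsStronglyCartesian.universal_property p w
      (cartLift p w d') u _ rfl φ
    let k : b ⟶ (reindex p u).obj (reindexObj p w d') := vertLift p u φ' h₁
    let l := (adj.homEquiv _ _).symm k
    have hl : unitMap adj b ≫ l.1 = φ' := by
      rw [unitMap, ← total_comp_map]
      have : adj.unit.app b ≫ (reindex p u).map l = k :=
        (adj.homEquiv_unit _ _ _).symm.trans (Equiv.apply_symm_apply _ _)
      exact (congrArg (total (a := reindexObj p w d')) this).trans (total_vertLift p u _ _)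
    refine ⟨total l, ⟨total_isHomLift p _, ?_⟩, ?_⟩
    · refine (Category.assoc _ _ _).symm.trans ?_
      exact (congrArg (· ≫ cartLift p w d') hl).trans h₂
    · rintro χ ⟨h₃, h₄⟩
      let m : S.obj b ⟶ reindexObj p w d' := vertLift p w χ h₃
      have hm : total m = χ := total_vertLift p w _ _
      rw [← hm]
      congr 1
      apply (adj.homEquiv _ _).injective
      rw [Equiv.apply_symm_apply, Adjunction.homEquiv_unit]
      refine total_ext (a := reindexObj p w d') ((total_comp_map _ _).trans ?_)
      refine Eq.trans ?_ (total_vertLift p u φ' h₁).symm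
      have h₅ : p.IsHomLift u (unitMap adj b) := total_isHomLift p _
      have h₆ : p.IsHomLift u (unitMap adj b ≫ m.1) := IsHomLift.of_comp_eq (Category.comp_id _)
        _ _ h₅ m.2
      refine Functor.IsStronglyCartesian.ext p w (cartLift p w d') u
        (ψ := unitMap adj b ≫ m.1) (ψ' := φ') ?_
      rw [h₂, ← h₄, ← hm]
      exact Category.assoc _ _ _

/-- The unit equation of the mate, read in the total category: the comparison is the vertical map
filling the square of the two unit maps and the two cartesian liftings. -/
lemma leftComparison_fac {K L I J : B} {u : K ⟶ I} {g : K ⟶ L} {f : I ⟶ J} {v : L ⟶ J}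
    (h : g ≫ v = u ≫ f) {Sv : p.Fiber L ⥤ p.Fiber J} {Su : p.Fiber K ⥤ p.Fiber I}
    (adjv : Sv ⊣ reindex p v) (adju : Su ⊣ reindex p u) (b : p.Fiber L) :
    unitMap adju (reindexObj p g b) ≫ ((leftComparison p h adjv adju).app b).1 ≫
      cartLift p f (Sv.obj b) = cartLift p g b ≫ unitMap adjv b := by
  have key := unit_mateEquiv_symm adjv adju (.mk _ _ _ _ (reindexSquare p h).hom) b
  have h₁ := total_comp_map (adju.unit.app (reindexObj p g b))
    ((leftComparison p h adjv adju).app b)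
  have h₂ := congrArg (fun k => total (a := reindexObj p f (Sv.obj b)) k ≫
    cartLift p f (Sv.obj b)) key
  have h₃ := reindex_map_cartLift p g (adjv.unit.app b)
  have h₄ := reindexSquare_hom_cartLift h (Sv.obj b)
  refine (Category.assoc _ _ _).symm.trans ?_
  refine (congrArg (· ≫ cartLift p f (Sv.obj b)) h₁.symm).trans (h₂.symm.trans ?_)
  refine (congrArg (· ≫ cartLift p f (Sv.obj b)) (comp_total p _ _)).trans ?_
  refine (Category.assoc _ _ _).trans ((congrArg (_ ≫ ·) (Category.assoc _ _ _)).trans ?_)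
  refine (congrArg (((reindex p g).map (adjv.unit.app b)).1 ≫ ·) h₄).trans ?_
  refine (Category.assoc _ _ _).symm.trans ((congrArg (· ≫ _) h₃).trans ?_)
  exact Category.assoc _ _ _

/-- Beck-Chevalley without choices. For unit maps and chosen liftings the filler is a unit map
followed by the comparison, which is invertible; any other square of this kind differs from it by
vertical isomorphisms. -/
lemma HasFibredCoproducts.base_change (hC : HasFibredCoproducts p F) {K L I J : B} {u : K ⟶ I}
    {g : K ⟶ L} {f : I ⟶ J} {v : L ⟶ J} (sq : IsPullback u g f v) (hv : F v) (hu : F u)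
    {b c b' c' : E} {η : b ⟶ c} (hη : p.IsStronglyCocartesian v η) {γ : b' ⟶ b}
    (hγ : p.IsStronglyCartesian g γ) {δ : c' ⟶ c} (hδ : p.IsStronglyCartesian f δ) {η' : b' ⟶ c'}
    (hη' : p.IsHomLift u η') (w : η' ≫ δ = γ ≫ η) : p.IsStronglyCocartesian u η' := by
  let b₀ : p.Fiber L := ⟨b, IsHomLift.domain_eq p v η⟩
  let η₀ : b ⟶ ((coprod hC v hv).obj b₀).1 := unitMap (coprodAdj hC v hv) b₀
  obtain ⟨i, hi, hi'⟩ := exists_vertical_iso_of_isStronglyCocartesian η₀ η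
    (unitMap_isStronglyCocartesian _ _) hη
  obtain ⟨j, hj, hj'⟩ := exists_vertical_iso_of_isStronglyCartesian γ (cartLift p g b₀) hγ
    inferInstance
  have hδ' : p.IsStronglyCartesian f (cartLift p f ((coprod hC v hv).obj b₀) ≫ i.hom) :=
    isStronglyCartesian_comp (Category.comp_id _) inferInstance inferInstance
  obtain ⟨k, hk, hk'⟩ := exists_vertical_iso_of_isStronglyCartesian _ δ hδ' hδ
  let η₁ := unitMap (coprodAdj hC u hu) (reindexObj p g b₀)
  have h₁ : p.IsStronglyCocartesian u η₁ := unitMap_isStronglyCocartesian _ _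
  have := hC.beckChevalley sq hv hu (coprodAdj hC v hv) (coprodAdj hC u hu)
  let l := isoOfFiberIso (asIso ((leftComparison p sq.w.symm (coprodAdj hC v hv)
    (coprodAdj hC u hu)).app b₀))
  have hl : p.IsHomLift (𝟙 I) l.hom := ((leftComparison p sq.w.symm (coprodAdj hC v hv)
    (coprodAdj hC u hu)).app b₀).2
  have hf : η₁ ≫ l.hom ≫ cartLift p f _ = cartLift p g b₀ ≫ η₀ := leftComparison_fac _ _ _ _
  have h₂ : p.IsStronglyCocartesian u (j.hom ≫ η₁ ≫ l.hom ≫ k.hom) :=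
    isStronglyCocartesian_comp (Category.id_comp _) inferInstance
      (isStronglyCocartesian_comp (Category.comp_id _) h₁
        (isStronglyCocartesian_comp (Category.comp_id (𝟙 I)) (.of_iso p (𝟙 I) l)
          (.of_iso p (𝟙 I) k)))
  convert h₂
  refine Functor.IsStronglyCartesian.ext p f δ u ?_
  have e₁ : (j.hom ≫ η₁ ≫ l.hom ≫ k.hom) ≫ δ = j.hom ≫ η₁ ≫ l.hom ≫ k.hom ≫ δ := by
    simp only [Category.assoc]
    exact congrArg (j.hom ≫ η₁ ≫ ·) (Category.assoc _ _ _)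
  have e₂ : j.hom ≫ (cartLift p g b₀ ≫ η₀) ≫ i.hom = γ ≫ η := by
    rw [← hi', ← hj']
    simp only [Category.assoc]
  rw [w, e₁, ← e₂, ← hf]
  refine congrArg (j.hom ≫ ·) (Eq.trans ?_ (congrArg (η₁ ≫ l.hom ≫ ·) hk'.symm))
  exact (Category.assoc _ _ _).trans (congrArg (η₁ ≫ ·) (Category.assoc _ _ _))

variable (p F) in
/-- `a` is left orthogonal to the cocartesian maps over display maps. -/
def CoprodOrth (a : E) : Prop :=
  ∀ ⦃K J : B⦄ (u : K ⟶ J), F u → ∀ ⦃b c : E⦄ (η : b ⟶ c), p.IsStronglyCocartesian u η →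
    ∀ φ : a ⟶ c, ∃! ψ : a ⟶ b, ψ ≫ η = φ

/-- The factorisation in the definition of splitting is, in the total category, plain composition
with the cocartesian unit map. -/
lemma section_fac {A K : B} {u : K ⟶ A} {S : p.Fiber K ⥤ p.Fiber A} (adj : S ⊣ reindex p u)
    {g : A ⟶ K} (h : g ≫ u = 𝟙 A) {a : p.Fiber A} {b : p.Fiber K} (s : a ⟶ (reindex p g).obj b) :
    (s ≫ (reindex p g).map (adj.unit.app b) ≫ (reindexSection p h).hom.app (S.obj b)).1 =
      total (a := b) s ≫ unitMap adj b := by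
  have h₁ := reindexSection_hom_val h (S.obj b)
  have h₂ := reindex_map_cartLift p g (adj.unit.app b)
  change s.1 ≫ ((reindex p g).map (adj.unit.app b)).1 ≫ _ = (s.1 ≫ cartLift p g b) ≫ unitMap adj b
  refine (congrArg (fun x => s.1 ≫ ((reindex p g).map (adj.unit.app b)).1 ≫ x) h₁).trans ?_
  refine Eq.trans ?_ (Category.assoc _ _ _).symm
  refine congrArg (s.1 ≫ ·) ?_
  refine (Category.assoc _ _ _).symm.trans ((congrArg (· ≫ _) h₂).trans ?_)
  exact Category.assoc _ _ _

lemma CoprodOrth.isCoprodSplitting (hC : HasFibredCoproducts p F) {A : B} {a : p.Fiber A}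
    (ha : CoprodOrth p F a.1) : IsCoprodSplitting hC a := by
  intro K u hu b h
  have hη := unitMap_isStronglyCocartesian (coprodAdj hC u hu) b
  obtain ⟨ψ, hψ, huniq⟩ := ha u hu _ hη h.1
  obtain ⟨g, hg⟩ := exists_isHomLift p a.2 b.2 ψ
  -- The lift is only a map of the total category. It lies over some `g`, which is a section because
  -- `ψ` followed by the unit map is the vertical map `h`.
  have hgu : g ≫ u = 𝟙 A := isHomLift_unique p h.1
    (hψ ▸ IsHomLift.of_comp_eq rfl ψ (unitMap (coprodAdj hC u hu) b) hg inferInstance) h.2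
  refine ⟨⟨⟨g, hgu⟩, vertLift p g ψ hg⟩, Subtype.ext ?_, ?_⟩
  · refine hψ.symm.trans (Eq.trans ?_ (section_fac _ hgu _).symm)
    rw [total_vertLift]
  · rintro ⟨⟨g', hg'⟩, s⟩ hs
    have h₁ : total (a := b) s = ψ := huniq _ ((section_fac _ hg' s).symm.trans
      (congrArg Subtype.val hs).symm)
    obtain rfl : g' = g := isHomLift_unique p ψ (h₁ ▸ total_isHomLift p _) hg
    congr 1
    exact total_ext (a := b) (h₁.trans (total_vertLift p g' ψ hg).symm)

lemma IsCoprodSplitting.existsUnique (hC : HasFibredCoproducts p F) {A : B} {a : p.Fiber A}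
    (ha : IsCoprodSplitting hC a) {K : B} {u : K ⟶ A} (hu : F u) {b c : E} {η : b ⟶ c}
    (hη : p.IsStronglyCocartesian u η) (φ : a.1 ⟶ c) (hφ : p.IsHomLift (𝟙 A) φ) :
    ∃! ψ : a.1 ⟶ b, ψ ≫ η = φ := by
  let b₀ : p.Fiber K := ⟨b, IsHomLift.domain_eq p u η⟩
  have hη₀ := unitMap_isStronglyCocartesian (coprodAdj hC u hu) b₀
  obtain ⟨i, hi, hi'⟩ := exists_vertical_iso_of_isStronglyCocartesian _ η hη₀ hη
  let h : a ⟶ (coprod hC u hu).obj b₀ := ⟨φ ≫ i.inv, inferInstance⟩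
  have hiff (ψ : a.1 ⟶ b) : ψ ≫ η = φ ↔ ψ ≫ unitMap (coprodAdj hC u hu) b₀ = h.1 := by
    rw [← hi', ← Category.assoc]
    exact (Iso.eq_comp_inv i).symm
  obtain ⟨⟨⟨g, hg⟩, s⟩, hs, huniq⟩ := ha u hu b₀ h
  refine ⟨total (a := b₀) s, (hiff _).2 ((section_fac _ hg s).symm.trans
    (congrArg Subtype.val hs).symm), fun ψ hψ => ?_⟩
  obtain ⟨g', hg'⟩ := exists_isHomLift p a.2 b₀.2 ψ
  have hgu : g' ≫ u = 𝟙 A := isHomLift_unique p φ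
    (hψ ▸ IsHomLift.of_comp_eq rfl ψ η hg' inferInstance) hφ
  have := huniq ⟨⟨g', hgu⟩, vertLift p g' (a := b₀) ψ hg'⟩ (Subtype.ext
    (((hiff ψ).1 hψ).symm.trans (Eq.trans (by rw [total_vertLift]) (section_fac _ hgu _).symm)))
  cases this
  exact (total_vertLift p g (a := b₀) ψ hg').symm

/-- Splitting gives lifts of vertical maps only. For `φ` over `k`, pull the cocartesian map back
along `k`: it stays cocartesian over a display map, `φ` becomes vertical, and lifts of the two
problems correspond. -/
lemma IsCoprodSplitting.coprodOrth [IsDisplayMapClass F] (hC : HasFibredCoproducts p F) {A : B}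
    {a : p.Fiber A} (ha : IsCoprodSplitting hC a) : CoprodOrth p F a.1 := by
  intro K J u hu b c η hη φ
  obtain ⟨k, hk⟩ := exists_isHomLift p a.2 (IsHomLift.codomain_eq p u η) φ
  have sq := (pb_isPullback hu k).flip
  obtain ⟨b', γ, hγ⟩ := exists_isStronglyCartesian p (pbTop hu k) (IsHomLift.domain_eq p u η)
  obtain ⟨c', δ, hδ⟩ := exists_isStronglyCartesian p k (IsHomLift.codomain_eq p u η)
  have hγη := IsHomLift.of_comp_eq (pb_w hu k) γ η hγ.toIsHomLift hη.toIsHomLift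
  obtain ⟨η', ⟨h₁, h₂⟩, -⟩ := Functor.IsStronglyCartesian.universal_property p k δ (pbBase hu k) _
    rfl (γ ≫ η)
  have hη' := hC.base_change sq hu (pbBase_mem hu k) hη hγ hδ h₁ h₂
  obtain ⟨φ', ⟨h₃, h₄⟩, -⟩ := Functor.IsStronglyCartesian.universal_property p k δ (𝟙 A) _
    (Category.id_comp _).symm φ
  obtain ⟨ψ, hψ, huniq⟩ := ha.existsUnique hC (pbBase_mem hu k) hη' φ' h₃
  refine ⟨ψ ≫ γ, ?_, fun χ hχ => ?_⟩
  · dsimp only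
    rw [Category.assoc, ← h₂, ← h₄, ← hψ, Category.assoc]
  -- A competing lift `χ` lies over some `g` with `g ≫ u = k`. It therefore factors through the
  -- pullback, as a lift of the vertical problem.
  · obtain ⟨g, hg⟩ := exists_isHomLift p a.2 (IsHomLift.domain_eq p u η) χ
    have hgu : g ≫ u = 𝟙 A ≫ k := (isHomLift_unique p φ
      (hχ ▸ IsHomLift.of_comp_eq rfl χ η hg inferInstance) hk).trans (Category.id_comp _).symm
    obtain ⟨χ', ⟨h₅, h₆⟩, -⟩ := Functor.IsStronglyCartesian.universal_property p (pbTop hu k) γ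
      (pbLift hu k g (𝟙 A) hgu) _ (pbLift_top _ _ _ _ _).symm χ
    rw [← h₆, huniq χ' ?_]
    have h₇ : p.IsHomLift (𝟙 A) (χ' ≫ η') :=
      IsHomLift.of_comp_eq (pbLift_base _ _ _ _ _) _ _ h₅ h₁
    refine Functor.IsStronglyCartesian.ext p k δ (𝟙 A) ?_
    rw [h₄, Category.assoc, h₂, ← Category.assoc, h₆, hχ]

lemma isCoprodSplitting_iff [IsDisplayMapClass F] (hC : HasFibredCoproducts p F) {A : B}
    {a : p.Fiber A} : IsCoprodSplitting hC a ↔ CoprodOrth p F a.1 :=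
  ⟨fun h => h.coprodOrth hC, fun h => h.isCoprodSplitting hC⟩

end Coproducts

/-! ### Products along a map, as cones in the total category. -/

section ProdCones

variable {B : Type u₁} [Category.{v₁} B] {E : Type u₂} [Category.{v₂} E]

/-- `κ : e ⟶ c` and `ε : e ⟶ b` exhibit `c` as a product of `b` along `v`, stably under change of
base: `κ` is cartesian over `v`, `ε` is vertical, and maps `d ⟶ c` over `f` correspond to maps
`e' ⟶ b`, where `e' ⟶ d` is a cartesian map over the pullback of `v` along `f`. -/
structure IsProdCone (p : E ⥤ B) {L J : B} (v : L ⟶ J) {c b e : E} (κ : e ⟶ c) (ε : e ⟶ b) :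
    Prop where
  cart : p.IsStronglyCartesian v κ
  vert : p.IsHomLift (𝟙 L) ε
  existsUnique : ∀ {K I : B} {u : K ⟶ I} {g : K ⟶ L} {f : I ⟶ J}, IsPullback u g f v →
    ∀ {d e' : E} (κ' : e' ⟶ d), p.IsStronglyCartesian u κ' →
      ∀ φ : e' ⟶ b, p.IsHomLift g φ → ∃! m : d ⟶ c, p.IsHomLift f m ∧
        ∃ n : e' ⟶ e, p.IsHomLift g n ∧ n ≫ κ = κ' ≫ m ∧ n ≫ ε = φ

variable {p : E ⥤ B} {L J : B} {v : L ⟶ J}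

lemma IsProdCone.hom_ext {c b e : E} {κ : e ⟶ c} {ε : e ⟶ b} (h : IsProdCone p v κ ε) {K I : B}
    {u : K ⟶ I} {g : K ⟶ L} {f : I ⟶ J} (sq : IsPullback u g f v) {d e' : E} {κ' : e' ⟶ d}
    (hκ' : p.IsStronglyCartesian u κ') {m m' : d ⟶ c} (hm : p.IsHomLift f m)
    (hm' : p.IsHomLift f m') {n n' : e' ⟶ e} (hn : p.IsHomLift g n) (hn' : p.IsHomLift g n')
    (w : n ≫ κ = κ' ≫ m) (w' : n' ≫ κ = κ' ≫ m') (hε : n ≫ ε = n' ≫ ε) : m = m' := by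
  have := h.vert
  exact (h.existsUnique sq κ' hκ' (n ≫ ε) (IsHomLift.of_comp_eq (Category.comp_id _) _ _ hn
    inferInstance)).unique ⟨hm, n, hn, w, rfl⟩ ⟨hm', n', hn', w', hε.symm⟩

/-- Each cone is tested against the other, over the pullback square of `v` along the identity. -/
lemma IsProdCone.exists_iso {c b e c' e' : E} {κ : e ⟶ c} {ε : e ⟶ b} {κ' : e' ⟶ c'} {ε' : e' ⟶ b}
    (h : IsProdCone p v κ ε) (h' : IsProdCone p v κ' ε') :
    ∃ (i : c ≅ c') (j : e ≅ e'), p.IsHomLift (𝟙 J) i.hom ∧ p.IsHomLift (𝟙 L) j.hom ∧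
      j.hom ≫ κ' = κ ≫ i.hom ∧ j.hom ≫ ε' = ε := by
  have := h.cart
  have := h'.cart
  obtain ⟨i, ⟨hi, j, hj, h₁, h₂⟩, -⟩ := h'.existsUnique (IsPullback.id_horiz v).flip κ h.cart ε
    h.vert
  obtain ⟨i', ⟨hi', j', hj', h₁', h₂'⟩, -⟩ := h.existsUnique (IsPullback.id_horiz v).flip κ' h'.cart
    ε' h'.vert
  have hκ := IsHomLift.domain_eq p v κ
  have hκ' := IsHomLift.domain_eq p v κ'
  have e₁ : i ≫ i' = 𝟙 c := h.hom_ext (IsPullback.id_horiz v).flip h.cart (n := j ≫ j') (n' := 𝟙 e)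
    inferInstance (IsHomLift.id (IsHomLift.codomain_eq p v κ)) inferInstance
    (IsHomLift.id hκ) (by rw [Category.assoc, h₁', ← Category.assoc, h₁, Category.assoc])
    (by simp) (by rw [Category.assoc, h₂', h₂, Category.id_comp])
  have e₂ : i' ≫ i = 𝟙 c' := h'.hom_ext (IsPullback.id_horiz v).flip h'.cart (n := j' ≫ j)
    (n' := 𝟙 e') inferInstance (IsHomLift.id (IsHomLift.codomain_eq p v κ')) inferInstance
    (IsHomLift.id hκ') (by rw [Category.assoc, h₁, ← Category.assoc, h₁', Category.assoc])
    (by simp) (by rw [Category.assoc, h₂, h₂', Category.id_comp])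
  have : p.IsHomLift (𝟙 L) (𝟙 e) := IsHomLift.id hκ
  have : p.IsHomLift (𝟙 L) (𝟙 e') := IsHomLift.id hκ'
  refine ⟨⟨i, i', e₁, e₂⟩, ⟨j, j', ?_, ?_⟩, hi, hj, h₁, h₂⟩
  · refine Functor.IsStronglyCartesian.ext p v κ (𝟙 L) ?_
    rw [Category.assoc, h₁', ← Category.assoc, h₁, Category.assoc, e₁]
    simp
  · refine Functor.IsStronglyCartesian.ext p v κ' (𝟙 L) ?_
    rw [Category.assoc, h₁, ← Category.assoc, h₁', Category.assoc, e₂]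
    simp

lemma IsProdCone.of_iso {c b e c' e' : E} {κ : e ⟶ c} {ε : e ⟶ b} (h : IsProdCone p v κ ε)
    (i : c' ≅ c) (hi : p.IsHomLift (𝟙 J) i.hom) {κ' : e' ⟶ c'} (hκ' : p.IsStronglyCartesian v κ')
    {j : e' ⟶ e} (hj : p.IsHomLift (𝟙 L) j) (w : j ≫ κ = κ' ≫ i.hom) :
    IsProdCone p v κ' (j ≫ ε) := by
  have := h.cart
  have := h.vert
  have := IsHomLift.inv_vertical i hi
  refine ⟨hκ', inferInstance, fun {K I u g f} sq {d e₁} κ₁ hκ₁ φ hφ => ?_⟩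
  obtain ⟨m, ⟨hm, n, hn, h₁, h₂⟩, hu⟩ := h.existsUnique sq κ₁ hκ₁ φ hφ
  have hb : p.IsHomLift (g ≫ v) (κ₁ ≫ m ≫ i.inv) := by
    rw [← sq.w]
    infer_instance
  obtain ⟨n', ⟨hn', h₁'⟩, -⟩ := Functor.IsStronglyCartesian.universal_property p v κ' g _ rfl
    (κ₁ ≫ m ≫ i.inv)
  have e₁ : n' ≫ j = n := by
    have : p.IsHomLift g (n' ≫ j) := inferInstance
    refine Functor.IsStronglyCartesian.ext p v κ g ?_
    rw [Category.assoc, w, ← Category.assoc, h₁', h₁]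
    simp
  refine ⟨m ≫ i.inv, ⟨inferInstance, n', hn', h₁', by rw [← Category.assoc, e₁, h₂]⟩, ?_⟩
  rintro m' ⟨hm', n'', hn'', h₁'', h₂''⟩
  rw [Iso.eq_comp_inv]
  refine hu _ ⟨inferInstance, n'' ≫ j, inferInstance, ?_, by rw [Category.assoc, h₂'']⟩
  rw [Category.assoc, w, ← Category.assoc, h₁'', Category.assoc]

lemma IsProdCone.comp_iso {c b e b' : E} {κ : e ⟶ c} {ε : e ⟶ b} (h : IsProdCone p v κ ε)
    (i : b ≅ b') (hi : p.IsHomLift (𝟙 L) i.hom) : IsProdCone p v κ (ε ≫ i.hom) := by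
  have := h.vert
  have := IsHomLift.inv_vertical i hi
  refine ⟨h.cart, inferInstance, fun {K I u g f} sq {d e₁} κ₁ hκ₁ φ hφ => ?_⟩
  have := h.existsUnique sq κ₁ hκ₁ (φ ≫ i.inv) inferInstance
  simpa only [Iso.eq_comp_inv, Category.assoc] using this

/-- Stability is built into the definition, which tests against every pullback of `v`: a pullback of
`u` pasted with the given square is again a pullback of `v`. -/
lemma IsProdCone.base_change {K I : B} {u : K ⟶ I} {g : K ⟶ L} {f : I ⟶ J}
    (sq : IsPullback u g f v) {c b e c' b' e' : E} {κ : e ⟶ c} {ε : e ⟶ b}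
    (h : IsProdCone p v κ ε) {δ : c' ⟶ c} (hδ : p.IsStronglyCartesian f δ) {κ' : e' ⟶ c'}
    (hκ' : p.IsStronglyCartesian u κ') {τ : b' ⟶ b} (hτ : p.IsStronglyCartesian g τ)
    {n : e' ⟶ e} (hn : p.IsHomLift g n) (w : n ≫ κ = κ' ≫ δ) {ε' : e' ⟶ b'}
    (hε' : p.IsHomLift (𝟙 K) ε') (wε : ε' ≫ τ = n ≫ ε) : IsProdCone p u κ' ε' := by
  have := h.cart
  have := h.vert
  refine ⟨hκ', hε', fun {K₁ I₁ u₁ g₁ f₁} sq₁ {d e₁} κ₁ hκ₁ φ hφ => ?_⟩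
  have sq₂ : IsPullback u₁ (g₁ ≫ g) (f₁ ≫ f) v := sq₁.paste_vert sq
  obtain ⟨m, ⟨hm, k, hk, h₁, h₂⟩, hu⟩ := h.existsUnique sq₂ κ₁ hκ₁ (φ ≫ τ) inferInstance
  obtain ⟨m', ⟨hm', e₁⟩, -⟩ := Functor.IsStronglyCartesian.universal_property p f δ f₁ _ rfl m
  have hb : p.IsHomLift (g₁ ≫ u) (κ₁ ≫ m') := by
    rw [← sq₁.w]
    infer_instance
  obtain ⟨k', ⟨hk', e₂⟩, -⟩ := Functor.IsStronglyCartesian.universal_property p u κ' g₁ _ rfl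
    (κ₁ ≫ m')
  have e₃ : k' ≫ n = k := by
    refine Functor.IsStronglyCartesian.ext p v κ (g₁ ≫ g) ?_
    rw [Category.assoc, w, ← Category.assoc, e₂, h₁, Category.assoc, e₁]
  refine ⟨m', ⟨hm', k', hk', e₂, ?_⟩, ?_⟩
  · refine Functor.IsStronglyCartesian.ext p g τ g₁ ?_
    rw [Category.assoc, wε, ← Category.assoc, e₃, h₂]
  · rintro m'' ⟨hm'', k'', hk'', e₄, e₅⟩
    refine Functor.IsStronglyCartesian.ext p f δ f₁ ?_
    rw [e₁]
    refine hu _ ⟨inferInstance, k'' ≫ n, inferInstance, ?_, ?_⟩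
    · rw [Category.assoc, w, ← Category.assoc, e₄, Category.assoc]
    · rw [Category.assoc, ← wε, ← Category.assoc, e₅]

lemma IsProdCone.map {D : Type u₃} [Category.{v₃} D] {K : D ⥤ E} {q : D ⥤ B}
    (hK : IsOverEquivalence K q p) {c b e : D} {κ : e ⟶ c} {ε : e ⟶ b} (h : IsProdCone q v κ ε) :
    IsProdCone p v (K.map κ) (K.map ε) := by
  have := h.vert
  have := hK.full
  have := hK.faithful
  have hl {I J : B} (f : I ⟶ J) {X Y : D} (φ : X ⟶ Y) := isHomLift_map_iff hK.comp (f := f) φ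
  refine ⟨hK.map_isStronglyCartesian κ h.cart, (hl _ _).2 inferInstance,
    fun {M I u g f} sq {d e₁} κ₁ hκ₁ φ hφ => ?_⟩
  obtain ⟨d₀, i, hi⟩ := hK.surj d
  obtain ⟨e₀, j, hj⟩ := hK.surj e₁
  replace hi := isHomLift_id_of_obj_eq i.hom (IsHomLift.codomain_eq p u κ₁) hi
  replace hj := isHomLift_id_of_obj_eq j.hom (IsHomLift.domain_eq p u κ₁) hj
  have := IsHomLift.inv_vertical i hi
  have := IsHomLift.inv_vertical j hj
  obtain ⟨κ₀, hκ₀, w⟩ := IsOverEquivalence.exists_preimage (f := u) hK.comp (j.hom ≫ κ₁ ≫ i.inv)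
    inferInstance
  -- The image of `κ₀` is `κ₁` up to isomorphisms, hence cartesian, and the fully faithful `K`
  -- reflects cartesian maps.
  have hκ₀' : q.IsStronglyCartesian u κ₀ := by
    obtain ⟨G, hG, i₀, j₀, h₁, h₂⟩ := hK.exists_inverse
    have hc : p.IsStronglyCartesian u (K.map κ₀) := by
      rw [w]
      exact isStronglyCartesian_comp (Category.id_comp _) (.of_iso p (𝟙 M) j)
        (isStronglyCartesian_comp (Category.comp_id _) hκ₁ (.of_isIso p (𝟙 I) i.inv))
    exact
      { toIsHomLift := hκ₀
        universal_property' := by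
          intro Z t ψ hψ
          have hψ' := (hl (t ≫ u) ψ).2 hψ
          obtain ⟨χ, ⟨hχ, hχ'⟩, hu⟩ := Functor.IsStronglyCartesian.universal_property p u
            (K.map κ₀) t _ rfl (K.map ψ)
          obtain ⟨χ₀, hχ₀, rfl⟩ := IsOverEquivalence.exists_preimage hK.comp χ hχ
          refine ⟨χ₀, ⟨hχ₀, K.map_injective (by rw [K.map_comp, hχ'])⟩, ?_⟩
          rintro χ' ⟨h₃, rfl⟩
          exact K.map_injective (hu _ ⟨(hl _ _).2 h₃, (K.map_comp _ _).symm⟩) }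
  obtain ⟨φ₀, hφ₀, wφ⟩ := IsOverEquivalence.exists_preimage (f := g) hK.comp (j.hom ≫ φ)
    inferInstance
  obtain ⟨m, ⟨hm, n, hn, h₁, h₂⟩, hu⟩ := h.existsUnique sq κ₀ hκ₀' φ₀ hφ₀
  have hm' := (hl _ _).2 hm
  have hn' := (hl _ _).2 hn
  refine ⟨i.inv ≫ K.map m, ⟨inferInstance, j.inv ≫ K.map n, inferInstance, ?_, ?_⟩, ?_⟩
  · rw [Category.assoc, ← K.map_comp, h₁, K.map_comp, w]
    simp
  · rw [Category.assoc, ← K.map_comp, h₂, wφ]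
    simp
  · rintro m' ⟨hm₁, n', hn₁, h₃, h₄⟩
    obtain ⟨m₀, hm₀, wm⟩ := IsOverEquivalence.exists_preimage (f := f) hK.comp (i.hom ≫ m')
      inferInstance
    obtain ⟨n₀, hn₀, wn⟩ := IsOverEquivalence.exists_preimage (f := g) hK.comp (j.hom ≫ n')
      inferInstance
    rw [Iso.eq_inv_comp, ← wm]
    congr 1
    refine hu m₀ ⟨hm₀, n₀, hn₀, K.map_injective ?_, K.map_injective ?_⟩
    · rw [K.map_comp, K.map_comp, wm, wn, w, Category.assoc, h₃]
      simp
    · rw [K.map_comp, wn, wφ, Category.assoc, h₄]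

end ProdCones

/-! ### Fibred products correspond to product cones. -/

section Products

variable {B : Type u₁} [Category.{v₁} B] {E : Type u₂} [Category.{v₂} E] {p : E ⥤ B}
  [p.IsFibered] {F : MorphismProperty B}

/-- The map `n` is forced, being the lift of `m` to the cartesian maps over `u` and `v`; it is the
reindexed `m` followed by a coherence map. The claim is then the counit equation of the mate. -/
lemma rightComparison_fac {K L I J : B} {u : K ⟶ I} {g : K ⟶ L} {f : I ⟶ J} {v : L ⟶ J}
    (h : g ≫ v = u ≫ f) {Pv : p.Fiber L ⥤ p.Fiber J} {Pu : p.Fiber K ⥤ p.Fiber I}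
    (adjv : reindex p v ⊣ Pv) (adju : reindex p u ⊣ Pu) (b : p.Fiber L) {d : p.Fiber I}
    (m : d ⟶ reindexObj p f (Pv.obj b)) (n : (reindexObj p u d).1 ⟶ (reindexObj p v (Pv.obj b)).1)
    (hn : p.IsHomLift g n) (w : n ≫ cartLift p v (Pv.obj b) = cartLift p u d ≫ total m) :
    n ≫ (adjv.counit.app b).1 = ((adju.homEquiv _ _).symm
      (m ≫ (rightComparison p h adjv adju).app b)).1 ≫ cartLift p g b := by
  have key := mateEquiv_counit adjv adju (.mk _ _ _ _ (reindexSquare p h).inv) b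
  have hn' : n = ((reindex p u).map m).1 ≫ ((reindexSquare p h).inv.app (Pv.obj b)).1 ≫
      cartLift p g (reindexObj p v (Pv.obj b)) := by
    have h₁ : p.IsHomLift g (((reindex p u).map m).1 ≫
        ((reindexSquare p h).inv.app (Pv.obj b)).1 ≫ cartLift p g (reindexObj p v (Pv.obj b))) :=
      IsHomLift.of_comp_eq (Category.id_comp _) _ _ ((reindex p u).map m).2
        (IsHomLift.of_comp_eq (Category.id_comp _) _ _ ((reindexSquare p h).inv.app (Pv.obj b)).2
          (cartLift_isCartesian p g _).toIsHomLift)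
    refine @Functor.IsStronglyCartesian.ext _ _ _ _ p _ _ _ _ v (cartLift p v (Pv.obj b))
      inferInstance _ _ g _ _ hn h₁ ?_
    refine w.trans (Eq.symm ?_)
    refine (Category.assoc _ _ _).trans ?_
    refine (congrArg (_ ≫ ·) (Category.assoc _ _ _)).trans ?_
    refine (congrArg (((reindex p u).map m).1 ≫ ·)
      (reindexSquare_inv_cartLift h (Pv.obj b))).trans ?_
    refine (Category.assoc _ _ _).symm.trans ?_
    refine (congrArg (· ≫ cartLift p f (Pv.obj b)) (reindex_map_cartLift p u m)).trans ?_
    exact Category.assoc _ _ _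
  have h₂ : (adju.homEquiv _ _).symm (m ≫ (rightComparison p h adjv adju).app b) =
      (reindex p u).map m ≫ (reindexSquare p h).inv.app (Pv.obj b) ≫
        (reindex p g).map (adjv.counit.app b) := by
    refine (adju.homEquiv_counit _ _ _).trans ?_
    refine (congrArg (· ≫ adju.counit.app _) ((reindex p u).map_comp m _)).trans ?_
    refine (Category.assoc _ _ _).trans ?_
    exact congrArg ((reindex p u).map m ≫ ·) key
  rw [hn', h₂]
  refine (Category.assoc _ _ _).trans ?_
  refine Eq.trans ?_ (Category.assoc _ _ _).symm
  refine congrArg (((reindex p u).map m).1 ≫ ·) ?_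
  refine (Category.assoc _ _ _).trans ?_
  refine Eq.trans ?_ (Category.assoc _ _ _).symm
  exact congrArg (((reindexSquare p h).inv.app (Pv.obj b)).1 ≫ ·)
    (reindex_map_cartLift p g (adjv.counit.app b)).symm

/-- The dictionary between cones and Beck-Chevalley: the universal property of the counit cone at a
square asks that every map be uniquely of the form `m` followed by the comparison, which holds
exactly if the comparison is invertible. -/
lemma rightComparison_fac_iff {K L I J : B} {u : K ⟶ I} {g : K ⟶ L} {f : I ⟶ J} {v : L ⟶ J}
    (h : g ≫ v = u ≫ f) {Pv : p.Fiber L ⥤ p.Fiber J} {Pu : p.Fiber K ⥤ p.Fiber I}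
    (adjv : reindex p v ⊣ Pv) (adju : reindex p u ⊣ Pu) (b : p.Fiber L) {d : p.Fiber I}
    (m : d ⟶ reindexObj p f (Pv.obj b)) (φ : (reindex p u).obj d ⟶ reindexObj p g b) :
    (∃ n : (reindexObj p u d).1 ⟶ (reindexObj p v (Pv.obj b)).1, p.IsHomLift g n ∧
      n ≫ cartLift p v (Pv.obj b) = cartLift p u d ≫ total m ∧
        n ≫ (adjv.counit.app b).1 = total φ) ↔
      m ≫ (rightComparison p h adjv adju).app b = adju.homEquiv _ _ φ := by
  refine Iff.trans ?_ (Equiv.symm_apply_eq (adju.homEquiv _ _))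
  constructor
  · rintro ⟨n, hn, h₁, h₂⟩
    exact total_ext ((rightComparison_fac h adjv adju b m n hn h₁).symm.trans h₂)
  · intro h₁
    have : p.IsHomLift (g ≫ v) (cartLift p u d ≫ total m) := by
      rw [h]
      infer_instance
    obtain ⟨n, ⟨hn, h₂⟩, -⟩ := Functor.IsStronglyCartesian.universal_property p v
      (cartLift p v (Pv.obj b)) g _ rfl (cartLift p u d ≫ total m)
    exact ⟨n, hn, h₂, (rightComparison_fac h adjv adju b m n hn h₂).trans
      (congrArg total h₁)⟩

/-- The cone given by the counit of `v^* ⊣ ∏_v`. -/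
lemma HasFibredProducts.isProdCone [IsDisplayMapClass F] (hP : HasFibredProducts p F) {L J : B}
    (v : L ⟶ J) (hv : F v) (b : p.Fiber L) :
    IsProdCone p v (cartLift p v ((prod hP v hv).obj b)) ((prodAdj hP v hv).counit.app b).1 where
  cart := inferInstance
  vert := ((prodAdj hP v hv).counit.app b).2
  existsUnique := by
    intro K I u g f sq d e' κ' hκ' φ hφ
    have hu : F u := F.of_isPullback sq.flip hv
    let d₀ : p.Fiber I := ⟨d, IsHomLift.codomain_eq p u κ'⟩
    obtain ⟨j, hj, hj'⟩ := exists_vertical_iso_of_isStronglyCartesian (cartLift p u d₀) κ'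
      inferInstance hκ'
    have hj'' := IsHomLift.inv_vertical j hj
    have := hP.beckChevalley sq hv hu (prodAdj hP v hv) (prodAdj hP u hu)
    let r : reindexObj p f ((prod hP v hv).obj b) ⟶ (prod hP u hu).obj (reindexObj p g b) :=
      (rightComparison p sq.w.symm (prodAdj hP v hv) (prodAdj hP u hu)).app b
    have hr : IsIso r := NatIso.isIso_app_of_isIso _ b
    let φ' : (reindex p u).obj d₀ ⟶ reindexObj p g b := vertLift p g (a := b) (j.hom ≫ φ)
      (IsHomLift.of_comp_eq (Category.id_comp _) _ _ hj hφ)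
    have hφ' : total φ' = j.hom ≫ φ := total_vertLift p g _ _
    have hiff (m : d₀ ⟶ reindexObj p f ((prod hP v hv).obj b)) :
        (∃ n : e' ⟶ (reindexObj p v ((prod hP v hv).obj b)).1, p.IsHomLift g n ∧
          n ≫ cartLift p v ((prod hP v hv).obj b) = κ' ≫ total m ∧
            n ≫ ((prodAdj hP v hv).counit.app b).1 = φ) ↔
              m ≫ r = (prodAdj hP u hu).homEquiv _ _ φ' := by
      refine Iff.trans ?_ (rightComparison_fac_iff sq.w.symm (prodAdj hP v hv) (prodAdj hP u hu) b
        m φ')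
      rw [hφ']
      constructor
      · rintro ⟨n, hn, h₁, h₂⟩
        refine ⟨j.hom ≫ n, inferInstance, ?_, ?_⟩
        · rw [Category.assoc, h₁, ← Category.assoc, hj']
        · refine (Category.assoc _ _ _).trans (congrArg (j.hom ≫ ·) h₂)
      · rintro ⟨n, hn, h₁, h₂⟩
        refine ⟨j.inv ≫ n, inferInstance, ?_, ?_⟩
        · rw [Category.assoc, h₁, ← Category.assoc, ← hj', Iso.inv_hom_id_assoc]
        · refine (Category.assoc _ _ _).trans ((congrArg (j.inv ≫ ·) h₂).trans ?_)
          exact Iso.inv_hom_id_assoc _ _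
    refine ⟨total ((prodAdj hP u hu).homEquiv _ _ φ' ≫ inv r), ⟨total_isHomLift p _,
      (hiff _).2 (by simp)⟩, ?_⟩
    rintro m ⟨hm, hn⟩
    have hm' : total (vertLift p f m hm : d₀ ⟶ reindexObj p f ((prod hP v hv).obj b)) = m :=
      total_vertLift p f _ _
    rw [← hm'] at hn ⊢
    congr 1
    exact (IsIso.eq_comp_inv _).2 ((hiff _).1 hn)

lemma IsProdCone.normalize {L J : B} {v : L ⟶ J} {c b e : E} {κ : e ⟶ c} {ε : e ⟶ b}
    (h : IsProdCone p v κ ε) : ∃ (c₀ : p.Fiber J) (ε₀ : (reindexObj p v c₀).1 ⟶ b),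
      IsProdCone p v (cartLift p v c₀) ε₀ := by
  have := h.cart
  have hc := IsHomLift.codomain_eq p v κ
  obtain ⟨j, hj, hj'⟩ := exists_vertical_iso_of_isStronglyCartesian (f := v)
    (cartLift p v ⟨c, hc⟩) κ (cartLift_isStronglyCartesian _ _) h.cart
  exact ⟨⟨c, hc⟩, _, h.of_iso (Iso.refl c) (IsHomLift.id hc) (cartLift_isStronglyCartesian _ _) hj
    (hj'.trans (Category.comp_id _).symm)⟩

/-- Over the pullback of `v` along the identity, the universal property of a cone is that of the
counit of `v^* ⊣ ∏_v` at `b`. -/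
lemma IsProdCone.existsUnique_vertical {L J : B} {v : L ⟶ J} {c : p.Fiber J} {b : p.Fiber L}
    {ε : (reindex p v).obj c ⟶ b} (h : IsProdCone p v (cartLift p v c) ε.1) {d : p.Fiber J}
    (φ : (reindex p v).obj d ⟶ b) : ∃! m : d ⟶ c, (reindex p v).map m ≫ ε = φ := by
  obtain ⟨m, ⟨hm, n, hn, h₁, h₂⟩, hu⟩ := h.existsUnique (IsPullback.id_horiz v).flip
    (cartLift p v d) inferInstance φ.1 φ.2
  have key (m : d ⟶ c) : (reindex p v).map m ≫ ε = φ ↔ ∃ n : (reindexObj p v d).1 ⟶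
      (reindexObj p v c).1, p.IsHomLift (𝟙 L) n ∧ n ≫ cartLift p v c = cartLift p v d ≫ m.1 ∧
        n ≫ ε.1 = φ.1 := by
    constructor
    · intro h
      exact ⟨((reindex p v).map m).1, ((reindex p v).map m).2, reindex_map_cartLift p v m,
        congrArg Subtype.val h⟩
    · rintro ⟨n, hn, h₁, h₂⟩
      have e : (⟨n, hn⟩ : (reindex p v).obj d ⟶ (reindex p v).obj c) = (reindex p v).map m :=
        total_ext (a := c) (h₁.trans (reindex_map_cartLift p v m).symm)
      rw [← e]
      exact Subtype.ext h₂
  refine ⟨⟨m, hm⟩, (key _).2 ⟨n, hn, h₁, h₂⟩, fun m' hm' => Subtype.ext ?_⟩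
  exact hu m'.1 ⟨m'.2, (key m').1 hm'⟩

/-- The apex of a cone and the value of a right adjoint represent the same functor on the fibre, so
they are isomorphic compatibly with `ε` and the counit. The stable universal property passes along
this isomorphism. -/
lemma isProdCone_counit_of_isProdCone {L J : B} {v : L ⟶ J} {P : p.Fiber L ⥤ p.Fiber J}
    (adj : reindex p v ⊣ P) {b : p.Fiber L} {c e : E} {κ : e ⟶ c} {ε : e ⟶ b.1}
    (h : IsProdCone p v κ ε) : IsProdCone p v (cartLift p v (P.obj b)) (adj.counit.app b).1 := by
  obtain ⟨c₀, ε₀, h₀⟩ := h.normalize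
  let ε₁ : (reindex p v).obj c₀ ⟶ b := ⟨ε₀, h₀.vert⟩
  obtain ⟨m, hm, -⟩ := h₀.existsUnique_vertical (ε := ε₁) (adj.counit.app b)
  let i := adj.homEquiv _ _ ε₁
  have hi : (reindex p v).map i ≫ adj.counit.app b = ε₁ :=
    (adj.homEquiv_counit _ _ _).symm.trans (Equiv.symm_apply_apply _ _)
  have e₁ : m ≫ i = 𝟙 (P.obj b) := by
    apply (adj.homEquiv _ _).symm.injective
    rw [Adjunction.homEquiv_counit, Adjunction.homEquiv_counit, Functor.map_comp, Category.assoc,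
      hi, hm]
    simp
  have e₂ : i ≫ m = 𝟙 c₀ := (h₀.existsUnique_vertical (ε := ε₁) ε₁).unique
    (by rw [Functor.map_comp, Category.assoc, hm, hi]) (by simp)
  have h₁ := h₀.of_iso (isoOfFiberIso ⟨m, i, e₁, e₂⟩) m.2
    (κ' := cartLift p v (P.obj b)) inferInstance ((reindex p v).map m).2
    (reindex_map_cartLift p v m)
  have e₃ : ((reindex p v).map m).1 ≫ ε₀ = (adj.counit.app b).1 := congrArg Subtype.val hm
  exact e₃ ▸ h₁

/-- A cone on `b` is a terminal object of the category of maps from values of `v^*` to `b`, which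
yields the adjoint objectwise. Beck-Chevalley is the universal property at the remaining squares. -/
lemma hasFibredProducts_of_isProdCone [IsDisplayMapClass F]
    (h : ∀ ⦃L J : B⦄ (v : L ⟶ J), F v → ∀ b : p.Fiber L, ∃ (c e : E) (κ : e ⟶ c) (ε : e ⟶ b.1),
      IsProdCone p v κ ε) : HasFibredProducts p F where
  isLeftAdjoint := by
    intro L J v hv
    have (b : p.Fiber L) : HasTerminal (CostructuredArrow (reindex p v) b) := by
      obtain ⟨c, e, κ, ε, hc⟩ := h v hv b
      obtain ⟨c₀, ε₀, h₀⟩ := hc.normalize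
      let ε₁ : (reindex p v).obj c₀ ⟶ b := ⟨ε₀, h₀.vert⟩
      have hu {d : p.Fiber J} (φ : (reindex p v).obj d ⟶ b) := h₀.existsUnique_vertical (ε := ε₁) φ
      refine IsTerminal.hasTerminal (X := CostructuredArrow.mk ε₁) (IsTerminal.ofUniqueHom
        (fun X => CostructuredArrow.homMk (hu X.hom).choose (hu X.hom).choose_spec.1)
        (fun X m => ?_))
      exact CostructuredArrow.hom_ext _ _ ((hu X.hom).choose_spec.2 _ (CostructuredArrow.w m))
    exact isLeftAdjoint_of_costructuredArrowTerminals _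
  beckChevalley := by
    intro K L I J u g f v sq hv hu Pv Pu adjv adju
    have (b : p.Fiber L) : IsIso ((rightComparison p sq.w.symm adjv adju).app b) := by
      obtain ⟨c, e, κ, ε, hc⟩ := h v hv b
      have h₁ := isProdCone_counit_of_isProdCone adjv hc
      let r : reindexObj p f (Pv.obj b) ⟶ Pu.obj (reindexObj p g b) :=
        (rightComparison p sq.w.symm adjv adju).app b
      -- Composition with `r` is bijective on maps from every `d`, so `r` is invertible.
      have key {d : p.Fiber I} (ψ : d ⟶ Pu.obj (reindexObj p g b)) :
          ∃! m : d ⟶ reindexObj p f (Pv.obj b), m ≫ r = ψ := by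
        let φ : (reindex p u).obj d ⟶ reindexObj p g b := (adju.homEquiv _ _).symm ψ
        have hφ : adju.homEquiv _ _ φ = ψ := Equiv.apply_symm_apply _ _
        obtain ⟨m, ⟨hm, hn⟩, huniq⟩ := h₁.existsUnique sq (cartLift p u d) inferInstance (total φ)
          (total_isHomLift p _)
        have hm' : total (vertLift p f m hm : d ⟶ reindexObj p f (Pv.obj b)) = m :=
          total_vertLift p f _ _
        rw [← hm'] at hn
        refine ⟨vertLift p f m hm, ?_, fun m' h' => total_ext ?_⟩
        · exact ((rightComparison_fac_iff sq.w.symm adjv adju b _ φ).1 hn).trans hφ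
        · rw [hm']
          exact huniq _ ⟨total_isHomLift p _,
            (rightComparison_fac_iff sq.w.symm adjv adju b m' φ).2 (h'.trans hφ.symm)⟩
      obtain ⟨s, hs, -⟩ := key (𝟙 _)
      have e : r ≫ s = 𝟙 _ := (key r).unique ((Category.assoc _ _ _).trans
        ((congrArg (r ≫ ·) hs).trans (Category.comp_id _))) (Category.id_comp _)
      exact ⟨s, e, hs⟩
    exact NatIso.isIso_of_isIso_app _

end Products

/-! ### Orthogonality to product cones and its invariance. -/

section ProdOrth

variable {B : Type u₁} [Category.{v₁} B] {E : Type u₂} [Category.{v₂} E]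

/-- Given `κ : e ⟶ c` and `ε : e ⟶ b` over `v : L ⟶ J`, a cartesian map `κ' : c' ⟶ c` and a lift
`n : c' ⟶ e` of `κ'` over `g : A ⟶ L`, the map `n ≫ ε` factors as the vertical `θ : c' ⟶ b'`
followed by the cartesian `l : b' ⟶ b` over `g`. -/
structure IsProdLeg (p : E ⥤ B) {A L : B} (g : A ⟶ L) {c b e c' b' : E} (κ : e ⟶ c) (ε : e ⟶ b)
    (κ' : c' ⟶ c) (l : b' ⟶ b) (θ : c' ⟶ b') : Prop where
  cart : p.IsStronglyCartesian g l
  vert : p.IsHomLift (𝟙 A) θ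
  fac : ∃ n : c' ⟶ e, p.IsHomLift g n ∧ n ≫ κ = κ' ∧ n ≫ ε = θ ≫ l

/-- Every vertical map `c' ⟶ a` factors uniquely through a leg at a unique `g`. -/
structure ProdOrthAt (p : E ⥤ B) (A : B) {L : B} {c b e c' : E} (κ : e ⟶ c) (ε : e ⟶ b)
    (κ' : c' ⟶ c) (a : E) : Prop where
  exists_fac : ∀ h : c' ⟶ a, p.IsHomLift (𝟙 A) h → ∃ (g : A ⟶ L) (b' : E) (l : b' ⟶ b)
    (θ : c' ⟶ b') (s : b' ⟶ a), IsProdLeg p g κ ε κ' l θ ∧ p.IsHomLift (𝟙 A) s ∧ θ ≫ s = h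
  unique : ∀ {g₁ g₂ : A ⟶ L} {b₁ b₂ : E} {l₁ : b₁ ⟶ b} {l₂ : b₂ ⟶ b} {θ₁ : c' ⟶ b₁}
    {θ₂ : c' ⟶ b₂}, IsProdLeg p g₁ κ ε κ' l₁ θ₁ → IsProdLeg p g₂ κ ε κ' l₂ θ₂ →
      ∀ (s₁ : b₁ ⟶ a) (s₂ : b₂ ⟶ a), p.IsHomLift (𝟙 A) s₁ → p.IsHomLift (𝟙 A) s₂ →
        θ₁ ≫ s₁ = θ₂ ≫ s₂ → g₁ = g₂
  epi : ∀ {g : A ⟶ L} {b₁ : E} {l : b₁ ⟶ b} {θ : c' ⟶ b₁}, IsProdLeg p g κ ε κ' l θ →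
    ∀ s₁ s₂ : b₁ ⟶ a, p.IsHomLift (𝟙 A) s₁ → p.IsHomLift (𝟙 A) s₂ → θ ≫ s₁ = θ ≫ s₂ → s₁ = s₂

/-- `a` is orthogonal to the product cones over display maps. -/
def ProdOrth (p : E ⥤ B) (F : MorphismProperty B) (a : E) : Prop :=
  ∀ ⦃L J A : B⦄ ⦃v : L ⟶ J⦄, F v → ∀ ⦃c b e : E⦄ ⦃κ : e ⟶ c⦄ ⦃ε : e ⟶ b⦄, IsProdCone p v κ ε →
    ∀ ⦃k : A ⟶ J⦄ ⦃c' : E⦄ ⦃κ' : c' ⟶ c⦄, p.IsStronglyCartesian k κ' →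
      ProdOrthAt p A (L := L) κ ε κ' a

variable {p : E ⥤ B} {A L J : B}

lemma IsProdLeg.comp_eq {v : L ⟶ J} {g : A ⟶ L} {k : A ⟶ J} {c b e c' b' : E} {κ : e ⟶ c}
    {ε : e ⟶ b} {κ' : c' ⟶ c} {l : b' ⟶ b} {θ : c' ⟶ b'} (h : IsProdLeg p g κ ε κ' l θ)
    (hκ : p.IsHomLift v κ) (hκ' : p.IsHomLift k κ') : g ≫ v = k := by
  obtain ⟨n, hn, h₁, -⟩ := h.fac
  exact isHomLift_unique p κ' (h₁ ▸ inferInstance) hκ'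

/-- A leg at `g` is the component `k^* ∏_v b ⟶ g^* b` of the evaluation. It exists for every `g`
over `k` and every cartesian lifting of `g`, and by the next lemma it is unique up to vertical
isomorphism. -/
lemma IsProdLeg.exists {v : L ⟶ J} {g : A ⟶ L} {k : A ⟶ J} (hg : g ≫ v = k) {c b e c' b' : E}
    {κ : e ⟶ c} {ε : e ⟶ b} (hκ : p.IsStronglyCartesian v κ) (hε : p.IsHomLift (𝟙 L) ε)
    {κ' : c' ⟶ c} (hκ' : p.IsHomLift k κ') {l : b' ⟶ b} (hl : p.IsStronglyCartesian g l) :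
    ∃ θ : c' ⟶ b', IsProdLeg p g κ ε κ' l θ := by
  obtain ⟨n, ⟨hn, h₁⟩, -⟩ := Functor.IsStronglyCartesian.universal_property p v κ g k hg.symm κ'
  obtain ⟨θ, ⟨hθ, h₂⟩, -⟩ := Functor.IsStronglyCartesian.universal_property p g l (𝟙 A) g
    (Category.id_comp _).symm (n ≫ ε)
  exact ⟨θ, hl, hθ, n, hn, h₁, h₂.symm⟩

lemma IsProdLeg.exists_iso {v : L ⟶ J} {g : A ⟶ L} {c b e c' b₁ b₂ : E} {κ : e ⟶ c} {ε : e ⟶ b}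
    (hκ : p.IsStronglyCartesian v κ) {κ' : c' ⟶ c} {l₁ : b₁ ⟶ b} {θ₁ : c' ⟶ b₁} {l₂ : b₂ ⟶ b}
    {θ₂ : c' ⟶ b₂} (h₁ : IsProdLeg p g κ ε κ' l₁ θ₁) (h₂ : IsProdLeg p g κ ε κ' l₂ θ₂) :
    ∃ i : b₁ ≅ b₂, p.IsHomLift (𝟙 A) i.hom ∧ i.hom ≫ l₂ = l₁ ∧ θ₁ ≫ i.hom = θ₂ := by
  have := h₁.vert
  have := h₂.vert
  have := h₂.cart
  obtain ⟨i, hi, hi'⟩ := exists_vertical_iso_of_isStronglyCartesian l₁ l₂ h₁.cart h₂.cart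
  refine ⟨i, hi, hi', ?_⟩
  obtain ⟨n₁, hn₁, e₁, e₂⟩ := h₁.fac
  obtain ⟨n₂, hn₂, e₃, e₄⟩ := h₂.fac
  obtain rfl : n₁ = n₂ := Functor.IsStronglyCartesian.ext p v κ g (e₁.trans e₃.symm)
  refine Functor.IsStronglyCartesian.ext p g l₂ (𝟙 A) ?_
  rw [Category.assoc, hi', ← e₂, e₄]

/-- Transfer of `ProdOrthAt` along a correspondence between legs. -/
lemma ProdOrthAt.transfer {L₁ : B} {c b e c' c₁ b₁ e₁ c₁' a : E} {κ : e ⟶ c} {ε : e ⟶ b}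
    {κ' : c' ⟶ c} {κ₁ : e₁ ⟶ c₁} {ε₁ : e₁ ⟶ b₁} {κ₁' : c₁' ⟶ c₁}
    (H : ProdOrthAt p A (L := L₁) κ₁ ε₁ κ₁' a) (w : c₁' ≅ c') (hw : p.IsHomLift (𝟙 A) w.hom)
    (T : (A ⟶ L₁) → (A ⟶ L))
    (h₁ : ∀ {g : A ⟶ L₁} {b' : E} {l : b' ⟶ b₁} {θ : c₁' ⟶ b'}, IsProdLeg p g κ₁ ε₁ κ₁' l θ →
      ∃ l' : b' ⟶ b, IsProdLeg p (T g) κ ε κ' l' (w.inv ≫ θ))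
    (h₂ : ∀ {g : A ⟶ L} {b' : E} {l : b' ⟶ b} {θ : c' ⟶ b'}, IsProdLeg p g κ ε κ' l θ →
      ∃ (g' : A ⟶ L₁) (l' : b' ⟶ b₁), T g' = g ∧ IsProdLeg p g' κ₁ ε₁ κ₁' l' (w.hom ≫ θ)) :
    ProdOrthAt p A (L := L) κ ε κ' a where
  exists_fac h hh := by
    obtain ⟨g, b', l, θ, s, h₃, h₄, h₅⟩ := H.exists_fac (w.hom ≫ h) inferInstance
    obtain ⟨l', hl'⟩ := h₁ h₃
    exact ⟨T g, b', l', _, s, hl', h₄, by rw [Category.assoc, h₅, Iso.inv_hom_id_assoc]⟩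
  unique H₁ H₂ s₁ s₂ hs₁ hs₂ e := by
    obtain ⟨g₁, l₁, rfl, H₁'⟩ := h₂ H₁
    obtain ⟨g₂, l₂, rfl, H₂'⟩ := h₂ H₂
    rw [H.unique H₁' H₂' s₁ s₂ hs₁ hs₂ (by rw [Category.assoc, e, Category.assoc])]
  epi H₁ s₁ s₂ hs₁ hs₂ e := by
    obtain ⟨g₁, l₁, rfl, H₁'⟩ := h₂ H₁
    exact H.epi H₁' s₁ s₂ hs₁ hs₂ (by rw [Category.assoc, e, Category.assoc])

lemma ProdOrthAt.of_iso {c b e c' a a' : E} {κ : e ⟶ c} {ε : e ⟶ b}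
    {κ' : c' ⟶ c} (H : ProdOrthAt p A (L := L) κ ε κ' a) (i : a ≅ a')
    (hi : p.IsHomLift (𝟙 A) i.hom) : ProdOrthAt p A (L := L) κ ε κ' a' where
  exists_fac h hh := by
    have := IsHomLift.inv_vertical i hi
    obtain ⟨g, b', l, θ, s, h₃, h₄, h₅⟩ := H.exists_fac (h ≫ i.inv) inferInstance
    exact ⟨g, b', l, θ, s ≫ i.hom, h₃, inferInstance, by rw [← Category.assoc, h₅]; simp⟩
  unique H₁ H₂ s₁ s₂ hs₁ hs₂ e := by
    have := IsHomLift.inv_vertical i hi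
    exact H.unique H₁ H₂ (s₁ ≫ i.inv) (s₂ ≫ i.inv) inferInstance inferInstance
      (by rw [← Category.assoc, e, Category.assoc])
  epi H₁ s₁ s₂ hs₁ hs₂ e := by
    have := IsHomLift.inv_vertical i hi
    exact (cancel_mono i.inv).1 (H.epi H₁ (s₁ ≫ i.inv) (s₂ ≫ i.inv) inferInstance inferInstance
      (by rw [← Category.assoc, e, Category.assoc]))

lemma ProdOrth.of_iso {F : MorphismProperty B} {a a' : E} (H : ProdOrth p F a) (i : a ≅ a')
    (hi : p.IsHomLift (𝟙 (p.obj a')) i.hom) : ProdOrth p F a' := by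
  intro L J A v hv c b e κ ε h k c' κ' hκ'
  -- If `a'` does not lie over `A`, no map into it is vertical over `A` and all three clauses are
  -- vacuous.
  by_cases hA : p.obj a' = A
  · exact (H hv h hκ').of_iso i (isHomLift_id_of_obj_eq _ hA hi)
  · exact ⟨fun f hf => (hA (IsHomLift.codomain_eq p (𝟙 A) f)).elim,
      fun _ _ s _ hs _ _ => (hA (IsHomLift.codomain_eq p (𝟙 A) s)).elim,
      fun _ s _ hs _ _ => (hA (IsHomLift.codomain_eq p (𝟙 A) s)).elim⟩

/-- Independence of `ProdOrthAt` of the cone. -/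
lemma ProdOrthAt.of_cone_iso {v : L ⟶ J} {c b e c₁ e₁ c' c₁' a : E} {κ : e ⟶ c} {ε : e ⟶ b}
    {κ' : c' ⟶ c} {κ₁ : e₁ ⟶ c₁} {ε₁ : e₁ ⟶ b} {κ₁' : c₁' ⟶ c₁}
    (H : ProdOrthAt p A (L := L) κ₁ ε₁ κ₁' a) (h₁ : IsProdCone p v κ₁ ε₁)
    (h : IsProdCone p v κ ε) {k : A ⟶ J} (hκ₁' : p.IsStronglyCartesian k κ₁')
    (hκ' : p.IsStronglyCartesian k κ') : ProdOrthAt p A (L := L) κ ε κ' a := by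
  obtain ⟨i, j, hi, hj, hij, hε⟩ := h₁.exists_iso h
  have hc : p.IsStronglyCartesian k (κ₁' ≫ i.hom) :=
    isStronglyCartesian_comp (Category.comp_id _) hκ₁' (.of_iso p (𝟙 J) i)
  obtain ⟨w, hw, hw'⟩ := exists_vertical_iso_of_isStronglyCartesian _ _ hc hκ'
  have hwi := IsHomLift.inv_vertical w hw
  have hji := IsHomLift.inv_vertical j hj
  have hκ₁ : κ₁' = w.hom ≫ κ' ≫ i.inv := by
    rw [← Category.assoc, Iso.eq_comp_inv, hw']
  refine H.transfer w hw _root_.id (fun {g b' l θ} hl => ⟨l, ?_⟩) (fun {g b' l θ} hl => ⟨g, l, rfl, ?_⟩)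
  · obtain ⟨n, hn, e₁, e₂⟩ := hl.fac
    have := hl.vert
    refine ⟨hl.cart, inferInstance, w.inv ≫ n ≫ j.hom,
      (inferInstance : p.IsHomLift g (w.inv ≫ n ≫ j.hom)), ?_, ?_⟩
    · simp only [Category.assoc, hij]
      rw [← Category.assoc n, e₁, ← hw', Iso.inv_hom_id_assoc]
    · simp only [Category.assoc, hε]
      rw [e₂]
  · obtain ⟨n, hn, e₁, e₂⟩ := hl.fac
    have := hl.vert
    refine ⟨hl.cart, inferInstance, w.hom ≫ n ≫ j.inv, inferInstance, ?_, ?_⟩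
    · have : j.inv ≫ κ₁ = κ ≫ i.inv := by
        rw [Iso.inv_comp_eq, ← Category.assoc, hij]
        simp
      simp only [Category.assoc, this]
      rw [← Category.assoc n, e₁, hκ₁]
    · simp only [Category.assoc, ← hε]
      rw [Iso.inv_hom_id_assoc, e₂]

/-- `ProdOrthAt` only has to be checked after a change of base. -/
lemma ProdOrthAt.of_base_change {K : B} {u : K ⟶ A} {t : K ⟶ L} {k : A ⟶ J} {v : L ⟶ J}
    (sq : IsPullback u t k v) {c b e c' b₁ e₁ a : E} {κ : e ⟶ c} {ε : e ⟶ b} {κ' : c' ⟶ c}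
    (h : IsProdCone p v κ ε) (hκ' : p.IsStronglyCartesian k κ') {κ₁ : e₁ ⟶ c'}
    (hκ₁ : p.IsStronglyCartesian u κ₁) {τ : b₁ ⟶ b} (hτ : p.IsStronglyCartesian t τ) {n : e₁ ⟶ e}
    (hn : p.IsHomLift t n) (w : n ≫ κ = κ₁ ≫ κ') {ε₁ : e₁ ⟶ b₁} (hε₁ : p.IsHomLift (𝟙 K) ε₁)
    (wε : ε₁ ≫ τ = n ≫ ε) (H : ProdOrthAt p A (L := K) κ₁ ε₁ (𝟙 c') a) :
    ProdOrthAt p A (L := L) κ ε κ' a := by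
  have := h.cart
  have := h.vert
  have hid : p.IsHomLift (𝟙 A) (𝟙 c') := IsHomLift.id (IsHomLift.domain_eq p k κ')
  -- By the pullback property, composition with `t` is a bijection from sections of `u` to maps `A ⟶
  -- L` over `k`, and the legs at corresponding maps agree.
  refine H.transfer (Iso.refl c') hid (· ≫ t) (fun {g b' l θ} hl => ⟨l ≫ τ, ?_⟩)
    (fun {g b' l θ} hl => ?_)
  · obtain ⟨m, hm, e₁, e₂⟩ := hl.fac
    have := hl.vert
    have := hl.cart
    refine ⟨inferInstance, by simpa using hl.vert, m ≫ n, inferInstance, ?_, ?_⟩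
    · rw [Category.assoc, w, ← Category.assoc, e₁, Category.id_comp]
    · rw [Category.assoc, ← wε, ← Category.assoc, e₂]
      simp
  · obtain ⟨m, hm, e₁, e₂⟩ := hl.fac
    have := hl.vert
    have := hl.cart
    have hg : 𝟙 A ≫ k = g ≫ v := (Category.id_comp _).trans (hl.comp_eq h.cart.toIsHomLift
      hκ'.toIsHomLift).symm
    have h₁ : sq.lift (𝟙 A) g hg ≫ u = 𝟙 A := sq.lift_fst _ _ _
    have h₂ : sq.lift (𝟙 A) g hg ≫ t = g := sq.lift_snd _ _ _
    generalize sq.lift (𝟙 A) g hg = g' at h₁ h₂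
    obtain ⟨l', ⟨hl', e₃⟩, -⟩ := Functor.IsStronglyCartesian.universal_property p t τ g' g
      h₂.symm l
    obtain ⟨m', ⟨hm', e₄⟩, -⟩ := Functor.IsStronglyCartesian.universal_property p u κ₁ g' (𝟙 A)
      h₁.symm (𝟙 c')
    have hcl : p.IsStronglyCartesian g' l' := by
      have : p.IsStronglyCartesian (g' ≫ t) (l' ≫ τ) := by rwa [h₂, e₃]
      exact Functor.IsStronglyCartesian.of_comp p (g := t) (ψ := τ)
    have e₅ : m' ≫ n = m := by
      have : p.IsHomLift g (m' ≫ n) := h₂ ▸ inferInstance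
      refine Functor.IsStronglyCartesian.ext p v κ g ?_
      rw [Category.assoc, w, ← Category.assoc, e₄, Category.id_comp, e₁]
    refine ⟨g', l', h₂, hcl, by simpa using hl.vert, m', hm', e₄, ?_⟩
    have h₃ : p.IsHomLift g' (((Iso.refl c').hom ≫ θ) ≫ l') :=
      IsHomLift.of_comp_eq (Category.id_comp _) _ _ (by simpa using hl.vert) hl'
    refine Functor.IsStronglyCartesian.ext p t τ g' ?_
    simp only [Iso.refl_hom, Category.id_comp, Category.assoc]
    rw [wε, e₃, ← Category.assoc, e₅, e₂]

/-- An equivalence preserves cones and legs, so uniqueness reflects at once. For existence, the leg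
found in `D` has to be replaced by the image of one in `E`. -/
lemma ProdOrth.of_map {D : Type u₃} [Category.{v₃} D] {q : D ⥤ B} [p.IsFibered] {G : E ⥤ D}
    (hG : IsOverEquivalence G p q) {F : MorphismProperty B} {a : E} (ha : ProdOrth q F (G.obj a)) :
    ProdOrth p F a := by
  intro L J A v hv c b e κ ε h k c' κ' hκ'
  have H := ha hv (h.map hG) (hG.map_isStronglyCartesian κ' hκ')
  have := hG.full
  have := hG.faithful
  have := h.vert
  have := h.cart
  have hl {I J : B} {f : I ⟶ J} {X Y : E} (φ : X ⟶ Y) := isHomLift_map_iff hG.comp (f := f) φ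
  have leg {g : A ⟶ L} {b' : E} {l : b' ⟶ b} {θ : c' ⟶ b'} (hleg : IsProdLeg p g κ ε κ' l θ) :
      IsProdLeg q g (G.map κ) (G.map ε) (G.map κ') (G.map l) (G.map θ) := by
    obtain ⟨n, hn, e₁, e₂⟩ := hleg.fac
    refine ⟨hG.map_isStronglyCartesian _ hleg.cart, (hl _).2 hleg.vert, G.map n, (hl _).2 hn, ?_, ?_⟩
    · rw [← G.map_comp, e₁]
    · rw [← G.map_comp, e₂, G.map_comp]
  refine ⟨fun f hf => ?_, fun H₁ H₂ s₁ s₂ hs₁ hs₂ e => ?_, fun H₁ s₁ s₂ hs₁ hs₂ e => ?_⟩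
  · obtain ⟨g, b₀, l₀, θ₀, s₀, hleg, hs₀, e⟩ := H.exists_fac (G.map f) ((hl _).2 hf)
    -- The leg found in `D` need not come from `E`, but its index `g` has a leg in `E`, whose image
    -- is isomorphic to it.
    obtain ⟨b', l, hl'⟩ := exists_isStronglyCartesian p g (IsHomLift.codomain_eq p (𝟙 L) ε)
    obtain ⟨θ, hθ⟩ := IsProdLeg.exists (hleg.comp_eq ((hl _).2 h.cart.toIsHomLift)
      ((hl _).2 hκ'.toIsHomLift)) h.cart h.vert hκ'.toIsHomLift hl'
    obtain ⟨i, hi, -, hi'⟩ := (leg hθ).exists_iso (hG.map_isStronglyCartesian _ h.cart) hleg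
    obtain ⟨s, hs, hs'⟩ := IsOverEquivalence.exists_preimage (f := 𝟙 A) hG.comp (i.hom ≫ s₀)
      inferInstance
    refine ⟨g, b', l, θ, s, hθ, hs, G.map_injective ?_⟩
    rw [G.map_comp, hs', ← Category.assoc, hi', e]
  · exact H.unique (leg H₁) (leg H₂) (G.map s₁) (G.map s₂) ((hl _).2 hs₁) ((hl _).2 hs₂)
      (by rw [← G.map_comp, e, G.map_comp])
  · exact G.map_injective (H.epi (leg H₁) (G.map s₁) (G.map s₂) ((hl _).2 hs₁) ((hl _).2 hs₂)
      (by rw [← G.map_comp, e, G.map_comp]))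

end ProdOrth

/-! ### Splitting for products as orthogonality. -/

section ProdSplitting

variable {B : Type u₁} [Category.{v₁} B] {E : Type u₂} [Category.{v₂} E] {p : E ⥤ B}
  [p.IsFibered] {F : MorphismProperty B}

lemma comp_hom_inv_comp {C : Type u₁} [Category.{v₁} C] {W X Y Z : C} (f : W ⟶ X) (i : X ≅ Y)
    (g : X ⟶ Z) : (f ≫ i.hom) ≫ i.inv ≫ g = f ≫ g := by
  simp

/-- The canonical leg at a section. -/
lemma isProdLeg_section {A K : B} {u : K ⟶ A} {P : p.Fiber K ⥤ p.Fiber A}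
    (adj : reindex p u ⊣ P) {g : A ⟶ K} (h : g ≫ u = 𝟙 A) (b : p.Fiber K) :
    IsProdLeg p g (cartLift p u (P.obj b)) (adj.counit.app b).1 (𝟙 (P.obj b).1) (cartLift p g b)
      ((reindexSection p h).inv.app (P.obj b) ≫ (reindex p g).map (adj.counit.app b)).1 where
  cart := inferInstance
  vert := ((reindexSection p h).inv.app (P.obj b) ≫ (reindex p g).map (adj.counit.app b)).2
  fac := by
    refine ⟨((reindexSection p h).inv.app (P.obj b)).1 ≫ cartLift p g (reindexObj p u (P.obj b)),
      IsHomLift.of_comp_eq (Category.id_comp _) _ _ ((reindexSection p h).inv.app (P.obj b)).2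
        (cartLift_isCartesian p g _).toIsHomLift, ?_, ?_⟩
    · exact (Category.assoc _ _ _).trans (reindexSection_inv_cartLift h (P.obj b))
    · refine (Category.assoc _ _ _).trans (Eq.trans ?_ (Category.assoc _ _ _).symm)
      exact congrArg (((reindexSection p h).inv.app (P.obj b)).1 ≫ ·)
        (reindex_map_cartLift p g (adj.counit.app b)).symm

/-- When `κ'` is an identity, an index `g` of a leg is a section of `u`, and up to isomorphism the
leg is the canonical map `∏_u b ≅ g^* u^* ∏_u b ⟶ g^* b` of the definition of splitting. -/
lemma isProdSplitting_iff_prodOrthAt (hP : HasFibredProducts p F) {A : B} (a : p.Fiber A) :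
    IsProdSplitting hP a ↔ ∀ ⦃K : B⦄ (u : K ⟶ A) (hu : F u) (b : p.Fiber K),
      ProdOrthAt p A (L := K) (cartLift p u ((prod hP u hu).obj b))
        ((prodAdj hP u hu).counit.app b).1 (𝟙 ((prod hP u hu).obj b).1) a.1 := by
  refine forall₄_congr fun K u hu b => ?_
  have hcart : p.IsStronglyCartesian u (cartLift p u ((prod hP u hu).obj b)) := inferInstance
  have hid : p.IsHomLift (𝟙 A) (𝟙 ((prod hP u hu).obj b).1) :=
    IsHomLift.id ((prod hP u hu).obj b).2
  have hleg {g : A ⟶ K} (h : g ≫ u = 𝟙 A) := isProdLeg_section (prodAdj hP u hu) h b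
  constructor
  · intro H
    have mk {g : A ⟶ K} {b₁ : E} {l : b₁ ⟶ b.1} {θ : ((prod hP u hu).obj b).1 ⟶ b₁}
        (h : IsProdLeg p g (cartLift p u ((prod hP u hu).obj b)) ((prodAdj hP u hu).counit.app b).1
          (𝟙 _) l θ) : ∃ (hg : g ≫ u = 𝟙 A) (i : b₁ ≅ (reindexObj p g b).1),
            p.IsHomLift (𝟙 A) i.hom ∧ θ ≫ i.hom = ((reindexSection p hg).inv.app _ ≫
              (reindex p g).map ((prodAdj hP u hu).counit.app b)).1 := by
      have hg := h.comp_eq hcart.toIsHomLift hid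
      obtain ⟨i, hi, -, hi'⟩ := h.exists_iso hcart (hleg hg)
      exact ⟨hg, i, hi, hi'⟩
    refine ⟨fun h hh => ?_, fun {g₁ g₂ b₁ b₂ l₁ l₂ θ₁ θ₂} h₁ h₂ s₁ s₂ hs₁ hs₂ e => ?_,
      fun {g b₁ l θ} h₁ s₁ s₂ hs₁ hs₂ e => ?_⟩
    · obtain ⟨⟨⟨g, hg⟩, s⟩, hs, -⟩ := H (⟨h, hh⟩ : (prod hP u hu).obj b ⟶ a)
      refine ⟨g, _, _, _, s.1, hleg hg, s.2, ?_⟩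
      exact (Category.assoc _ _ _).trans (congrArg Subtype.val hs).symm
    · obtain ⟨hg₁, i₁, hi₁, e₁⟩ := mk h₁
      obtain ⟨hg₂, i₂, hi₂, e₂⟩ := mk h₂
      have := h₁.vert
      let t₁ : (reindex p g₁).obj b ⟶ a := ⟨i₁.inv ≫ s₁, IsHomLift.of_comp_eq (Category.id_comp _) _ _
        (IsHomLift.inv_vertical i₁ hi₁) hs₁⟩
      let t₂ : (reindex p g₂).obj b ⟶ a := ⟨i₂.inv ≫ s₂, IsHomLift.of_comp_eq (Category.id_comp _) _ _
        (IsHomLift.inv_vertical i₂ hi₂) hs₂⟩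
      let h : (prod hP u hu).obj b ⟶ a := ⟨θ₁ ≫ s₁, inferInstance⟩
      have q₁ : h = (reindexSection p hg₁).inv.app _ ≫
          (reindex p g₁).map ((prodAdj hP u hu).counit.app b) ≫ t₁ := by
        refine Subtype.ext (Eq.trans ?_ (Category.assoc _ _ _))
        refine Eq.trans ?_ (congrArg (· ≫ t₁.1) e₁)
        exact (comp_hom_inv_comp _ _ _).symm
      have q₂ : h = (reindexSection p hg₂).inv.app _ ≫
          (reindex p g₂).map ((prodAdj hP u hu).counit.app b) ≫ t₂ := by
        refine Subtype.ext (Eq.trans ?_ (Category.assoc _ _ _))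
        refine Eq.trans ?_ (congrArg (· ≫ t₂.1) e₂)
        exact e.trans (comp_hom_inv_comp _ _ _).symm
      have := (H h).unique (y₁ := ⟨⟨g₁, hg₁⟩, t₁⟩) (y₂ := ⟨⟨g₂, hg₂⟩, t₂⟩) q₁ q₂
      exact congrArg (fun s => s.1.1) this
    · obtain ⟨hg, i, hi, e₁⟩ := mk h₁
      have := h₁.vert
      let t (s : b₁ ⟶ a.1) (hs : p.IsHomLift (𝟙 A) s) : (reindex p g).obj b ⟶ a :=
        ⟨i.inv ≫ s, IsHomLift.of_comp_eq (Category.id_comp _) _ _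
        (IsHomLift.inv_vertical i hi) hs⟩
      let h : (prod hP u hu).obj b ⟶ a := ⟨θ ≫ s₁, inferInstance⟩
      have q (s : b₁ ⟶ a.1) (hs : p.IsHomLift (𝟙 A) s) (e' : θ ≫ s₁ = θ ≫ s) :
          h = (reindexSection p hg).inv.app _ ≫
            (reindex p g).map ((prodAdj hP u hu).counit.app b) ≫ t s hs := by
        refine Subtype.ext (Eq.trans ?_ (Category.assoc _ _ _))
        refine Eq.trans ?_ (congrArg (· ≫ (t s hs).1) e₁)
        exact e'.trans (comp_hom_inv_comp _ _ _).symm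
      have := (H h).unique (y₁ := ⟨⟨g, hg⟩, t s₁ hs₁⟩) (y₂ := ⟨⟨g, hg⟩, t s₂ hs₂⟩)
        (q s₁ hs₁ rfl) (q s₂ hs₂ e)
      have e₂ : t s₁ hs₁ = t s₂ hs₂ := eq_of_heq (Sigma.mk.inj this).2
      exact (cancel_epi i.inv).1 (congrArg Subtype.val e₂)
  · intro H h
    obtain ⟨g, b', l, θ, s, h₁, hs, e⟩ := H.exists_fac h.1 h.2
    have hg := h₁.comp_eq hcart.toIsHomLift hid
    obtain ⟨i, hi, -, hi'⟩ := h₁.exists_iso hcart (hleg hg)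
    have hii := IsHomLift.inv_vertical i hi
    refine ⟨⟨⟨g, hg⟩, ⟨i.inv ≫ s, IsHomLift.of_comp_eq (Category.id_comp _) _ _
        (IsHomLift.inv_vertical i hi) hs⟩⟩, ?_, ?_⟩
    · refine Subtype.ext (Eq.trans ?_ (Category.assoc _ _ _))
      refine Eq.trans ?_ (congrArg (· ≫ i.inv ≫ s) hi')
      exact e.symm.trans (comp_hom_inv_comp _ _ _).symm
    · rintro ⟨⟨g', hg'⟩, s'⟩ hs'
      have e' := (Category.assoc _ _ _).trans (congrArg Subtype.val hs').symm
      obtain rfl := H.unique h₁ (hleg hg') s s'.1 hs s'.2 (e.trans e'.symm)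
      congr 1
      refine Subtype.ext (H.epi (hleg hg) _ _ s'.2 (IsHomLift.of_comp_eq (Category.id_comp _) _ _ hii hs) (e'.trans ?_))
      exact e.symm.trans ((comp_hom_inv_comp _ _ _).symm.trans (congrArg (· ≫ i.inv ≫ s) hi'))

lemma ProdOrth.isProdSplitting [IsDisplayMapClass F] (hP : HasFibredProducts p F) {A : B}
    {a : p.Fiber A} (ha : ProdOrth p F a.1) : IsProdSplitting hP a :=
  (isProdSplitting_iff_prodOrthAt hP a).2 fun _ u hu b => ha hu (hP.isProdCone u hu b) (k := 𝟙 A)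
    (haveI : p.IsHomLift (𝟙 A) (𝟙 ((prod hP u hu).obj b).1) :=
      IsHomLift.id ((prod hP u hu).obj b).2
    .of_isIso p (𝟙 A) _)

/-- Splitting concerns only counit cones over maps into `A`, tested at the identity. Pulling an
arbitrary cone back along `k` makes the testing map an identity, and cones on the same object are
isomorphic. -/
lemma IsProdSplitting.prodOrth [IsDisplayMapClass F] (hP : HasFibredProducts p F) {A : B}
    {a : p.Fiber A} (ha : IsProdSplitting hP a) : ProdOrth p F a.1 := by
  intro L J A' v hv c b e κ ε h k c' κ' hκ'
  by_cases hA : p.obj a.1 = A'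
  · obtain rfl : A = A' := a.2.symm.trans hA
    have := h.cart
    have := h.vert
    have sq := (pb_isPullback hv k).flip
    obtain ⟨b₁, τ, hτ⟩ := exists_isStronglyCartesian p (pbTop hv k) (IsHomLift.codomain_eq p (𝟙 L) ε)
    obtain ⟨e₁, κ₁, hκ₁⟩ := exists_isStronglyCartesian p (pbBase hv k) (IsHomLift.domain_eq p k κ')
    have hb : p.IsHomLift (pbTop hv k ≫ v) (κ₁ ≫ κ') := by
      rw [pb_w]
      infer_instance
    obtain ⟨n, ⟨hn, hn'⟩, -⟩ := Functor.IsStronglyCartesian.universal_property p v κ (pbTop hv k) _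
      rfl (κ₁ ≫ κ')
    obtain ⟨ε₁, ⟨hε₁, hε₁'⟩, -⟩ := Functor.IsStronglyCartesian.universal_property p (pbTop hv k) τ
      (𝟙 _) _ (Category.id_comp _).symm (n ≫ ε)
    refine ProdOrthAt.of_base_change sq h hκ' hκ₁ hτ hn hn' hε₁ hε₁' ?_
    have hc := h.base_change sq hκ' hκ₁ hτ hn hn' hε₁ hε₁'
    let b₀ : p.Fiber (pb hv k) := ⟨b₁, IsHomLift.domain_eq p (pbTop hv k) τ⟩
    have hid : p.IsHomLift (𝟙 A) (𝟙 c') := IsHomLift.id (IsHomLift.domain_eq p k κ')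
    have hid' : p.IsHomLift (𝟙 A) (𝟙 ((prod hP _ (pbBase_mem hv k)).obj b₀).1) :=
      IsHomLift.id ((prod hP _ (pbBase_mem hv k)).obj b₀).2
    exact ((isProdSplitting_iff_prodOrthAt hP a).1 ha _ (pbBase_mem hv k) b₀).of_cone_iso
      (hP.isProdCone _ _ b₀) hc (.of_isIso p (𝟙 A) _) (.of_isIso p (𝟙 A) _)
  · exact ⟨fun f hf => (hA (IsHomLift.codomain_eq p (𝟙 A') f)).elim,
      fun _ _ s _ hs _ _ => (hA (IsHomLift.codomain_eq p (𝟙 A') s)).elim,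
      fun _ s _ hs _ _ => (hA (IsHomLift.codomain_eq p (𝟙 A') s)).elim⟩

lemma isProdSplitting_iff [IsDisplayMapClass F] (hP : HasFibredProducts p F) {A : B}
    {a : p.Fiber A} : IsProdSplitting hP a ↔ ProdOrth p F a.1 :=
  ⟨fun h => h.prodOrth hP, fun h => h.isProdSplitting hP⟩

end ProdSplitting

/-! ### Recognition of `Σ_F`-completions. -/

section SigmaEquivalence

variable {B : Type u₁} [Category.{v₁} B] {E : Type u₂} [Category.{v₂} E] {p : E ⥤ B}
  {F : MorphismProperty B} {D : Type u₃} [Category.{v₃} D] {q : D ⥤ B}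

lemma HasFibredCoproducts.exists_isStronglyCocartesian [p.IsFibered]
    (hC : HasFibredCoproducts p F) {K I : B} (u : K ⟶ I) (hu : F u) {b : E} (hb : p.obj b = K) :
    ∃ (c : E) (η : b ⟶ c), p.IsStronglyCocartesian u η :=
  ⟨_, _, unitMap_isStronglyCocartesian (coprodAdj hC u hu) ⟨b, hb⟩⟩

/-- A fibration `p` is equivalent to the `Σ_F`-completion of a full subfibration of objects
orthogonal to the cocartesian maps over display maps, if these generate `p`. -/
theorem exists_sigma_isOverEquivalence {K : D ⥤ E} (hK : K ⋙ p = q) [K.Full] [K.Faithful]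
    (hC : ∀ {A I : B} (u : A ⟶ I), F u → ∀ {b : E}, p.obj b = A →
      ∃ (c : E) (η : b ⟶ c), p.IsStronglyCocartesian u η)
    (horth : ∀ x, CoprodOrth p F (K.obj x))
    (hgen : ∀ Y : E, ∃ (A : B) (f : A ⟶ p.obj Y) (_ : F f) (x : D) (η : K.obj x ⟶ Y),
      p.IsStronglyCocartesian f η) :
    ∃ S : SigmaCat q F ⥤ E, IsOverEquivalence S (sigmaFib q F) p := by
  have hobj {A : B} (x : q.Fiber A) : p.obj (K.obj x.1) = A :=
    (Functor.congr_obj hK x.1).trans x.2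
  have hl {I J : B} {f : I ⟶ J} {X Y : D} (φ : X ⟶ Y) := isHomLift_map_iff hK (f := f) φ
  choose obj η hη using fun X : SigmaCat q F => hC X.map X.mem (hobj X.fib)
  -- The functor sends `(g, α)` to the codomain of a cocartesian map out of `K α` over `g`; its
  -- action on maps is forced by the universal property.
  have hmap {X Y : SigmaCat q F} (φ : X ⟶ Y) : ∃! m : obj X ⟶ obj Y,
      p.IsHomLift (SigmaHom.base φ) m ∧ η X ≫ m = K.map (SigmaHom.fib φ) ≫ η Y := by
    have h₁ := (hl _).2 (SigmaHom.isHomLift φ)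
    have h₂ : p.IsHomLift (X.map ≫ SigmaHom.base φ) (K.map (SigmaHom.fib φ) ≫ η Y) := by
      rw [SigmaHom.w φ]
      infer_instance
    exact Functor.IsStronglyCocartesian.universal_property p X.map (η X) (SigmaHom.base φ) _ rfl _
  choose map hmap₁ hmap₂ using fun {X Y : SigmaCat q F} (φ : X ⟶ Y) => hmap φ
  have hid (X : SigmaCat q F) : p.IsHomLift (𝟙 X.base) (𝟙 (obj X)) :=
    IsHomLift.id (IsHomLift.codomain_eq p X.map (η X))
  let S : SigmaCat q F ⥤ E :=
    { obj := obj
      map := map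
      map_id := fun X => by
        refine (hmap₂ (𝟙 X) _ ⟨hid X, ?_⟩).symm
        have : K.map (SigmaHom.fib (𝟙 X)) = 𝟙 _ := K.map_id _
        rw [this]
        simp
      map_comp := fun {X Y Z} φ ψ => by
        have h₁ := (hmap₁ φ).1
        have h₂ := (hmap₁ ψ).1
        refine (hmap₂ (φ ≫ ψ) _ ⟨IsHomLift.comp p _ _ _ _, ?_⟩).symm
        have : K.map (SigmaHom.fib (φ ≫ ψ)) = K.map (SigmaHom.fib φ) ≫ K.map (SigmaHom.fib ψ) :=
          K.map_comp _ _
        rw [this, ← Category.assoc, (hmap₁ φ).2, Category.assoc, (hmap₁ ψ).2, Category.assoc] }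
  have hS : S ⋙ p = sigmaFib q F := comp_eq_of_isHomLift fun φ => (hmap₁ φ).1
  refine ⟨S, hS, ⟨fun {X Y} m => ?_⟩, ⟨fun {X Y φ φ'} h => ?_⟩, fun Y => ?_⟩
  · change obj X ⟶ obj Y at m
    obtain ⟨f, hf⟩ := exists_isHomLift p (IsHomLift.codomain_eq p X.map (η X))
      (IsHomLift.codomain_eq p Y.map (η Y)) m
    -- Orthogonality recovers the component in `D` as the lift of `η X ≫ m` through `η Y`; the top
    -- side of the square in `B` is the map under this lift.
    obtain ⟨ψ, hψ, -⟩ := horth X.fib.1 Y.map Y.mem (η Y) (hη Y) (η X ≫ m)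
    obtain ⟨ψ, rfl⟩ := K.map_surjective ψ
    obtain ⟨t, ht⟩ := exists_isHomLift q X.fib.2 Y.fib.2 ψ
    have ht' := (hl ψ).2 ht
    have hw : X.map ≫ f = t ≫ Y.map := isHomLift_unique p (η X ≫ m) inferInstance
      (hψ ▸ inferInstance)
    exact ⟨⟨f, t, hw, ψ, ht⟩, (hmap₂ (X := X) (Y := Y) ⟨f, t, hw, ψ, ht⟩ m ⟨hf, hψ.symm⟩).symm⟩
  · change map φ = map φ' at h
    have h₁ : SigmaHom.base φ = SigmaHom.base φ' :=
      isHomLift_unique p (map φ) (hmap₁ φ).1 (h ▸ (hmap₁ φ').1)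
    have h₂ : SigmaHom.fib φ = SigmaHom.fib φ' := by
      refine K.map_injective ((horth X.fib.1 Y.map Y.mem (η Y) (hη Y) (η X ≫ map φ)).unique
        (hmap₁ φ).2.symm ?_)
      rw [h]
      exact (hmap₁ φ').2.symm
    have h₃ : SigmaHom.top φ = SigmaHom.top φ' :=
      isHomLift_unique q (SigmaHom.fib φ) (SigmaHom.isHomLift φ) (h₂ ▸ SigmaHom.isHomLift φ')
    exact SigmaHom.ext h₁ h₃ h₂
  · obtain ⟨A, f, hf, x, ε, hε⟩ := hgen Y
    let X : SigmaCat q F := ⟨f, hf, ⟨x, (Functor.congr_obj hK x).symm.trans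
      (IsHomLift.domain_eq p f ε)⟩⟩
    obtain ⟨i, hi, -⟩ := exists_vertical_iso_of_isStronglyCocartesian (η X) ε (hη X) hε
    exact ⟨X, i, hi⟩

/-- A functor over `B` preserving cartesian maps. -/
structure IsCartesianFunctor (K : D ⥤ E) (q : D ⥤ B) (p : E ⥤ B) : Prop where
  comp : K ⋙ p = q
  map_cart : ∀ {I J : B} {f : I ⟶ J} {X Y : D} (φ : X ⟶ Y), q.IsStronglyCartesian f φ →
    p.IsStronglyCartesian f (K.map φ)

lemma IsCartesianFunctor.isHomLift (hK : IsCartesianFunctor K q p) {I J : B} {f : I ⟶ J} {X Y : D}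
    (φ : X ⟶ Y) (h : q.IsHomLift f φ) : p.IsHomLift f (K.map φ) :=
  (isHomLift_map_iff hK.comp φ).2 h

end SigmaEquivalence

/-! ### Recognition of `Π_F`-completions. -/

section PiEquivalence

variable {B : Type u₁} [Category.{v₁} B] {E : Type u₂} [Category.{v₂} E] {p : E ⥤ B}
  {F : MorphismProperty B} [IsDisplayMapClass F] {D : Type u₃} [Category.{v₃} D] {q : D ⥤ B}
  [q.IsFibered]

namespace PiHom

variable {X Y Z W : PiCat q F} {K : D ⥤ E}

/-- The action of a map of `Π_F(q)` on maps into the image of `X.fib` under a cartesian functor: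
`ψ` is the image of `α`. -/
def Acts (p : E ⥤ B) (K : D ⥤ E) (f : PiHom X Y) {T : B} (s : T ⟶ Y.dom) (t : T ⟶ X.base)
    (w : s ≫ Y.map = t ≫ f.base) {c : E} (α : c ⟶ K.obj X.fib.1) (ψ : c ⟶ K.obj Y.fib.1) : Prop :=
  ∃ β : c ⟶ K.obj (reindexObj q f.idx X.fib).1, p.IsHomLift (pbLift Y.mem f.base s t w) β ∧
    β ≫ K.map (cartLift q f.idx X.fib) = α ∧ β ≫ K.map (total f.fib) = ψ

lemma Acts.isHomLift (hK : IsCartesianFunctor K q p) {f : PiHom X Y} {T : B} {s : T ⟶ Y.dom}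
    {t : T ⟶ X.base} {w : s ≫ Y.map = t ≫ f.base} {c : E} {α : c ⟶ K.obj X.fib.1}
    {ψ : c ⟶ K.obj Y.fib.1} (h : f.Acts p K s t w α ψ) : p.IsHomLift s ψ := by
  obtain ⟨β, hβ, -, rfl⟩ := h
  exact IsHomLift.of_comp_eq (pbLift_top _ _ _ _ _) _ _ hβ (hK.isHomLift _ (total_isHomLift q _))

lemma Acts.exists (hK : IsCartesianFunctor K q p) (f : PiHom X Y) {T : B} (s : T ⟶ Y.dom)
    (t : T ⟶ X.base) (w : s ≫ Y.map = t ≫ f.base) {c : E} (α : c ⟶ K.obj X.fib.1)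
    (hα : p.IsHomLift (f.idxAt s t w) α) : ∃ ψ, f.Acts p K s t w α ψ := by
  have := hK.map_cart _ (cartLift_isStronglyCartesian f.idx X.fib)
  obtain ⟨β, ⟨h₁, h₂⟩, -⟩ := Functor.IsStronglyCartesian.universal_property p f.idx
    (K.map (cartLift q f.idx X.fib)) (pbLift Y.mem f.base s t w) (f.idxAt s t w) rfl α
  exact ⟨_, β, h₁, h₂, rfl⟩

lemma Acts.unique (hK : IsCartesianFunctor K q p) {f : PiHom X Y} {T : B} {s : T ⟶ Y.dom}
    {t : T ⟶ X.base} {w : s ≫ Y.map = t ≫ f.base} {c : E} {α : c ⟶ K.obj X.fib.1}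
    {ψ ψ' : c ⟶ K.obj Y.fib.1} (h : f.Acts p K s t w α ψ) (h' : f.Acts p K s t w α ψ') : ψ = ψ' := by
  obtain ⟨β, hβ, h₁, rfl⟩ := h
  obtain ⟨β', hβ', h₁', rfl⟩ := h'
  have := hK.map_cart _ (cartLift_isStronglyCartesian f.idx X.fib)
  rw [Functor.IsStronglyCartesian.ext p f.idx (K.map (cartLift q f.idx X.fib))
    (pbLift Y.mem f.base s t w) (h₁.trans h₁'.symm)]

lemma Acts.natural {f : PiHom X Y} {T T' : B} (k : T' ⟶ T) {s : T ⟶ Y.dom}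
    {t : T ⟶ X.base} {w : s ≫ Y.map = t ≫ f.base} {c c' : E} {α : c ⟶ K.obj X.fib.1}
    {ψ : c ⟶ K.obj Y.fib.1} (h : f.Acts p K s t w α ψ) (γ : c' ⟶ c) (hγ : p.IsHomLift k γ)
    {s' : T' ⟶ Y.dom} {t' : T' ⟶ X.base} (hs : s' = k ≫ s) (ht : t' = k ≫ t)
    (w' : s' ≫ Y.map = t' ≫ f.base) : f.Acts p K s' t' w' (γ ≫ α) (γ ≫ ψ) := by
  subst hs ht
  have : pbLift Y.mem f.base (k ≫ s) (k ≫ t) w' = k ≫ pbLift Y.mem f.base s t w :=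
    pb_hom_ext (by simp) (by simp)
  obtain ⟨β, hβ, rfl, rfl⟩ := h
  exact ⟨γ ≫ β, this ▸ inferInstance, Category.assoc _ _ _, Category.assoc _ _ _⟩

/-- Relates the action on arbitrary maps into `K.obj X.fib` to `actAt`, by which composition in
`Π_F(q)` is defined. -/
lemma Acts.comp_map {f : PiHom X Y} {T : B} {s : T ⟶ Y.dom} {t : T ⟶ X.base}
    {w : s ≫ Y.map = t ≫ f.base} {a : D} {α : a ⟶ X.fib.1} (hα : q.IsHomLift (f.idxAt s t w) α)
    (hK : IsCartesianFunctor K q p) : f.Acts p K s t w (K.map α) (K.map (f.actAt s t w α hα)) := by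
  obtain ⟨β, h₁, h₂, h₃⟩ := f.exists_actAt s t w α hα
  exact ⟨K.map β, hK.isHomLift _ h₁, by rw [← K.map_comp, h₂], by rw [← K.map_comp, h₃]⟩

lemma Acts.id (hK : IsCartesianFunctor K q p) {T : B} (s : T ⟶ X.dom)
    (t : T ⟶ X.base) (w : s ≫ X.map = t ≫ 𝟙 X.base) {c : E} (α : c ⟶ K.obj X.fib.1)
    (hα : p.IsHomLift s α) : (PiHom.id X).Acts p K s t w α α := by
  have hα' : p.IsHomLift ((PiHom.id X).idxAt s t w) α := (id_idxAt s t w).symm ▸ hα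
  obtain ⟨ψ, β, hβ, h₁, h₂⟩ := Acts.exists hK (PiHom.id X) s t w α hα'
  have : total (PiHom.id X).fib = cartLift q (PiHom.id X).idx X.fib := Category.id_comp _
  exact ⟨β, hβ, h₁, by rw [← h₁]; exact congrArg (fun x => β ≫ K.map x) this⟩

lemma Acts.comp (hK : IsCartesianFunctor K q p) {f : PiHom X Y} {g : PiHom Y Z} {T : B}
    {s : T ⟶ Z.dom} {t : T ⟶ X.base} {w : s ≫ Z.map = t ≫ f.base ≫ g.base} {c : E}
    {α : c ⟶ K.obj X.fib.1} {ψ : c ⟶ K.obj Y.fib.1} {χ : c ⟶ K.obj Z.fib.1}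
    (h₁ : f.Acts p K (g.idxAt s (t ≫ f.base) (comp_w f g w)) t (idxAt_map _ _ _ _) α ψ)
    (h₂ : g.Acts p K s (t ≫ f.base) (comp_w f g w) ψ χ) :
    (PiHom.comp f g).Acts p K s t w α χ := by
  have hα : p.IsHomLift ((PiHom.comp f g).idxAt s t w) α := by
    rw [comp_idxAt]
    obtain ⟨β, hβ, rfl, -⟩ := h₁
    exact IsHomLift.of_comp_eq rfl _ _ hβ (hK.isHomLift _ inferInstance)
  let r := (PiHom.comp f g).idx
  have hr : f.idxAt (g.idxAt (pbTop _ _) (pbBase _ _ ≫ f.base) (comp_w f g (pb_w _ _)))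
    (pbBase _ _) (idxAt_map _ _ _ _) = r := rfl
  have hc := hK.map_cart _ (cartLift_isStronglyCartesian r X.fib)
  obtain ⟨ψ', β, hβ, rfl, e⟩ := Acts.exists hK (PiHom.comp f g) s t w α hα
  have hs : s = pbLift Z.mem (f.base ≫ g.base) s t w ≫ pbTop _ _ := (pbLift_top _ _ _ _ _).symm
  have ht : t = pbLift Z.mem (f.base ≫ g.base) s t w ≫ pbBase _ _ := (pbLift_base _ _ _ _ _).symm
  have ht' : t ≫ f.base = pbLift Z.mem (f.base ≫ g.base) s t w ≫ pbBase _ _ ≫ f.base := by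
    rw [← Category.assoc, ← ht]
  have hr' : q.IsHomLift (f.idxAt (g.idxAt (pbTop Z.mem (f.base ≫ g.base))
      (pbBase Z.mem (f.base ≫ g.base) ≫ f.base) (comp_w f g (pb_w _ _)))
      (pbBase Z.mem (f.base ≫ g.base)) (idxAt_map _ _ _ _)) (cartLift q r X.fib) :=
    (cartLift_isCartesian q r X.fib).toIsHomLift
  -- The vertical part of a composite is defined by acting on the cartesian lifting of its index.
  -- The argument `α` factors through the image of that lifting by `β`, so naturality in `β` gives
  -- the general case.
  have a₁ := Acts.comp_map hr' hK
  have a₂ := Acts.comp_map (f := g) (s := pbTop Z.mem (f.base ≫ g.base))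
    (t := pbBase Z.mem (f.base ≫ g.base) ≫ f.base)
    (w := comp_w f g (pb_w _ _)) (actAt_isHomLift f _ _ _ (cartLift q r X.fib) hr') hK
  have b₁ := (a₁.natural _ β hβ (g.idxAt_natural _ _ _ _ hs ht' (comp_w f g w)) ht
    (idxAt_map _ _ _ _)).unique hK h₁
  have b₂ := a₂.natural _ β hβ hs ht' (comp_w f g w)
  rw [b₁] at b₂
  have b₃ := b₂.unique hK h₂
  refine ⟨β, hβ, rfl, ?_⟩
  rw [← b₃]
  exact congrArg (fun x => β ≫ K.map x) (total_vertLift q _ _ _)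

end PiHom

/-- The value at `s` of a map `ρ : d ⟶ c` into the apex of a cone. -/
def IsEval (p : E ⥤ B) {T L : B} (s : T ⟶ L) {c b e d : E} (κ : e ⟶ c) (ε : e ⟶ b) (ρ : d ⟶ c)
    (ψ : d ⟶ b) : Prop :=
  ∃ n : d ⟶ e, p.IsHomLift s n ∧ n ≫ κ = ρ ∧ n ≫ ε = ψ

namespace IsEval

variable {T L J : B} {v : L ⟶ J} {s : T ⟶ L} {c b e d : E} {κ : e ⟶ c} {ε : e ⟶ b} {ρ : d ⟶ c}
  {ψ ψ' : d ⟶ b}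

lemma isHomLift (h : IsEval p s κ ε ρ ψ) (hε : p.IsHomLift (𝟙 L) ε) : p.IsHomLift s ψ := by
  obtain ⟨n, hn, -, rfl⟩ := h
  infer_instance

lemma unique (hκ : p.IsStronglyCartesian v κ) (h : IsEval p s κ ε ρ ψ)
    (h' : IsEval p s κ ε ρ ψ') : ψ = ψ' := by
  obtain ⟨n, hn, h₁, rfl⟩ := h
  obtain ⟨n', hn', h₂, rfl⟩ := h'
  rw [Functor.IsStronglyCartesian.ext p v κ s (h₁.trans h₂.symm)]

lemma exists_eval (hκ : p.IsStronglyCartesian v κ) {w : T ⟶ J} (hw : w = s ≫ v) (ε : e ⟶ b)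
    (hρ : p.IsHomLift w ρ) : ∃ ψ, IsEval p s κ ε ρ ψ := by
  obtain ⟨n, ⟨h₁, h₂⟩, -⟩ := Functor.IsStronglyCartesian.universal_property p v κ s w hw ρ
  exact ⟨_, n, h₁, h₂, rfl⟩

lemma natural (h : IsEval p s κ ε ρ ψ) {T' : B} {k : T' ⟶ T} {s' : T' ⟶ L} (hs : k ≫ s = s')
    {d' : E} {γ : d' ⟶ d} (hγ : p.IsHomLift k γ) : IsEval p s' κ ε (γ ≫ ρ) (γ ≫ ψ) := by
  obtain ⟨n, hn, rfl, rfl⟩ := h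
  exact ⟨γ ≫ n, IsHomLift.of_comp_eq hs _ _ hγ hn, Category.assoc _ _ _, Category.assoc _ _ _⟩

end IsEval

namespace PiHom

variable {X Y Z : PiCat q F} {K : D ⥤ E} {cX eX cY eY cZ eZ : E} {κX : eX ⟶ cX}
  {εX : eX ⟶ K.obj X.fib.1} {κY : eY ⟶ cY} {εY : eY ⟶ K.obj Y.fib.1} {κZ : eZ ⟶ cZ}
  {εZ : eZ ⟶ K.obj Z.fib.1}

/-- `m` is the map between products induced by the map `f` of `Π_F(q)`. -/
def Induces (p : E ⥤ B) (κX : eX ⟶ cX) (εX : eX ⟶ K.obj X.fib.1) (κY : eY ⟶ cY)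
    (εY : eY ⟶ K.obj Y.fib.1) (f : PiHom X Y) (m : cX ⟶ cY) : Prop :=
  p.IsHomLift f.base m ∧ ∀ {T : B} (s : T ⟶ Y.dom) (t : T ⟶ X.base) (w : s ≫ Y.map = t ≫ f.base)
    {d : E} (τ : d ⟶ cX), p.IsHomLift t τ → ∀ α ψ, IsEval p (f.idxAt s t w) κX εX τ α →
      f.Acts p K s t w α ψ → IsEval p s κY εY (τ ≫ m) ψ

/-- One generic stage suffices: every other stage factors through the chosen pullback and every `τ'`
through the cartesian `τ`, and both evaluation and action are natural. -/
lemma Induces.of_isEval (hK : IsCartesianFunctor K q p) (hX : IsProdCone p X.map κX εX)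
    {f : PiHom X Y} {m : cX ⟶ cY} (hm : p.IsHomLift f.base m) {d : E} {τ : d ⟶ cX}
    (hτ : p.IsStronglyCartesian (pbBase Y.mem f.base) τ) {α : d ⟶ K.obj X.fib.1}
    {ψ : d ⟶ K.obj Y.fib.1} (hα : IsEval p f.idx κX εX τ α)
    (hψ : f.Acts p K (pbTop Y.mem f.base) (pbBase Y.mem f.base) (pb_w _ _) α ψ)
    (h : IsEval p (pbTop Y.mem f.base) κY εY (τ ≫ m) ψ) : f.Induces p κX εX κY εY m := by
  refine ⟨hm, fun {T} s t w {d'} τ' hτ' α' ψ' hα' hψ' => ?_⟩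
  obtain ⟨γ, ⟨hγ, rfl⟩, -⟩ := Functor.IsStronglyCartesian.universal_property p
    (pbBase Y.mem f.base) τ (pbLift Y.mem f.base s t w) t (pbLift_base _ _ _ _ _).symm τ'
  obtain rfl := hα'.unique hX.cart (hα.natural rfl hγ)
  obtain rfl := hψ'.unique hK (hψ.natural _ γ hγ (pbLift_top _ _ _ _ _).symm
    (pbLift_base _ _ _ _ _).symm w)
  rw [Category.assoc]
  exact h.natural (pbLift_top _ _ _ _ _) hγ

/-- At the generic stage, evaluate `τ` at `f.idx` and act by `f`. The result is a map to `K.obj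
Y.fib` over the pullback of `Y.map`, that is, a map into the product. -/
lemma existsUnique_induces [p.IsFibered] (hK : IsCartesianFunctor K q p)
    (hX : IsProdCone p X.map κX εX) (hY : IsProdCone p Y.map κY εY) (f : PiHom X Y) :
    ∃! m, f.Induces p κX εX κY εY m := by
  have := hX.cart
  obtain ⟨d, τ, hτ⟩ := exists_isStronglyCartesian p (pbBase Y.mem f.base)
    (IsHomLift.codomain_eq p X.map κX)
  obtain ⟨α, hα⟩ := IsEval.exists_eval hX.cart f.w.symm εX hτ.toIsHomLift
  have hα' : IsEval p (f.idxAt (pbTop Y.mem f.base) (pbBase Y.mem f.base) (pb_w _ _)) κX εX τ α :=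
    (idxAt_self f).symm ▸ hα
  obtain ⟨ψ, hψ⟩ := Acts.exists hK f (pbTop Y.mem f.base) (pbBase Y.mem f.base) (pb_w _ _) α
    (hα'.isHomLift hX.vert)
  obtain ⟨m, ⟨hm, hm'⟩, hu⟩ := hY.existsUnique (pb_isPullback Y.mem f.base).flip τ hτ ψ
    (hψ.isHomLift hK)
  exact ⟨m, .of_isEval hK hX hm hτ hα hψ hm', fun m' h =>
    hu m' ⟨h.1, h.2 _ _ _ τ hτ.toIsHomLift α ψ hα' hψ⟩⟩

lemma Induces.id (hK : IsCartesianFunctor K q p) (hX : IsProdCone p X.map κX εX) :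
    (PiHom.id X).Induces p κX εX κX εX (𝟙 cX) := by
  have := hX.cart
  refine ⟨IsHomLift.id (IsHomLift.codomain_eq p X.map κX), fun s t w d τ hτ α ψ hα hψ => ?_⟩
  replace hα : IsEval p s κX εX τ α := (id_idxAt s t w) ▸ hα
  rw [hψ.unique hK (Acts.id hK s t w α (hα.isHomLift hX.vert)), Category.comp_id]
  exact hα

lemma Induces.comp (hK : IsCartesianFunctor K q p) (hX : IsProdCone p X.map κX εX)
    (hY : IsProdCone p Y.map κY εY) {f : PiHom X Y} {g : PiHom Y Z} {m : cX ⟶ cY} {m' : cY ⟶ cZ}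
    (h : f.Induces p κX εX κY εY m) (h' : g.Induces p κY εY κZ εZ m') :
    (PiHom.comp f g).Induces p κX εX κZ εZ (m ≫ m') := by
  have := h.1
  have := h'.1
  refine ⟨IsHomLift.comp p f.base g.base m m', fun s t w d τ hτ α ψ hα hψ => ?_⟩
  replace hα : IsEval p (f.idxAt (g.idxAt s (t ≫ f.base) (comp_w f g w)) t
    (idxAt_map _ _ _ _)) κX εX τ α := (comp_idxAt f g s t w) ▸ hα
  obtain ⟨ψ₁, hψ₁⟩ := Acts.exists hK f _ _ _ α (hα.isHomLift hX.vert)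
  have h₁ := h.2 _ _ _ τ hτ α ψ₁ hα hψ₁
  obtain ⟨ψ₂, hψ₂⟩ := Acts.exists hK g s (t ≫ f.base) (comp_w f g w) ψ₁ (h₁.isHomLift hY.vert)
  rw [hψ.unique hK (Acts.comp hK hψ₁ hψ₂), ← Category.assoc]
  exact h'.2 _ _ _ _ inferInstance _ _ h₁ hψ₂

/-- If `f` induces `m`, then the vertical part `k` of the evaluation of `τ ≫ m` factors through the
leg at `f.idx`, with `f.fib` as second factor. This is the kind of factorisation about which
`ProdOrth` speaks. -/
lemma Induces.exists_leg (hK : IsCartesianFunctor K q p) (hX : IsProdCone p X.map κX εX)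
    (hY : IsProdCone p Y.map κY εY) {f : PiHom X Y} {m : cX ⟶ cY}
    (h : f.Induces p κX εX κY εY m) {d : E} {τ : d ⟶ cX}
    (hτ : p.IsStronglyCartesian (pbBase Y.mem f.base) τ)
    {k : d ⟶ K.obj (reindexObj q (pbTop Y.mem f.base) Y.fib).1} (hk : p.IsHomLift (𝟙 (pb Y.mem f.base)) k)
    (hk' : IsEval p (pbTop Y.mem f.base) κY εY (τ ≫ m)
      (k ≫ K.map (cartLift q (pbTop Y.mem f.base) Y.fib))) :
    ∃ θ, IsProdLeg p f.idx κX εX τ (K.map (cartLift q f.idx X.fib)) θ ∧ θ ≫ K.map f.fib.1 = k := by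
  obtain ⟨θ, hθ⟩ := IsProdLeg.exists f.w hX.cart hX.vert hτ.toIsHomLift
    (hK.map_cart _ (cartLift_isStronglyCartesian f.idx X.fib))
  refine ⟨θ, hθ, ?_⟩
  obtain ⟨n, hn, h₁, h₂⟩ := hθ.fac
  have hα : IsEval p (f.idxAt (pbTop Y.mem f.base) (pbBase Y.mem f.base) (pb_w _ _)) κX εX τ
      (n ≫ εX) := ⟨n, (idxAt_self f).symm ▸ hn, h₁, rfl⟩
  have e : pbLift Y.mem f.base (pbTop Y.mem f.base) (pbBase Y.mem f.base) (pb_w _ _) = 𝟙 _ :=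
    pb_hom_ext (by simp) (by simp)
  have hψ : f.Acts p K (pbTop Y.mem f.base) (pbBase Y.mem f.base) (pb_w _ _) (n ≫ εX)
      (θ ≫ K.map (total f.fib)) := ⟨θ, e.symm ▸ hθ.vert, h₂.symm, rfl⟩
  have h₃ := (h.2 _ _ _ τ hτ.toIsHomLift _ _ hα hψ).unique hY.cart hk'
  have := hK.map_cart _ (cartLift_isStronglyCartesian (pbTop Y.mem f.base) Y.fib)
  have := hθ.vert
  have := hK.isHomLift f.fib.1 f.fib.2
  refine Functor.IsStronglyCartesian.ext p (pbTop Y.mem f.base)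
    (K.map (cartLift q (pbTop Y.mem f.base) Y.fib)) (𝟙 (pb Y.mem f.base)) ?_
  rw [← h₃, Category.assoc, ← K.map_comp]
  rfl

/-- Fullness. A map into the product of `Y` is a vertical map `k` out of the pulled back product of
`X`, into an object of the image of `K`. Orthogonality factors `k` through a leg at some `i`; the
index and the remaining vertical map form a map of `Π_F(q)`. -/
lemma exists_induces [p.IsFibered] [K.Full] (hK : IsCartesianFunctor K q p)
    (hX : IsProdCone p X.map κX εX) (hY : IsProdCone p Y.map κY εY)
    (horth : ∀ x, ProdOrth p F (K.obj x)) {f : X.base ⟶ Y.base} {m : cX ⟶ cY}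
    (hm : p.IsHomLift f m) : ∃ φ : PiHom X Y, φ.Induces p κX εX κY εY m := by
  have := hX.cart
  obtain ⟨d, τ, hτ⟩ := exists_isStronglyCartesian p (pbBase Y.mem f)
    (IsHomLift.codomain_eq p X.map κX)
  obtain ⟨ψ, hψ⟩ := IsEval.exists_eval (ρ := τ ≫ m) hY.cart (pb_w Y.mem f).symm εY inferInstance
  have hψ' : p.IsHomLift (pbTop Y.mem f) ψ := hψ.isHomLift hY.vert
  have := hK.map_cart _ (cartLift_isStronglyCartesian (pbTop Y.mem f) Y.fib)
  obtain ⟨k, ⟨hk, rfl⟩, -⟩ := Functor.IsStronglyCartesian.universal_property p (pbTop Y.mem f)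
    (K.map (cartLift q (pbTop Y.mem f) Y.fib)) (𝟙 _) _ (Category.id_comp _).symm ψ
  obtain ⟨i, b', l, θ', s', hleg, hs', e⟩ :=
    (horth (reindexObj q (pbTop Y.mem f) Y.fib).1 X.mem hX hτ).exists_fac k hk
  have hi := hleg.comp_eq hX.cart.toIsHomLift hτ.toIsHomLift
  -- The leg is replaced by the isomorphic one through the image of the chosen reindexing along `i`,
  -- so that its remaining factor is a map between values of `K` and has a preimage.
  have hc := hK.map_cart _ (cartLift_isStronglyCartesian i X.fib)
  obtain ⟨θ, hθ⟩ := IsProdLeg.exists hi hX.cart hX.vert hτ.toIsHomLift hc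
  obtain ⟨j, hj, -, hj'⟩ := hθ.exists_iso hX.cart hleg
  obtain ⟨s, hs, hs''⟩ := IsOverEquivalence.exists_preimage (f := 𝟙 (pb Y.mem f)) hK.comp (j.hom ≫ s')
    inferInstance
  obtain ⟨n, hn, h₁, h₂⟩ := hθ.fac
  let φ : PiHom X Y := ⟨f, i, hi, ⟨s, hs⟩⟩
  have e' : pbLift Y.mem f (pbTop Y.mem f) (pbBase Y.mem f) (pb_w _ _) = 𝟙 _ :=
    pb_hom_ext (by simp) (by simp)
  refine ⟨φ, .of_isEval hK hX hm hτ ⟨n, hn, h₁, h₂⟩ ⟨θ, e'.symm ▸ hθ.vert, rfl, ?_⟩ hψ⟩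
  rw [← e, ← hj', Category.assoc, Category.assoc, ← Category.assoc j.hom, ← hs'', ← K.map_comp]
  rfl

/-- Faithfulness. Both maps give a factorisation of the same `k` through a leg; orthogonality makes
the indices equal and the second factors as well. -/
lemma Induces.injective [p.IsFibered] [K.Faithful] (hK : IsCartesianFunctor K q p)
    (hX : IsProdCone p X.map κX εX) (hY : IsProdCone p Y.map κY εY)
    (horth : ∀ x, ProdOrth p F (K.obj x)) {f g : PiHom X Y} {m : cX ⟶ cY}
    (hf : f.Induces p κX εX κY εY m) (hg : g.Induces p κX εX κY εY m) : f = g := by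
  have := hX.cart
  have hb : f.base = g.base := isHomLift_unique p m hf.1 hg.1
  have := hf.1
  obtain ⟨d, τ, hτ⟩ := exists_isStronglyCartesian p (pbBase Y.mem f.base)
    (IsHomLift.codomain_eq p X.map κX)
  obtain ⟨ψ, hψ⟩ := IsEval.exists_eval (ρ := τ ≫ m) hY.cart (pb_w Y.mem f.base).symm εY
    inferInstance
  have hψ' : p.IsHomLift (pbTop Y.mem f.base) ψ := hψ.isHomLift hY.vert
  have := hK.map_cart _ (cartLift_isStronglyCartesian (pbTop Y.mem f.base) Y.fib)
  obtain ⟨k, ⟨hk, rfl⟩, -⟩ := Functor.IsStronglyCartesian.universal_property p (pbTop Y.mem f.base)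
    (K.map (cartLift q (pbTop Y.mem f.base) Y.fib)) (𝟙 _) _ (Category.id_comp _).symm ψ
  have H := horth (reindexObj q (pbTop Y.mem f.base) Y.fib).1 X.mem hX hτ
  obtain ⟨f, i, wi, x⟩ := f
  obtain ⟨g, i', wi', x'⟩ := g
  obtain rfl : f = g := hb
  obtain ⟨θ, hθ, e⟩ := hf.exists_leg hK hX hY hτ hk hψ
  obtain ⟨θ', hθ', e'⟩ := hg.exists_leg hK hX hY hτ hk hψ
  have hx := hK.isHomLift x.1 x.2
  have hx' := hK.isHomLift x'.1 x'.2
  obtain rfl : i = i' := H.unique hθ hθ' _ _ hx hx' (e.trans e'.symm)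
  congr 1
  obtain ⟨j, -, hj, hj'⟩ := hθ.exists_iso hX.cart hθ'
  refine Subtype.ext (K.map_injective (H.epi hθ _ _ hx hx' (e.trans (e'.symm.trans ?_))))
  -- Two legs at the same index with the same cartesian part coincide, since the lift `n` of `τ` is
  -- unique.
  congr 1
  have := hθ.vert
  have := hθ'.vert
  have := hθ.cart
  obtain ⟨n, hn, h₁, h₂⟩ := hθ.fac
  obtain ⟨n', hn', h₁', h₂'⟩ := hθ'.fac
  refine Functor.IsStronglyCartesian.ext p i (K.map (cartLift q i X.fib)) (𝟙 (pb Y.mem f)) ?_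
  refine h₂'.symm.trans (Eq.trans ?_ h₂)
  congr 1
  exact Functor.IsStronglyCartesian.ext p X.map κX i (h₁'.trans h₁.symm)

end PiHom

/-- A fibration `p` is equivalent to the `Π_F`-completion of a full subfibration of objects
orthogonal to the product cones over display maps, if these cogenerate `p`. -/
theorem exists_pi_isOverEquivalence [p.IsFibered] {K : D ⥤ E} (hK : IsCartesianFunctor K q p)
    [K.Full] [K.Faithful]
    (hP : ∀ {A I : B} (v : A ⟶ I), F v → ∀ {b : E}, p.obj b = A →
      ∃ (c e : E) (κ : e ⟶ c) (ε : e ⟶ b), IsProdCone p v κ ε)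
    (horth : ∀ x, ProdOrth p F (K.obj x))
    (hgen : ∀ Y : E, ∃ (A : B) (f : A ⟶ p.obj Y) (_ : F f) (x : D) (e : E) (κ : e ⟶ Y)
      (ε : e ⟶ K.obj x), IsProdCone p f κ ε) :
    ∃ S : PiCat q F ⥤ E, IsOverEquivalence S (piFib q F) p := by
  have hobj {A : B} (x : q.Fiber A) : p.obj (K.obj x.1) = A :=
    (Functor.congr_obj hK.comp x.1).trans x.2
  choose obj top κ ε hX using fun X : PiCat q F => hP X.map X.mem (hobj X.fib)
  choose map hmap₁ hmap₂ using fun {X Y : PiCat q F} (φ : X ⟶ Y) =>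
    PiHom.existsUnique_induces hK (hX X) (hX Y) φ
  let S : PiCat q F ⥤ E :=
    { obj := obj
      map := map
      map_id := fun X => (hmap₂ (𝟙 X) _ (PiHom.Induces.id hK (hX X))).symm
      map_comp := fun {X Y Z} φ ψ => (hmap₂ (φ ≫ ψ) _
        (PiHom.Induces.comp hK (hX X) (hX Y) (hmap₁ φ) (hmap₁ ψ))).symm }
  have hS : S ⋙ p = piFib q F := comp_eq_of_isHomLift fun φ => (hmap₁ φ).1
  refine ⟨S, hS, ⟨fun {X Y} m => ?_⟩, ⟨fun {X Y φ φ'} h => ?_⟩, fun Y => ?_⟩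
  · change obj X ⟶ obj Y at m
    have h₁ := (hX X).cart
    have h₂ := (hX Y).cart
    obtain ⟨f, hf⟩ := exists_isHomLift p (IsHomLift.codomain_eq p X.map (κ X))
      (IsHomLift.codomain_eq p Y.map (κ Y)) m
    obtain ⟨φ, hφ⟩ := PiHom.exists_induces hK (hX X) (hX Y) horth hf
    exact ⟨φ, (hmap₂ (X := X) (Y := Y) φ m hφ).symm⟩
  · change map φ = map φ' at h
    exact (hmap₁ φ).injective hK (hX X) (hX Y) horth (h ▸ hmap₁ φ')
  · obtain ⟨A, f, hf, x, e, κ', ε', hc⟩ := hgen Y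
    have := hc.vert
    let X : PiCat q F := ⟨f, hf, ⟨x, (Functor.congr_obj hK.comp x).symm.trans
      (IsHomLift.codomain_eq p (𝟙 A) ε')⟩⟩
    obtain ⟨i, -, hi, -⟩ := (hX X).exists_iso hc
    exact ⟨X, i, hi⟩

end PiEquivalence

/-! ### A calculus of generalised elements for maps of `Π_F(p)`. -/

section Sends

variable {B : Type u₁} [Category.{v₁} B] {E : Type u₂} [Category.{v₂} E] {p : E ⥤ B}
  [p.IsFibered] {F : MorphismProperty B} [IsDisplayMapClass F]

namespace PiHom

variable {X Y Z : PiCat p F}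

/-- At the stage `s : T ⟶ Y.dom`, the map `φ` of `Π_F(p)` has index `i` and sends `α` to `ψ`. -/
def Sends (φ : PiHom X Y) {T : B} (s : T ⟶ Y.dom) (i : T ⟶ X.dom) {c : E} (α : c ⟶ X.fib.1)
    (ψ : c ⟶ Y.fib.1) : Prop :=
  ∃ (w : s ≫ Y.map = (i ≫ X.map) ≫ φ.base) (_ : φ.idxAt s (i ≫ X.map) w = i)
    (hα : p.IsHomLift (φ.idxAt s (i ≫ X.map) w) α), φ.actAt s (i ≫ X.map) w α hα = ψ

lemma exists_sends (φ : PiHom X Y) {T : B} (s : T ⟶ Y.dom) (t : T ⟶ X.base)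
    (w : s ≫ Y.map = t ≫ φ.base) : ∃ i : T ⟶ X.dom, i ≫ X.map = t ∧
      ∀ {c : E} (α : c ⟶ X.fib.1), p.IsHomLift i α → ∃ ψ, φ.Sends s i α ψ := by
  have e := φ.idxAt_map s t w
  have e' : φ.idxAt s (φ.idxAt s t w ≫ X.map) (e.symm ▸ w) = φ.idxAt s t w :=
    φ.idxAt_congr rfl e _ _
  exact ⟨_, e, fun α hα => ⟨_, e.symm ▸ w, e', e'.symm ▸ hα, rfl⟩⟩

namespace Sends

variable {φ : PiHom X Y} {T : B} {s : T ⟶ Y.dom} {i : T ⟶ X.dom} {c : E} {α : c ⟶ X.fib.1}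
  {ψ : c ⟶ Y.fib.1}

lemma w (h : φ.Sends s i α ψ) : s ≫ Y.map = (i ≫ X.map) ≫ φ.base := h.1

lemma idxAt_eq (h : φ.Sends s i α ψ) {t : T ⟶ X.base} (ht : i ≫ X.map = t)
    (w : s ≫ Y.map = t ≫ φ.base) : φ.idxAt s t w = i := by
  subst ht
  exact h.2.1

lemma actAt_eq (h : φ.Sends s i α ψ) {t : T ⟶ X.base} (ht : i ≫ X.map = t)
    (w : s ≫ Y.map = t ≫ φ.base) (hα : p.IsHomLift (φ.idxAt s t w) α) :
    φ.actAt s t w α hα = ψ := by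
  subst ht
  exact h.2.2.2

lemma of_actAt {t : T ⟶ X.base} {w : s ≫ Y.map = t ≫ φ.base} (hi : φ.idxAt s t w = i)
    (hα : p.IsHomLift (φ.idxAt s t w) α) (h : φ.actAt s t w α hα = ψ) : φ.Sends s i α ψ := by
  have ht : i ≫ X.map = t := hi ▸ φ.idxAt_map s t w
  subst ht
  exact ⟨w, hi, hα, h⟩

lemma isHomLift_left (h : φ.Sends s i α ψ) : p.IsHomLift i α := by
  obtain ⟨w, e, hα, -⟩ := h
  rwa [e] at hα

lemma isHomLift_right (h : φ.Sends s i α ψ) : p.IsHomLift s ψ := by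
  obtain ⟨w, e, hα, rfl⟩ := h
  exact φ.actAt_isHomLift _ _ _ _ _

lemma idx_unique (h : φ.Sends s i α ψ) {i' : T ⟶ X.dom} {c' : E} {α' : c' ⟶ X.fib.1}
    {ψ' : c' ⟶ Y.fib.1} (h' : φ.Sends s i' α' ψ') (e : i ≫ X.map = i' ≫ X.map) : i = i' :=
  (h.idxAt_eq e (e ▸ h.w)).symm.trans (h'.idxAt_eq rfl _)

lemma val_unique (h : φ.Sends s i α ψ) {ψ' : c ⟶ Y.fib.1} (h' : φ.Sends s i α ψ') : ψ = ψ' :=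
  (h.actAt_eq rfl h.1 h.2.2.1).symm.trans (h'.actAt_eq rfl h'.1 h'.2.2.1)

lemma natural (h : φ.Sends s i α ψ) {T' : B} (k : T' ⟶ T) {c' : E} (γ : c' ⟶ c)
    (hγ : p.IsHomLift k γ) : φ.Sends (k ≫ s) (k ≫ i) (γ ≫ α) (γ ≫ ψ) := by
  obtain ⟨w, e, hα, rfl⟩ := h
  have w' : (k ≫ s) ≫ Y.map = ((k ≫ i) ≫ X.map) ≫ φ.base := by
    simp only [Category.assoc] at w ⊢
    rw [w]
  have e' : φ.idxAt (k ≫ s) ((k ≫ i) ≫ X.map) w' = k ≫ i :=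
    (φ.idxAt_natural k s _ w rfl (Category.assoc _ _ _) w').trans (congrArg (k ≫ ·) e)
  have hα' : p.IsHomLift i α := by rwa [e] at hα
  have h' : p.IsHomLift (φ.idxAt (k ≫ s) ((k ≫ i) ≫ X.map) w') (γ ≫ α) := by
    rw [e']
    infer_instance
  exact ⟨w', e', h', φ.actAt_natural k s _ w γ hγ α hα rfl (Category.assoc _ _ _) w' rfl h'⟩

lemma natural' (h : φ.Sends s i α ψ) {T' : B} {k : T' ⟶ T} {c' : E} (γ : c' ⟶ c)
    (hγ : p.IsHomLift k γ) {s' : T' ⟶ Y.dom} {i' : T' ⟶ X.dom} {α' : c' ⟶ X.fib.1}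
    {ψ' : c' ⟶ Y.fib.1} (hs : k ≫ s = s') (hi : k ≫ i = i') (hα : γ ≫ α = α') (hψ : γ ≫ ψ = ψ') :
    φ.Sends s' i' α' ψ' := by
  subst hs hi hα hψ
  exact h.natural k γ hγ

protected lemma comp (h : φ.Sends s i α ψ) {g : PiHom Y Z} {r : T ⟶ Z.dom} {χ : c ⟶ Z.fib.1}
    (h' : g.Sends r s ψ χ) : (PiHom.comp φ g).Sends r i α χ := by
  have w : r ≫ Z.map = (i ≫ X.map) ≫ φ.base ≫ g.base := by
    rw [h'.w, h.w, Category.assoc]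
  have e₁ := h'.idxAt_eq h.w (comp_w φ g w)
  have e₂ : φ.idxAt (g.idxAt r ((i ≫ X.map) ≫ φ.base) (comp_w φ g w)) (i ≫ X.map)
      (idxAt_map _ _ _ _) = i :=
    (φ.idxAt_congr e₁ rfl _ h.w).trans (h.idxAt_eq rfl _)
  have e := (comp_idxAt φ g r (i ≫ X.map) w).trans e₂
  have hα := h.isHomLift_left
  have hα₂ : p.IsHomLift (φ.idxAt (g.idxAt r ((i ≫ X.map) ≫ φ.base) (comp_w φ g w)) (i ≫ X.map)
      (idxAt_map _ _ _ _)) α := e₂.symm ▸ hα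
  have hα₁ : p.IsHomLift ((PiHom.comp φ g).idxAt r (i ≫ X.map) w) α := e.symm ▸ hα
  refine ⟨w, e, hα₁, (comp_actAt φ g r (i ≫ X.map) w α hα₁ hα₂).trans ?_⟩
  have e₃ : φ.actAt _ (i ≫ X.map) (idxAt_map g r _ (comp_w φ g w)) α hα₂ = ψ :=
    (φ.actAt_congr e₁ rfl _ h.w rfl _ h.2.2.1).trans (h.actAt_eq rfl _ _)
  exact (g.actAt_congr rfl h.w.symm _ h'.w e₃ _ h'.2.2.1).trans (h'.actAt_eq rfl _ _)

/-- The stage determines both intermediate indices before any argument is chosen. The index of the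
composite is unique, so the computed one is `i`, and then `α` can be sent along. -/
lemma of_comp {g : PiHom Y Z} {r : T ⟶ Z.dom} {χ : c ⟶ Z.fib.1}
    (h : (PiHom.comp φ g).Sends r i α χ) :
    ∃ (s : T ⟶ Y.dom) (ψ : c ⟶ Y.fib.1), φ.Sends s i α ψ ∧ g.Sends r s ψ χ := by
  have w : r ≫ Z.map = (i ≫ X.map) ≫ φ.base ≫ g.base := h.w
  obtain ⟨s, hs, H⟩ := g.exists_sends r ((i ≫ X.map) ≫ φ.base) (comp_w φ g w)
  obtain ⟨i', hi', H'⟩ := φ.exists_sends s (i ≫ X.map) hs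
  have key {d : E} (β : d ⟶ X.fib.1) (hβ : p.IsHomLift i' β) :
      ∃ ψ χ', φ.Sends s i' β ψ ∧ g.Sends r s ψ χ' := by
    obtain ⟨ψ, hψ⟩ := H' β hβ
    obtain ⟨χ', hχ'⟩ := H ψ hψ.isHomLift_right
    exact ⟨ψ, χ', hψ, hχ'⟩
  have hi : i' = i := by
    obtain ⟨ψ, χ', h₁, h₂⟩ := key (cartLift p i' X.fib) inferInstance
    exact (h₁.comp h₂).idx_unique h hi'
  subst hi
  obtain ⟨ψ, χ', h₁, h₂⟩ := key α h.isHomLift_left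
  obtain rfl := (h₁.comp h₂).val_unique h
  exact ⟨s, ψ, h₁, h₂⟩

end Sends

/-- A Yoneda argument: the stage given by a pullback and the cartesian argument `α` are generic, and
every other value is a restriction of this one. Any pullback will do, not only the chosen one. -/
lemma ext_sends {f g : PiHom X Y} (hb : f.base = g.base) {P : B} {s : P ⟶ Y.dom}
    {t : P ⟶ X.base} (sq : IsPullback s t Y.map f.base) {i : P ⟶ X.dom} (hi : i ≫ X.map = t)
    {c : E} {α : c ⟶ X.fib.1} (hα : p.IsStronglyCartesian i α) {ψ : c ⟶ Y.fib.1}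
    (hf : f.Sends s i α ψ) (hg : g.Sends s i α ψ) : f = g := by
  subst hi
  refine ext_at hb (fun s' t' w w' => ?_) (fun s' t' w w' c' α' hα₁ hα₂ => ?_)
  · obtain ⟨k, rfl, rfl⟩ : ∃ k, k ≫ s = s' ∧ k ≫ i ≫ X.map = t' :=
      ⟨sq.lift s' t' w, sq.lift_fst _ _ _, sq.lift_snd _ _ _⟩
    rw [f.idxAt_natural k s (i ≫ X.map) sq.w rfl rfl, hf.idxAt_eq rfl,
      g.idxAt_natural k s (i ≫ X.map) hg.w rfl rfl, hg.idxAt_eq rfl]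
  · obtain ⟨k, rfl, rfl⟩ : ∃ k, k ≫ s = s' ∧ k ≫ i ≫ X.map = t' :=
      ⟨sq.lift s' t' w, sq.lift_fst _ _ _, sq.lift_snd _ _ _⟩
    have e : f.idxAt (k ≫ s) (k ≫ i ≫ X.map) w = k ≫ i := by
      rw [f.idxAt_natural k s (i ≫ X.map) sq.w rfl rfl, hf.idxAt_eq rfl]
    have hα' : p.IsHomLift (k ≫ i) α' := e ▸ hα₁
    obtain ⟨γ, ⟨hγ, rfl⟩, -⟩ :=
      Functor.IsStronglyCartesian.universal_property p i α k (k ≫ i) rfl α'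
    rw [(hf.natural k γ hγ).actAt_eq (Category.assoc _ _ _),
      (hg.natural k γ hγ).actAt_eq (Category.assoc _ _ _)]

lemma Sends.exists_val {φ : PiHom X Y} {T : B} {s : T ⟶ Y.dom} {i : T ⟶ X.dom} {c c' : E}
    {α : c ⟶ X.fib.1} {ψ : c ⟶ Y.fib.1} (h : φ.Sends s i α ψ) (α' : c' ⟶ X.fib.1)
    (hα' : p.IsHomLift i α') : ∃ ψ', φ.Sends s i α' ψ' := by
  obtain ⟨i', hi', H⟩ := φ.exists_sends s (i ≫ X.map) h.w
  obtain ⟨ψ₁, h₁⟩ := H (cartLift p i' X.fib) inferInstance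
  obtain rfl := h₁.idx_unique h hi'
  exact H α' hα'

/-- A variant for the case where the values of `g` are not known directly but can be constrained, as
in the uniqueness part of a universal property. -/
lemma ext_sends_of {f g : PiHom X Y} (hb : f.base = g.base) {P : B} {s : P ⟶ Y.dom}
    {t : P ⟶ X.base} (sq : IsPullback s t Y.map f.base) {i : P ⟶ X.dom} (hi : i ≫ X.map = t)
    {c : E} {α : c ⟶ X.fib.1} (hα : p.IsStronglyCartesian i α) {ψ : c ⟶ Y.fib.1}
    (hf : f.Sends s i α ψ) (hg : ∀ {i' : P ⟶ X.dom} {c' : E} {α' : c' ⟶ X.fib.1}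
      {ψ' : c' ⟶ Y.fib.1}, i' ≫ X.map = t → g.Sends s i' α' ψ' → i' = i)
    (hg' : ∀ {ψ' : c ⟶ Y.fib.1}, g.Sends s i α ψ' → ψ' = ψ) : f = g := by
  obtain ⟨i', hi', H⟩ := g.exists_sends s t (hb ▸ sq.w)
  obtain ⟨ψ₁, h₁⟩ := H (cartLift p i' X.fib) inferInstance
  obtain rfl := hg hi' h₁
  obtain ⟨ψ₂, h₂⟩ := h₁.exists_val α hα.toIsHomLift
  obtain rfl := hg' h₂
  exact ext_sends hb sq hi hα hf h₂

/-- The converse of extensionality: index and value at a generic element can be prescribed freely.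
The data are carried to the chosen pullback and the chosen cartesian lifting by the comparison maps
`k` and `γ`. -/
lemma exists_of_isPullback {f : X.base ⟶ Y.base} {P : B} {s : P ⟶ Y.dom}
    {t : P ⟶ X.base} (sq : IsPullback s t Y.map f) {i : P ⟶ X.dom} (hi : i ≫ X.map = t)
    {c : E} {α : c ⟶ X.fib.1} (hα : p.IsStronglyCartesian i α) {ψ : c ⟶ Y.fib.1}
    (hψ : p.IsHomLift s ψ) : ∃ φ : PiHom X Y, φ.base = f ∧ φ.Sends s i α ψ := by
  let k : pb Y.mem f ⟶ P := sq.lift (pbTop Y.mem f) (pbBase Y.mem f) (pb_w _ _)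
  have hk₁ : k ≫ s = pbTop Y.mem f := sq.lift_fst _ _ _
  have hk₂ : k ≫ t = pbBase Y.mem f := sq.lift_snd _ _ _
  have hl : pbLift Y.mem f s t sq.w ≫ k = 𝟙 P := sq.hom_ext
    (by rw [Category.assoc, hk₁, pbLift_top, Category.id_comp])
    (by rw [Category.assoc, hk₂, pbLift_base, Category.id_comp])
  obtain ⟨γ, ⟨hγ, hγ'⟩, -⟩ := Functor.IsStronglyCartesian.universal_property p i α k (k ≫ i) rfl
    (cartLift p (k ≫ i) X.fib)
  have hγψ : p.IsHomLift (pbTop Y.mem f) (γ ≫ ψ) := IsHomLift.of_comp_eq hk₁ _ _ hγ hψ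
  let φ : PiHom X Y := ⟨f, k ≫ i, by rw [Category.assoc, hi, hk₂], vertLift p _ (γ ≫ ψ) hγψ⟩
  have hφ : total φ.fib = γ ≫ ψ := total_vertLift p _ _ _
  have e : φ.idxAt s t sq.w = i := by
    change pbLift Y.mem f s t sq.w ≫ k ≫ i = i
    rw [← Category.assoc, hl, Category.id_comp]
  have hα' : p.IsHomLift (φ.idxAt s t sq.w) α := e.symm ▸ hα.toIsHomLift
  refine ⟨φ, rfl, .of_actAt e hα' ?_⟩
  obtain ⟨β, h₁, h₂, h₃⟩ := φ.exists_actAt s t sq.w α hα'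
  rw [h₃, hφ]
  have hβγ : p.IsHomLift (𝟙 P) (β ≫ γ) := IsHomLift.of_comp_eq hl _ _ h₁ hγ
  have hid : p.IsHomLift (𝟙 P) (𝟙 c) := IsHomLift.id (IsHomLift.domain_eq p s ψ)
  have h₄ : β ≫ γ = 𝟙 c := by
    refine Functor.IsStronglyCartesian.ext p i α (𝟙 P) ?_
    rw [Category.id_comp]
    exact (Category.assoc _ _ _).trans ((congrArg (β ≫ ·) hγ').trans h₂)
  exact (Category.assoc _ _ _).symm.trans ((congrArg (· ≫ ψ) h₄).trans (Category.id_comp _))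

end PiHom

end Sends

/-! ### Cartesian maps and products in `Π_F(p)`. -/

section PiCones

variable {B : Type u₁} [Category.{v₁} B] {E : Type u₂} [Category.{v₂} E] {p : E ⥤ B}

lemma isStronglyCartesian_of_comp {I J K : B} {f : I ⟶ J} {g : J ⟶ K} {h : I ⟶ K} (w : f ≫ g = h)
    {X Y Z : E} {φ : X ⟶ Y} {ψ : Y ⟶ Z} {χ : X ⟶ Z} (e : φ ≫ ψ = χ)
    (hψ : p.IsStronglyCartesian g ψ) (hχ : p.IsStronglyCartesian h χ) (hφ : p.IsHomLift f φ) :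
    p.IsStronglyCartesian f φ := by
  subst w e
  exact Functor.IsStronglyCartesian.of_comp p (g := g) (ψ := ψ)

lemma exists_fac_of_isStronglyCartesian {I J K : B} {f : I ⟶ J} {g : J ⟶ K} {h : I ⟶ K}
    {Y Z X : E} {ψ : Y ⟶ Z} (hψ : p.IsStronglyCartesian g ψ) (χ : X ⟶ Z) (w : f ≫ g = h)
    (hχ : p.IsHomLift h χ) : ∃ φ : X ⟶ Y, p.IsHomLift f φ ∧ φ ≫ ψ = χ :=
  (Functor.IsStronglyCartesian.universal_property p g ψ f h w.symm χ).exists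

/-- It suffices to test the universal property of a product on one cartesian map for each
object. -/
lemma IsProdCone.of_exists_cart {L J : B} {v : L ⟶ J} {c b e : E} {κ : e ⟶ c} {ε : e ⟶ b}
    (cart : p.IsStronglyCartesian v κ) (vert : p.IsHomLift (𝟙 L) ε)
    (H : ∀ {K I : B} {u : K ⟶ I} {g : K ⟶ L} {f : I ⟶ J}, IsPullback u g f v →
      ∀ d : E, p.obj d = I → ∃ (e' : E) (κ' : e' ⟶ d), p.IsStronglyCartesian u κ' ∧
        ∀ φ : e' ⟶ b, p.IsHomLift g φ → ∃! m : d ⟶ c, p.IsHomLift f m ∧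
          ∃ n : e' ⟶ e, p.IsHomLift g n ∧ n ≫ κ = κ' ≫ m ∧ n ≫ ε = φ) :
    IsProdCone p v κ ε := by
  refine ⟨cart, vert, fun {K I u g f} sq {d e₂} κ₂ hκ₂ φ hφ => ?_⟩
  obtain ⟨e₁, κ₁, hκ₁, h⟩ := H sq d (IsHomLift.codomain_eq p u κ₂)
  obtain ⟨i, hi, rfl⟩ := exists_vertical_iso_of_isStronglyCartesian κ₂ κ₁ hκ₂ hκ₁
  have := IsHomLift.inv_vertical i hi
  obtain ⟨m, ⟨hm, n, hn, h₁, h₂⟩, hu⟩ := h (i.inv ≫ φ) inferInstance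
  refine ⟨m, ⟨hm, i.hom ≫ n, inferInstance, by rw [Category.assoc, h₁, Category.assoc],
    by rw [Category.assoc, h₂, Iso.hom_inv_id_assoc]⟩, ?_⟩
  rintro m' ⟨hm', n', hn', h₁', h₂'⟩
  refine hu m' ⟨hm', i.inv ≫ n', inferInstance, ?_, by rw [Category.assoc, h₂']⟩
  rw [Category.assoc, h₁', Category.assoc, Iso.inv_hom_id_assoc]

variable [p.IsFibered] {F : MorphismProperty B} [IsDisplayMapClass F]

lemma piFib_isHomLift_iff {X Y : PiCat p F} {f : X.base ⟶ Y.base} (φ : X ⟶ Y) :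
    (piFib p F).IsHomLift f φ ↔ PiHom.base φ = f := by
  constructor
  · intro h
    exact (@IsHomLift.eq_of_isHomLift _ _ _ _ (piFib p F) _ _ f φ h).symm
  · rintro rfl
    exact IsHomLift.map (piFib p F) φ

namespace PiHom

variable {X Y Z : PiCat p F}

/-- The map `m` of `Π_F(p)` is given by a cartesian map `σ` over the top `z` of a pullback
square. -/
structure IsCart (m : PiHom X Y) (z : X.dom ⟶ Y.dom) (σ : X.fib.1 ⟶ Y.fib.1) : Prop where
  sq : IsPullback z X.map Y.map m.base
  cart : p.IsStronglyCartesian z σ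
  sends : m.Sends z (𝟙 X.dom) (𝟙 X.fib.1) σ

namespace IsCart

variable {m : PiHom X Y} {z : X.dom ⟶ Y.dom} {σ : X.fib.1 ⟶ Y.fib.1}

lemma sends_comp (h : m.IsCart z σ) {T : B} {i : T ⟶ X.dom} {c : E} (α : c ⟶ X.fib.1)
    (hα : p.IsHomLift i α) : m.Sends (i ≫ z) i α (α ≫ σ) :=
  h.sends.natural' α hα rfl (Category.comp_id _) (Category.comp_id _) rfl

/-- The stage `s` has a unique lift to the pullback, and that lift is an index for it; since the
index at a stage is unique, `i` is this lift. -/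
lemma eq_of_sends (h : m.IsCart z σ) {T : B} {s : T ⟶ Y.dom} {i : T ⟶ X.dom} {c : E}
    {α : c ⟶ X.fib.1} {χ : c ⟶ Y.fib.1} (h' : m.Sends s i α χ) : i ≫ z = s ∧ α ≫ σ = χ := by
  let l := h.sq.lift s (i ≫ X.map) h'.w
  have hl : l ≫ z = s := h.sq.lift_fst _ _ _
  have hl' : l ≫ X.map = i ≫ X.map := h.sq.lift_snd _ _ _
  have h₁ := h.sends_comp (cartLift p l X.fib) (cartLift_isCartesian p l X.fib).toIsHomLift
  rw [hl] at h₁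
  obtain e : l = i := h₁.idx_unique h' hl'
  rw [e] at hl
  have h₂ := h.sends_comp α h'.isHomLift_left
  rw [hl] at h₂
  exact ⟨hl, h₂.val_unique h'⟩

/-- By pasting, the generic stage for maps into `X` over `g` is also the generic stage for maps into
`Y` over `g ≫ m.base`, and values at the two stages correspond through the cartesian `σ`. -/
lemma isStronglyCartesian (h : m.IsCart z σ) :
    (piFib p F).IsStronglyCartesian m.base (show X ⟶ Y from m) where
  toIsHomLift := (piFib_isHomLift_iff (X := X) (Y := Y) m).2 rfl
  universal_property' := by
    intro W g ψ hψ
    have hb : PiHom.base ψ = g ≫ m.base :=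
      (@IsHomLift.eq_of_isHomLift _ _ _ _ (piFib p F) _ _ (g ≫ m.base) ψ hψ).symm
    have hc := h.cart
    have sq := pb_isPullback X.mem g
    have sq' : IsPullback (pbTop X.mem g ≫ z) (pbBase X.mem g) Y.map (g ≫ m.base) :=
      sq.paste_horiz h.sq
    obtain ⟨i, hi, H⟩ := PiHom.exists_sends ψ (pbTop X.mem g ≫ z) (pbBase X.mem g)
      (hb ▸ sq'.w)
    obtain ⟨χ, hχ⟩ := H (cartLift p i W.fib) inferInstance
    obtain ⟨χ', hχ', rfl⟩ := exists_fac_of_isStronglyCartesian h.cart χ rfl hχ.isHomLift_right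
    obtain ⟨φ, hφ, hφ'⟩ := exists_of_isPullback sq hi (cartLift_isStronglyCartesian i W.fib) hχ'
    refine ⟨φ, ⟨(piFib_isHomLift_iff (X := W) (Y := X) φ).2 hφ, ?_⟩, ?_⟩
    · refine ext_sends (X := W) (Y := Y) ((congrArg (· ≫ m.base) hφ).trans hb.symm) ?_ hi
        (cartLift_isStronglyCartesian i W.fib) (hφ'.comp (h.sends_comp χ' hχ')) hχ
      change IsPullback _ _ _ (φ.base ≫ m.base)
      rw [hφ]
      exact sq'
    · rintro φ' ⟨h₁, rfl⟩
      have hb' : PiHom.base φ' = g := (piFib_isHomLift_iff φ').1 h₁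
      refine (ext_sends_of (X := W) (Y := X) (hφ.trans hb'.symm) (hφ ▸ sq) hi
        (cartLift_isStronglyCartesian i W.fib) hφ' (fun hi' hs => ?_) (fun hs => ?_)).symm
      · exact (hs.comp (h.sends_comp _ hs.isHomLift_right)).idx_unique hχ (hi'.trans hi.symm)
      · have e := (hs.comp (h.sends_comp _ hs.isHomLift_right)).val_unique hχ
        have := hs.isHomLift_right
        exact Functor.IsStronglyCartesian.ext p z σ (pbTop X.mem g) e

end IsCart

lemma lift_isCart (Y : PiCat p F) {R : B} (f : R ⟶ Y.base) :
    (lift Y f).IsCart (pbTop Y.mem f) (cartLift p (pbTop Y.mem f) Y.fib) where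
  sq := pb_isPullback Y.mem f
  cart := cartLift_isStronglyCartesian (pbTop Y.mem f) Y.fib
  sends := by
    have e : pbLift Y.mem f (pbTop Y.mem f) (pbBase Y.mem f) (pb_w _ _) = 𝟙 _ :=
      pb_hom_ext (by simp) (by simp)
    have hi := (lift_idxAt f (pbTop Y.mem f) (pbBase Y.mem f) (pb_w _ _)).trans e
    have hα : p.IsHomLift ((lift Y f).idxAt (pbTop Y.mem f) (pbBase Y.mem f) (pb_w _ _))
        (𝟙 (reindexObj p (pbTop Y.mem f) Y.fib).1) :=
      hi.symm ▸ IsHomLift.id (reindexObj p (pbTop Y.mem f) Y.fib).2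
    exact .of_actAt hi hα ((lift_actAt f _ _ _ _ hα).trans (Category.id_comp _))

lemma exists_isCart (Y : PiCat p F) {R : B} (f : R ⟶ Y.base) :
    ∃ (P : B) (t : P ⟶ R) (ht : F t) (b : p.Fiber P) (m : PiHom (PiCat.mk t ht b) Y)
      (z : P ⟶ Y.dom) (σ : b.1 ⟶ Y.fib.1), m.base = f ∧ m.IsCart z σ :=
  ⟨_, _, _, _, lift Y f, _, _, rfl, lift_isCart Y f⟩

end PiHom

namespace PiCat

variable {L J D P : B} {h : D ⟶ L} {hh : F h} {w : D ⟶ J} {hw : F w} {a : p.Fiber D}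
  {t : P ⟶ L} {ht : F t} {b : p.Fiber P}

/-- An explicit presentation of the product of `(h, a)` along `κ.base`, with apex `(w, a)` where
`w = h ≫ κ.base`. -/
structure IsCone (κ : PiHom (PiCat.mk t ht b) (PiCat.mk w hw a))
    (ε : PiHom (PiCat.mk t ht b) (PiCat.mk h hh a)) (z : P ⟶ D) (σ : b.1 ⟶ a.1) (δ : D ⟶ P)
    (τ : a.1 ⟶ b.1) : Prop where
  fac : w = h ≫ κ.base
  cart : κ.IsCart z σ
  base : ε.base = 𝟙 L
  sec : δ ≫ z = 𝟙 D
  isHomLift : p.IsHomLift δ τ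
  fib_sec : τ ≫ σ = 𝟙 a.1
  sends : ε.Sends (𝟙 D) δ τ (𝟙 a.1)

/-- The product of `(h, a)` along `v` is `(h ≫ v, a)`. Its reindexing along `v` lives over `P = L
×_J D`, and `ε` is evaluation at the graph `δ = (h, 𝟙) : D ⟶ P`. -/
lemma exists_isCone (hh : F h) (hw : F w) (a : p.Fiber D) {v : L ⟶ J} (e : w = h ≫ v) :
    ∃ (P : B) (t : P ⟶ L) (ht : F t) (b : p.Fiber P)
      (κ : PiHom (PiCat.mk t ht b) (PiCat.mk w hw a))
      (ε : PiHom (PiCat.mk t ht b) (PiCat.mk h hh a)) (z : P ⟶ D) (σ : b.1 ⟶ a.1) (δ : D ⟶ P)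
      (τ : a.1 ⟶ b.1), κ.base = v ∧ IsCone κ ε z σ δ τ := by
  obtain ⟨P, t, ht, b, κ, z, σ, rfl, hκ⟩ := PiHom.exists_isCart (PiCat.mk w hw a) v
  let δ : D ⟶ P := hκ.sq.lift (𝟙 D) h ((Category.id_comp _).trans e)
  have hδ : δ ≫ z = 𝟙 D := hκ.sq.lift_fst _ _ _
  have hδ' : δ ≫ t = h := hκ.sq.lift_snd _ _ _
  have hid : p.IsHomLift (𝟙 D) (𝟙 a.1) := IsHomLift.id a.2
  have hid' : p.IsStronglyCartesian (𝟙 D) (𝟙 a.1) := .of_isIso p (𝟙 D) (𝟙 a.1)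
  obtain ⟨τ, hτ, hτ'⟩ := exists_fac_of_isStronglyCartesian hκ.cart (𝟙 a.1) hδ hid
  have hτ'' := isStronglyCartesian_of_comp hδ hτ' hκ.cart hid' hτ
  obtain ⟨ε, hε, hε'⟩ := PiHom.exists_of_isPullback (X := PiCat.mk t ht b)
    (Y := PiCat.mk h hh a) (IsPullback.id_horiz h) hδ' hτ'' hid
  exact ⟨P, t, ht, b, κ, ε, z, σ, δ, τ, rfl, e, hκ, hε, hδ, hτ, hτ', hε'⟩

variable {κ : PiHom (PiCat.mk t ht b) (PiCat.mk w hw a)}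
  {ε : PiHom (PiCat.mk t ht b) (PiCat.mk h hh a)} {z : P ⟶ D} {σ : b.1 ⟶ a.1} {δ : D ⟶ P}
  {τ : a.1 ⟶ b.1}

/-- The hypothesis `e` says that the stage of `n` lies on the graph `δ`; there `κ` and `ε` take the
same values. -/
lemma IsCone.sends_of_comp (H : IsCone κ ε z σ δ τ) {X : PiCat p F}
    {n : PiHom X (PiCat.mk t ht b)} {T : B} {s : T ⟶ D} {i : T ⟶ X.dom} {c : E} {α : c ⟶ X.fib.1}
    {χ : c ⟶ a.1} (hn : (PiHom.comp n κ).Sends s i α χ) (e : (i ≫ X.map) ≫ n.base = s ≫ h) :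
    (PiHom.comp n ε).Sends s i α χ := by
  obtain ⟨s', ξ, h₁, h₂⟩ := hn.of_comp
  obtain ⟨h₃, h₄⟩ := H.cart.eq_of_sends h₂
  have hδ : δ ≫ t = h := by
    have : 𝟙 D ≫ h = (δ ≫ t) ≫ ε.base := H.sends.w
    rw [H.base] at this
    simpa using this.symm
  have hs : s ≫ δ = s' := by
    refine H.cart.sq.hom_ext ?_ ?_
    · rw [h₃, Category.assoc, H.sec, Category.comp_id]
    · exact (Category.assoc _ _ _).trans ((congrArg (s ≫ ·) hδ).trans (e.symm.trans h₁.w.symm))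
  have hχ := hn.isHomLift_right
  have hξ := h₁.isHomLift_right
  have hτ := H.isHomLift
  have hχτ : p.IsHomLift s' (χ ≫ τ) := IsHomLift.of_comp_eq hs _ _ hχ hτ
  have hc := H.cart.cart
  have e' : χ ≫ τ = ξ := by
    refine Functor.IsStronglyCartesian.ext p z σ s' ?_
    refine (Category.assoc _ _ _).trans ((congrArg (χ ≫ ·) H.fib_sec).trans ?_)
    exact (Category.comp_id _).trans h₄.symm
  exact h₁.comp (H.sends.natural' χ hχ (Category.comp_id _) hs e' (Category.comp_id _))

lemma IsCone.isProdCone (H : IsCone κ ε z σ δ τ) : IsProdCone (piFib p F) κ.base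
    (show PiCat.mk t ht b ⟶ PiCat.mk w hw a from κ)
    (show PiCat.mk t ht b ⟶ PiCat.mk h hh a from ε) := by
  have hcart := H.cart.isStronglyCartesian
  refine .of_exists_cart hcart
    ((piFib_isHomLift_iff (X := PiCat.mk t ht b) (Y := PiCat.mk h hh a) ε).2 H.base) ?_
  rintro K I u g f sq d (rfl : d.base = I)
  obtain ⟨P', t', ht', b', κ', z', σ', hκb, hκ'⟩ := PiHom.exists_isCart d u
  refine ⟨PiCat.mk t' ht' b', κ', hκb ▸ hκ'.isStronglyCartesian, fun φ hφ => ?_⟩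
  have hφb : PiHom.base φ = g :=
    (piFib_isHomLift_iff (X := PiCat.mk t' ht' b') (Y := PiCat.mk h hh a) φ).1 hφ
  have sq₁ := pb_isPullback hh g
  -- The pullback of `h` along `g` is also the pullback of `w` along `f`. The map sought and the
  -- given `φ` thus have the same generic stage, and the former is defined by the generic value of
  -- the latter.
  have sq₂ : IsPullback (pbTop hh g) (pbBase hh g ≫ u) w f := by
    have := sq₁.paste_vert sq.flip
    rwa [← H.fac] at this
  have sqd : IsPullback z' t' d.map u := hκb ▸ hκ'.sq
  obtain ⟨i, hi, Hi⟩ := PiHom.exists_sends φ (pbTop hh g) (pbBase hh g) (hφb ▸ sq₁.w)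
  have hα : p.IsStronglyCartesian i (cartLift p i b') := inferInstance
  obtain ⟨χ, hχ⟩ := Hi (cartLift p i b') inferInstance
  have hα' := isStronglyCartesian_comp rfl hα hκ'.cart
  have hi' : (i ≫ z') ≫ d.map = pbBase hh g ≫ u := by
    rw [Category.assoc, sqd.w, ← Category.assoc]
    exact congrArg (· ≫ u) hi
  obtain ⟨m, hm, hm'⟩ := PiHom.exists_of_isPullback (X := d) (Y := PiCat.mk w hw a) sq₂ hi' hα'
    hχ.isHomLift_right
  -- Values of `m'` restrict along the cartesian `κ'` and are then values of `n ≫ ε`. This gives the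
  -- equation for `m`, and it forces every competitor to agree with `m`.
  have key {m' : PiHom d (PiCat.mk w hw a)} {n : PiHom (PiCat.mk t' ht' b') (PiCat.mk t ht b)}
      (hn : n.base = g) (hmn : PiHom.comp n κ = PiHom.comp κ' m') {j : pb hh g ⟶ P'} {c : E}
      {α : c ⟶ b'.1} (hα : p.IsHomLift j α) {ψ : c ⟶ a.1} (hj : j ≫ t' = pbBase hh g)
      (h' : m'.Sends (pbTop hh g) (j ≫ z') (α ≫ σ') ψ) :
      (PiHom.comp n ε).Sends (pbTop hh g) j α ψ := by
    have h₁ := (hκ'.sends_comp α hα).comp h'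
    rw [← hmn] at h₁
    refine H.sends_of_comp h₁ ?_
    rw [hn]
    exact (congrArg (· ≫ g) hj).trans sq₁.w.symm
  have hmc : (piFib p F).IsHomLift (u ≫ f) (PiHom.comp κ' m : PiCat.mk t' ht' b' ⟶ _) :=
    (piFib_isHomLift_iff (X := PiCat.mk t' ht' b') (Y := PiCat.mk w hw a) _).2
      (congrArg₂ (· ≫ ·) hκb hm)
  obtain ⟨n, hn, hn'⟩ := exists_fac_of_isStronglyCartesian hcart (PiHom.comp κ' m) sq.w.symm hmc
  have hnb : PiHom.base n = g :=
    (piFib_isHomLift_iff (X := PiCat.mk t' ht' b') (Y := PiCat.mk t ht b) n).1 hn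
  have hbase {n : PiHom (PiCat.mk t' ht' b') (PiCat.mk t ht b)} (hn : n.base = g) :
      (PiHom.comp n ε).base = g :=
    (congrArg₂ (· ≫ ·) hn H.base).trans (Category.comp_id _)
  refine ⟨m, ⟨(piFib_isHomLift_iff (X := d) (Y := PiCat.mk w hw a) m).2 hm, n, hn, hn', ?_⟩, ?_⟩
  · have h₁ := key hnb hn' hχ.isHomLift_left hi hm'
    exact PiHom.ext_sends ((hbase hnb).trans hφb.symm) ((hbase hnb).symm ▸ sq₁) hi hα h₁ hχ
  · rintro m' ⟨hm₁, n', hn₁, hn₂, rfl⟩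
    have hmb : PiHom.base m' = f :=
      (piFib_isHomLift_iff (X := d) (Y := PiCat.mk w hw a) m').1 hm₁
    have hnb' : PiHom.base n' = g :=
      (piFib_isHomLift_iff (X := PiCat.mk t' ht' b') (Y := PiCat.mk t ht b) n').1 hn₁
    refine (PiHom.ext_sends_of (X := d) (Y := PiCat.mk w hw a) (hm.trans hmb.symm) (hm ▸ sq₂) hi'
      hα' hm' (fun {i₁ c₁ α₁ ψ₁} hi₁ hs => ?_) (fun hs => ?_)).symm
    · let j := sqd.lift i₁ (pbBase hh g) hi₁
      have hj : j ≫ z' = i₁ := sqd.lift_fst _ _ _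
      have hj' : j ≫ t' = pbBase hh g := sqd.lift_snd _ _ _
      have hβ : p.IsHomLift j (cartLift p j b') := inferInstance
      have hσ := hκ'.cart
      obtain ⟨ψ₂, hs₂⟩ := hs.exists_val (cartLift p j b' ≫ σ')
        (IsHomLift.of_comp_eq hj _ _ hβ hσ.toIsHomLift)
      rw [← hj] at hs₂
      have := (key hnb' hn₂ hβ hj' hs₂).idx_unique hχ (hj'.trans hi.symm)
      rw [← hj, this]
    · exact (key hnb' hn₂ hχ.isHomLift_left hi hs).val_unique hχ

end PiCat

end PiCones

/-! ### Objects over identities cogenerate `Π_F(p)`. -/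

section PiUnits

variable {B : Type u₁} [Category.{v₁} B] {E : Type u₂} [Category.{v₂} E] {p : E ⥤ B}
  [p.IsFibered] {F : MorphismProperty B} [IsDisplayMapClass F]

namespace PiCat

/-- The object of `Π_F(p)` given by an object of `p`, over an identity. -/
def unit (hI : ∀ I, F (𝟙 I)) (x : E) : PiCat p F :=
  PiCat.mk (𝟙 (p.obj x)) (hI _) ⟨x, rfl⟩

lemma exists_unit_isStronglyCartesian (hI : ∀ I, F (𝟙 I)) {I J : B} {f : I ⟶ J} {x' x : E}
    (φ : x' ⟶ x) (hφ : p.IsStronglyCartesian f φ) :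
    ∃ m : unit (p := p) hI x' ⟶ unit hI x, (piFib p F).IsStronglyCartesian f m := by
  have := hφ.toIsHomLift
  subst_hom_lift p f φ
  have sq : IsPullback (p.map φ) (𝟙 (p.obj x')) (𝟙 (p.obj x)) (p.map φ) := .of_vert_isIso ⟨by simp⟩
  have hid : p.IsHomLift (𝟙 (p.obj x')) (𝟙 x') := IsHomLift.id rfl
  obtain ⟨m, hm, hm'⟩ := PiHom.exists_of_isPullback (X := unit (p := p) hI x')
    (Y := unit (p := p) hI x) sq (Category.comp_id (𝟙 (p.obj x')))
    (.of_isIso p (𝟙 (p.obj x')) (𝟙 x')) hφ.toIsHomLift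
  have : m.IsCart (p.map φ) φ := ⟨hm.symm ▸ sq, hφ, hm'⟩
  exact ⟨m, hm ▸ this.isStronglyCartesian⟩

lemma exists_isProdCone (X : PiCat p F) {J : B} (v : X.base ⟶ J) (hv : F (X.map ≫ v)) :
    ∃ (c e : PiCat p F) (κ : e ⟶ c) (ε : e ⟶ X), IsProdCone (piFib p F) v κ ε := by
  obtain ⟨P, t, ht, b, κ, ε, z, σ, δ, τ, hκ, h⟩ := exists_isCone X.mem hv X.fib rfl
  exact ⟨_, _, _, _, hκ ▸ h.isProdCone⟩

/-- The explicit cone with `h` an identity: `(v, x)` is the product along `v` of `x` placed over an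
identity. -/
lemma exists_isProdCone_unit (hI : ∀ I, F (𝟙 I)) (X : PiCat p F) :
    ∃ (e : PiCat p F) (κ : e ⟶ X) (ε : e ⟶ unit hI X.fib.1),
      IsProdCone (piFib p F) X.map κ ε := by
  obtain ⟨v, hv, x, rfl⟩ := X
  obtain ⟨P, t, ht, b, κ, ε, z, σ, δ, τ, hκ, h⟩ :=
    exists_isCone (hI (p.obj x)) hv ⟨x, rfl⟩ (Category.id_comp v).symm
  exact ⟨_, _, _, hκ ▸ h.isProdCone⟩

section Legs

variable {L J A D P C : B} {h : D ⟶ L} {hh : F h} {w : D ⟶ J} {hw : F w} {a : p.Fiber D}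
  {t : P ⟶ L} {ht : F t} {b : p.Fiber P} {κ : PiHom (PiCat.mk t ht b) (PiCat.mk w hw a)}
  {ε : PiHom (PiCat.mk t ht b) (PiCat.mk h hh a)} {z : P ⟶ D} {σ : b.1 ⟶ a.1} {δ : D ⟶ P}
  {τ : a.1 ⟶ b.1} {t' : C ⟶ A} {ht' : F t'} {b' : p.Fiber C}
  {κ' : PiHom (PiCat.mk t' ht' b') (PiCat.mk w hw a)} {z' : C ⟶ D} {σ' : b'.1 ⟶ a.1}

/-- The legs of an explicit cone. -/
lemma IsCone.exists_leg (H : IsCone κ ε z σ δ τ) (hκ' : κ'.IsCart z' σ') {g : A ⟶ L}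
    (hg : g ≫ κ.base = κ'.base) : ∃ (Q : B) (r : Q ⟶ A) (hr : F r) (y : Q ⟶ D) (d : p.Fiber Q)
      (l : PiHom (PiCat.mk r hr d) (PiCat.mk h hh a))
      (θ : PiHom (PiCat.mk t' ht' b') (PiCat.mk r hr d)) (j : Q ⟶ C) (lam : d.1 ⟶ a.1)
      (η : d.1 ⟶ b'.1), IsPullback y r h g ∧ j ≫ z' = y ∧ j ≫ t' = r ∧
        p.IsStronglyCartesian y lam ∧ p.IsStronglyCartesian j η ∧ η ≫ σ' = lam ∧
        IsProdLeg (piFib p F) g (show PiCat.mk t ht b ⟶ PiCat.mk w hw a from κ)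
          (show PiCat.mk t ht b ⟶ PiCat.mk h hh a from ε)
          (show PiCat.mk t' ht' b' ⟶ PiCat.mk w hw a from κ')
          (show PiCat.mk r hr d ⟶ PiCat.mk h hh a from l)
          (show PiCat.mk t' ht' b' ⟶ PiCat.mk r hr d from θ) ∧
        θ.Sends (𝟙 Q) j η (𝟙 d.1) := by
  obtain ⟨Q, r, hr, d, l, y, lam, rfl, hl⟩ := PiHom.exists_isCart (PiCat.mk h hh a) g
  have hwy : y ≫ w = r ≫ κ'.base := by
    refine (congrArg (y ≫ ·) H.fac).trans ?_
    rw [← hg, ← Category.assoc, ← Category.assoc]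
    exact congrArg (· ≫ κ.base) hl.sq.w
  let j : Q ⟶ C := hκ'.sq.lift y r hwy
  have hj : j ≫ z' = y := hκ'.sq.lift_fst _ _ _
  have hj' : j ≫ t' = r := hκ'.sq.lift_snd _ _ _
  obtain ⟨η, hη, hη'⟩ := exists_fac_of_isStronglyCartesian hκ'.cart lam hj hl.cart.toIsHomLift
  have hηc := isStronglyCartesian_of_comp hj hη' hκ'.cart hl.cart hη
  have hid : p.IsHomLift (𝟙 Q) (𝟙 d.1) := IsHomLift.id d.2
  obtain ⟨θ, hθ, hθ'⟩ := PiHom.exists_of_isPullback (X := PiCat.mk t' ht' b')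
    (Y := PiCat.mk r hr d) (IsPullback.id_horiz r) hj' hηc hid
  refine ⟨Q, r, hr, y, d, l, θ, j, lam, η, hl.sq, hj, hj', hl.cart, hηc, hη', ?_, hθ'⟩
  refine ⟨hl.isStronglyCartesian,
    (piFib_isHomLift_iff (X := PiCat.mk t' ht' b') (Y := PiCat.mk r hr d) θ).2 hθ, ?_⟩
  obtain ⟨n, hn, hn'⟩ := exists_fac_of_isStronglyCartesian H.cart.isStronglyCartesian
    (show PiCat.mk t' ht' b' ⟶ PiCat.mk w hw a from κ') hg
    ((piFib_isHomLift_iff (X := PiCat.mk t' ht' b') (Y := PiCat.mk w hw a) κ').2 rfl)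
  have hnb : PiHom.base n = l.base :=
    (piFib_isHomLift_iff (X := PiCat.mk t' ht' b') (Y := PiCat.mk t ht b) n).1 hn
  refine ⟨n, hn, hn', ?_⟩
  have h₁ : (PiHom.comp n κ).Sends y j η lam := by
    have := hκ'.sends_comp η hη
    rw [hj, hη'] at this
    have e : PiHom.comp n κ = κ' := hn'
    rwa [e]
  have h₂ := H.sends_of_comp h₁ (by
    rw [hnb]
    exact (congrArg (· ≫ l.base) hj').trans hl.sq.w.symm)
  have hb₁ : (PiHom.comp n ε).base = l.base :=
    (congrArg₂ (· ≫ ·) hnb H.base).trans (Category.comp_id _)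
  have hb₂ : (PiHom.comp θ l).base = l.base :=
    (congrArg (· ≫ l.base) hθ).trans (Category.id_comp _)
  have hlid : l.Sends y (𝟙 Q) (𝟙 d.1) lam := hl.sends
  have h₃ : (PiHom.comp θ l).Sends y j η lam :=
    (hθ'.natural' (𝟙 d.1) hid (Category.id_comp _) (Category.id_comp _) (Category.id_comp _)
      (Category.id_comp _)).comp hlid
  exact PiHom.ext_sends (X := PiCat.mk t' ht' b') (Y := PiCat.mk h hh a) (hb₁.trans hb₂.symm)
    (hb₁.symm ▸ hl.sq) hj' hηc h₂ h₃

variable {x : E}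

lemma exists_sends_unit {hI : ∀ I, F (𝟙 I)} {Q : B} {r : Q ⟶ p.obj x} {hr : F r} {d : p.Fiber Q}
    (s : PiHom (PiCat.mk r hr d) (unit hI x)) (hs : s.base = 𝟙 (p.obj x)) :
    ∃ (i : p.obj x ⟶ Q) (c : E) (α : c ⟶ d.1) (χ : c ⟶ x), i ≫ r = 𝟙 (p.obj x) ∧
      p.IsStronglyCartesian i α ∧ s.Sends (𝟙 (p.obj x)) i α χ := by
  obtain ⟨i, hi, H⟩ := s.exists_sends (𝟙 (p.obj x)) (𝟙 (p.obj x)) (by rw [hs]; rfl)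
  obtain ⟨χ, hχ⟩ := H (cartLift p i d) inferInstance
  exact ⟨i, _, _, χ, hi, cartLift_isStronglyCartesian i d, hχ⟩

/-- The objects over identities are orthogonal to explicit cones. -/
lemma IsCone.prodOrthAt_unit {hI : ∀ I, F (𝟙 I)} {t' : C ⟶ p.obj x} {ht' : F t'}
    {κ' : PiHom (PiCat.mk t' ht' b') (PiCat.mk w hw a)} (H : IsCone κ ε z σ δ τ)
    (hκ' : κ'.IsCart z' σ') :
    ProdOrthAt (piFib p F) (p.obj x) (L := L) (show PiCat.mk t ht b ⟶ PiCat.mk w hw a from κ)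
      (show PiCat.mk t ht b ⟶ PiCat.mk h hh a from ε)
      (show PiCat.mk t' ht' b' ⟶ PiCat.mk w hw a from κ') (unit hI x) := by
  have hκc := H.cart.isStronglyCartesian
  have hκc' := hκ'.isStronglyCartesian
  have key {g : p.obj x ⟶ L} {d : PiCat p F} {l : d ⟶ PiCat.mk h hh a}
      {θ : PiCat.mk t' ht' b' ⟶ d} (hl : IsProdLeg (piFib p F) g
        (show PiCat.mk t ht b ⟶ PiCat.mk w hw a from κ)
        (show PiCat.mk t ht b ⟶ PiCat.mk h hh a from ε)
        (show PiCat.mk t' ht' b' ⟶ PiCat.mk w hw a from κ') l θ) :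
      g ≫ κ.base = κ'.base := hl.comp_eq hκc.toIsHomLift hκc'.toIsHomLift
  constructor
  · intro m hm
    have hmb : PiHom.base m = 𝟙 (p.obj x) :=
      (piFib_isHomLift_iff (X := PiCat.mk t' ht' b') (Y := unit hI x) m).1 hm
    obtain ⟨i, c, α, χ, hi, hα, hs⟩ := exists_sends_unit m hmb
    have hw' : z' ≫ w = t' ≫ κ'.base := hκ'.sq.w
    -- A vertical map into `unit hI x` is a section `i` of `t'` with a map of `E`. Composing the
    -- section with `z'` gives a point of `D`, and its image in `L` is the index of the leg.
    have hg : (i ≫ z' ≫ h) ≫ κ.base = κ'.base := by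
      have e : (i ≫ z' ≫ h) ≫ κ.base = i ≫ z' ≫ w := by
        rw [Category.assoc, Category.assoc]
        exact congrArg (fun k => i ≫ z' ≫ k) H.fac.symm
      rw [e, hw', ← Category.assoc, hi, Category.id_comp]
    obtain ⟨Q, r, hr, y, d, l, θ, j, lam, η, sq, hj, hj', hlam, hη, hη', hleg, hθ⟩ :=
      H.exists_leg hκ' hg
    let k : p.obj x ⟶ Q := sq.lift (i ≫ z') (𝟙 _) (by rw [Category.assoc, Category.id_comp])
    have hk : k ≫ y = i ≫ z' := sq.lift_fst _ _ _
    have hk' : k ≫ r = 𝟙 _ := sq.lift_snd _ _ _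
    have hkj : k ≫ j = i := by
      refine hκ'.sq.hom_ext ?_ ?_
      · rw [Category.assoc, hj, hk]
      · exact (Category.assoc _ _ _).trans ((congrArg (k ≫ ·) hj').trans (hk'.trans hi.symm))
    have hασ := isStronglyCartesian_comp hk.symm hα hκ'.cart
    obtain ⟨β, hβ, hβ'⟩ := exists_fac_of_isStronglyCartesian hlam (α ≫ σ') rfl hασ.toIsHomLift
    have hβc := isStronglyCartesian_of_comp rfl hβ' hlam hασ hβ
    have hηl := hη.toIsHomLift
    have hβη : β ≫ η = α := by
      have := hκ'.cart
      have h₁ : p.IsHomLift i (β ≫ η) := IsHomLift.of_comp_eq hkj _ _ hβ hηl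
      have h₂ := hα.toIsHomLift
      refine Functor.IsStronglyCartesian.ext p z' σ' i ?_
      rw [Category.assoc, hη', hβ']
    obtain ⟨s, hsb, hs'⟩ := PiHom.exists_of_isPullback (X := PiCat.mk r hr d) (Y := unit hI x)
      (IsPullback.id_horiz (𝟙 (p.obj x))) hk' hβc hs.isHomLift_right
    refine ⟨_, _, l, θ, s, hleg,
      (piFib_isHomLift_iff (X := PiCat.mk r hr d) (Y := unit hI x) s).2 hsb, ?_⟩
    have hθb : PiHom.base θ = 𝟙 _ :=
      (piFib_isHomLift_iff (X := PiCat.mk t' ht' b') (Y := PiCat.mk r hr d) θ).1 hleg.vert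
    have hb : (PiHom.comp θ s).base = 𝟙 (p.obj x) :=
      (congrArg₂ (· ≫ ·) hθb hsb).trans (Category.comp_id _)
    refine PiHom.ext_sends (X := PiCat.mk t' ht' b') (Y := unit hI x) (hb.trans hmb.symm)
      (hb.symm ▸ IsPullback.id_horiz (𝟙 (p.obj x))) hi hα ?_ hs
    exact (hθ.natural' β hβ (Category.comp_id _) hkj hβη (Category.comp_id _)).comp hs'
  · intro g₁ g₂ b₁ b₂ l₁ l₂ θ₁ θ₂ h₁ h₂ s₁ s₂ hs₁ hs₂ e
    -- The index `g` is read off from the composite `θ ≫ s`: it is the section picked by that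
    -- composite, followed by `z' ≫ h`.
    have key' {g : p.obj x ⟶ L} {d : PiCat p F} {l : d ⟶ PiCat.mk h hh a}
      {θ : PiCat.mk t' ht' b' ⟶ d} (hl : IsProdLeg (piFib p F) g
        (show PiCat.mk t ht b ⟶ PiCat.mk w hw a from κ)
        (show PiCat.mk t ht b ⟶ PiCat.mk h hh a from ε)
        (show PiCat.mk t' ht' b' ⟶ PiCat.mk w hw a from κ') l θ) (s : d ⟶ unit hI x)
        (hs : (piFib p F).IsHomLift (𝟙 (p.obj x)) s) : ∃ (i : p.obj x ⟶ C) (c : E)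
          (α : c ⟶ b'.1) (χ : c ⟶ x), i ≫ t' = 𝟙 _ ∧ i ≫ z' ≫ h = g ∧
            PiHom.Sends (Y := unit hI x) (θ ≫ s) (𝟙 (p.obj x)) i α χ := by
      obtain ⟨Q, r, hr, y, d, l', θ', j, lam, η, sq, hj, hj', hlam, hη, hη', hleg, hθ⟩ :=
        H.exists_leg hκ' (key hl)
      obtain ⟨ι, hι, -, rfl⟩ := hleg.exists_iso hκc hl
      have hsb : PiHom.base (ι.hom ≫ s) = 𝟙 (p.obj x) :=
        (piFib_isHomLift_iff (X := PiCat.mk r hr d) (Y := unit hI x) (ι.hom ≫ s)).1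
          (IsHomLift.of_comp_eq (Category.comp_id _) _ _ hι hs)
      obtain ⟨k, c, α, χ, hk, hα, hs'⟩ := exists_sends_unit (ι.hom ≫ s) hsb
      refine ⟨k ≫ j, c, α ≫ η, χ, ?_, ?_, ?_⟩
      · rw [Category.assoc, hj', hk]
      · rw [Category.assoc, ← Category.assoc j, hj, sq.w, ← Category.assoc, hk, Category.id_comp]
      · rw [Category.assoc]
        exact (hθ.natural' α hα.toIsHomLift (Category.comp_id _) rfl rfl (Category.comp_id _)).comp
          hs'
    obtain ⟨i₁, c₁, α₁, χ₁, hi₁, rfl, hm₁⟩ := key' h₁ s₁ hs₁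
    obtain ⟨i₂, c₂, α₂, χ₂, hi₂, rfl, hm₂⟩ := key' h₂ s₂ hs₂
    rw [e] at hm₁
    rw [hm₁.idx_unique hm₂ (hi₁.trans hi₂.symm)]
  · intro g b₁ l θ hl s₁ s₂ hs₁ hs₂ e
    obtain ⟨Q, r, hr, y, d, l', θ', j, lam, η, sq, hj, hj', hlam, hη, hη', hleg, hθ⟩ :=
      H.exists_leg hκ' (key hl)
    obtain ⟨ι, hι, -, rfl⟩ := hleg.exists_iso hκc hl
    have hsb₁ : PiHom.base (ι.hom ≫ s₁) = 𝟙 (p.obj x) :=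
      (piFib_isHomLift_iff (X := PiCat.mk r hr d) (Y := unit hI x) (ι.hom ≫ s₁)).1
          (IsHomLift.of_comp_eq (Category.comp_id _) _ _ hι hs₁)
    have hsb₂ : PiHom.base (ι.hom ≫ s₂) = 𝟙 (p.obj x) :=
      (piFib_isHomLift_iff (X := PiCat.mk r hr d) (Y := unit hI x) (ι.hom ≫ s₂)).1
          (IsHomLift.of_comp_eq (Category.comp_id _) _ _ hι hs₂)
    have hcomp {s : PiCat.mk r hr d ⟶ unit hI x} {k : p.obj x ⟶ Q} {c : E} {α : c ⟶ d.1} {χ : c ⟶ x}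
        (hs : PiHom.Sends (Y := unit hI x) s (𝟙 (p.obj x)) k α χ) :
        PiHom.Sends (Y := unit hI x) (θ' ≫ s) (𝟙 (p.obj x)) (k ≫ j) (α ≫ η) χ :=
      (hθ.natural' α hs.isHomLift_left (Category.comp_id _) rfl rfl (Category.comp_id _)).comp hs
    rw [Category.assoc, Category.assoc] at e
    obtain ⟨k, c, α, χ, hk, hα, hs'⟩ := exists_sends_unit (ι.hom ≫ s₁) hsb₁
    rw [← cancel_epi ι.hom]
    refine PiHom.ext_sends_of (X := PiCat.mk r hr d) (Y := unit hI x) (hsb₁.trans hsb₂.symm)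
      (hsb₁.symm ▸ IsPullback.id_horiz (𝟙 (p.obj x))) hk hα hs' (fun {k'} _ _ _ hk' h' => ?_)
      (fun h' => ?_)
    · have h₂ := hcomp h'
      rw [← e] at h₂
      have h₃ : k' ≫ j = k ≫ j := h₂.idx_unique (hcomp hs') (by
        change (k' ≫ j) ≫ t' = (k ≫ j) ≫ t'
        rw [Category.assoc, Category.assoc, hj']
        exact hk'.trans hk.symm)
      refine sq.hom_ext ?_ (hk'.trans hk.symm)
      rw [← hj, ← Category.assoc, h₃, Category.assoc]
    · have h₂ := hcomp h'
      rw [← e] at h₂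
      exact h₂.val_unique (hcomp hs')

end Legs

/-- Every cone on `(h, a)` along a display map `v` is isomorphic to the explicit one. The latter
exists because `h ≫ v` is again in `F`. -/
lemma prodOrth_unit [F.IsStableUnderComposition] (hI : ∀ I, F (𝟙 I)) (x : E) :
    ProdOrth (piFib p F) F (unit hI x) := by
  intro L J A v hv c b e κ ε hc k c' κ' hκ'
  by_cases hA : p.obj x = A
  · subst hA
    obtain rfl : b.base = L := @IsHomLift.codomain_eq _ _ _ _ (piFib p F) _ _ _ _ _ ε hc.vert
    obtain ⟨h, hh, a⟩ := b
    obtain ⟨P, t, ht, b, κ₁, ε₁, z, σ, δ, τ, hκ₁, H⟩ :=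
      exists_isCone hh (F.comp_mem _ _ hh hv) a rfl
    obtain ⟨C, t', ht', b', κ₁', z', σ', rfl, hκ₁'⟩ :=
      PiHom.exists_isCart (PiCat.mk (h ≫ v) (F.comp_mem _ _ hh hv) a) k
    have h₁ := H.isProdCone
    rw [hκ₁] at h₁
    exact (H.prodOrthAt_unit hκ₁').of_cone_iso h₁ hc hκ₁'.isStronglyCartesian hκ'
  · exact ⟨fun f hf => (hA (@IsHomLift.codomain_eq _ _ _ _ (piFib p F) _ _ _ _ (𝟙 A) f hf)).elim,
      fun _ _ s _ hs _ _ =>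
        (hA (@IsHomLift.codomain_eq _ _ _ _ (piFib p F) _ _ _ _ (𝟙 A) s hs)).elim,
      fun _ s _ hs _ _ =>
        (hA (@IsHomLift.codomain_eq _ _ _ _ (piFib p F) _ _ _ _ (𝟙 A) s hs)).elim⟩

end PiCat

end PiUnits

/-! ### Objects over identities generate `Σ_F(p)`. -/

section SigmaUnits

variable {B : Type u₁} [Category.{v₁} B] {E : Type u₂} [Category.{v₂} E] {p : E ⥤ B}
  {F : MorphismProperty B}

lemma sigmaFib_isHomLift_iff {X Y : SigmaCat p F} {f : X.base ⟶ Y.base} (φ : X ⟶ Y) :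
    (sigmaFib p F).IsHomLift f φ ↔ SigmaHom.base φ = f := by
  constructor
  · intro h
    exact (@IsHomLift.eq_of_isHomLift _ _ _ _ (sigmaFib p F) _ _ f φ h).symm
  · rintro rfl
    exact IsHomLift.map (sigmaFib p F) φ

namespace SigmaCat

/-- A map of `Σ_F(p)` whose top component and whose component in `E` are isomorphisms is
cocartesian. -/
lemma isStronglyCocartesian_of_isIso {X Y : SigmaCat p F} (φ : X ⟶ Y)
    [IsIso (SigmaHom.top φ)] [IsIso (SigmaHom.fib φ)] :
    (sigmaFib p F).IsStronglyCocartesian (SigmaHom.base φ) φ where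
  toIsHomLift := (sigmaFib_isHomLift_iff φ).2 rfl
  universal_property' := by
    intro Z g ψ hψ
    change Y.base ⟶ Z.base at g
    have hb : SigmaHom.base ψ = SigmaHom.base φ ≫ g :=
      (@IsHomLift.eq_of_isHomLift _ _ _ _ (sigmaFib p F) _ _ (SigmaHom.base φ ≫ g) ψ hψ).symm
    have h₁ := SigmaHom.isHomLift φ
    have h₂ := SigmaHom.isHomLift ψ
    have h₃ : p.IsHomLift (inv (SigmaHom.top φ)) (inv (SigmaHom.fib φ)) := inferInstance
    have hw : Y.map ≫ g = (inv (SigmaHom.top φ) ≫ SigmaHom.top ψ) ≫ Z.map := by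
      rw [Category.assoc, ← SigmaHom.w ψ, hb, IsIso.eq_inv_comp, ← Category.assoc, ← SigmaHom.w φ]
      exact Category.assoc _ _ _
    let χ : Y ⟶ Z := SigmaHom.mk g (inv (SigmaHom.top φ) ≫ SigmaHom.top ψ) hw
      (inv (SigmaHom.fib φ) ≫ SigmaHom.fib ψ) inferInstance
    refine ⟨χ, ⟨(sigmaFib_isHomLift_iff χ).2 rfl, SigmaHom.ext hb.symm
      (IsIso.hom_inv_id_assoc _ _) (IsIso.hom_inv_id_assoc _ _)⟩, ?_⟩
    rintro χ' ⟨h₄, rfl⟩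
    refine SigmaHom.ext ((sigmaFib_isHomLift_iff χ').1 h₄) ?_ ?_
    · exact (IsIso.inv_hom_id_assoc _ _).symm
    · exact (IsIso.inv_hom_id_assoc _ _).symm

/-- The embedding of `p` into `Σ_F(p)` as the objects over identities. -/
def unit (p : E ⥤ B) (hI : ∀ I, F (𝟙 I)) : E ⥤ SigmaCat p F where
  obj x := SigmaCat.mk (𝟙 (p.obj x)) (hI _) ⟨x, rfl⟩
  map {x y} φ := SigmaHom.mk (X := SigmaCat.mk (𝟙 (p.obj x)) (hI _) ⟨x, rfl⟩)
    (Y := SigmaCat.mk (𝟙 (p.obj y)) (hI _) ⟨y, rfl⟩) (p.map φ) (p.map φ)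
    ((Category.id_comp _).trans (Category.comp_id _).symm) φ inferInstance
  map_id x := SigmaHom.ext (p.map_id x) (p.map_id x) rfl
  map_comp φ ψ := SigmaHom.ext (p.map_comp φ ψ) (p.map_comp φ ψ) rfl

variable (hI : ∀ I, F (𝟙 I))

instance : (unit p hI).Faithful where
  map_injective h := congrArg SigmaHom.fib h

instance : (unit p hI).Full where
  map_surjective {x y} m := by
    have h₁ : p.map (SigmaHom.fib m) = SigmaHom.top m :=
      (@IsHomLift.eq_of_isHomLift _ _ _ _ p _ _ _ _ (SigmaHom.isHomLift m)).symm
    have h₂ : 𝟙 _ ≫ SigmaHom.base m = SigmaHom.top m ≫ 𝟙 _ := SigmaHom.w m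
    rw [Category.id_comp, Category.comp_id] at h₂
    exact ⟨SigmaHom.fib m, SigmaHom.ext (h₁.trans h₂.symm) h₁ rfl⟩

/-- A map from `W` into an object over an identity has its top side forced to be `W.map` followed by
its base, so lifting it amounts to lifting its component in `E`. -/
lemma unit_isCartesianFunctor : IsCartesianFunctor (unit p hI) p (sigmaFib p F) where
  comp := rfl
  map_cart {I J f x y} φ hφ := by
    have := hφ.toIsHomLift
    subst_hom_lift p f φ
    exact
      { toIsHomLift := (sigmaFib_isHomLift_iff ((unit p hI).map φ)).2 rfl
        universal_property' := by
          intro W g ψ hψ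
          change W.base ⟶ p.obj x at g
          have hb : SigmaHom.base ψ = g ≫ p.map φ :=
            (sigmaFib_isHomLift_iff (X := W) (Y := (unit p hI).obj y) ψ).1 hψ
          obtain ⟨f, s, w, χ, hχ⟩ := ψ
          change W.dom ⟶ p.obj y at s
          change W.map ≫ f = s ≫ 𝟙 _ at w
          change W.fib.1 ⟶ y at χ
          change f = g ≫ p.map φ at hb
          change p.IsHomLift s χ at hχ
          rw [Category.comp_id] at w
          have ht : s = (W.map ≫ g) ≫ p.map φ := by
            rw [← w, hb]
            exact (Category.assoc _ _ _).symm
          obtain ⟨χ', ⟨hχ', hχ''⟩, hu⟩ := Functor.IsStronglyCartesian.universal_property p (p.map φ)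
            φ (W.map ≫ g) s ht χ
          let m : W ⟶ (unit p hI).obj x :=
            SigmaHom.mk g (W.map ≫ g) (Category.comp_id _).symm χ' hχ'
          refine ⟨m, ⟨(sigmaFib_isHomLift_iff m).2 rfl, SigmaHom.ext hb.symm ht.symm hχ''⟩, ?_⟩
          rintro ⟨g', s', w', ξ, hξ⟩ ⟨h₁, h₂⟩
          obtain rfl : g' = g :=
            (sigmaFib_isHomLift_iff (X := W) (Y := (unit p hI).obj x) ⟨g', s', w', ξ, hξ⟩).1 h₁
          obtain rfl : s' = W.map ≫ g' := (Category.comp_id _).symm.trans w'.symm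
          exact SigmaHom.ext rfl rfl (hu _ ⟨hξ, congrArg SigmaHom.fib h₂⟩) }

lemma exists_unit_isStronglyCocartesian (X : SigmaCat p F) :
    ∃ η : (unit p hI).obj X.fib.1 ⟶ X, (sigmaFib p F).IsStronglyCocartesian X.map η := by
  obtain ⟨g, hg, x, rfl⟩ := X
  let η : (unit p hI).obj x ⟶ SigmaCat.mk g hg ⟨x, rfl⟩ :=
    SigmaHom.mk g (𝟙 _) rfl (𝟙 x) (IsHomLift.id rfl)
  have h₁ : IsIso (SigmaHom.top η) := inferInstanceAs (IsIso (𝟙 _))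
  have h₂ : IsIso (SigmaHom.fib η) := inferInstanceAs (IsIso (𝟙 _))
  exact ⟨η, isStronglyCocartesian_of_isIso η⟩

/-- Up to isomorphism, a cocartesian map out of `b` over `u` is the explicit one to `(b.map ≫ u,
b.fib)`, with identities as top and component in `E`. Lifting a map from an object over an identity
changes only its base, which is forced to be `s ≫ b.map`. -/
lemma coprodOrth_unit [F.IsStableUnderComposition] (x : E) :
    CoprodOrth (sigmaFib p F) F ((unit p hI).obj x) := by
  intro K J u hu b c η hη φ
  obtain rfl : b.base = K := @IsHomLift.domain_eq _ _ _ _ (sigmaFib p F) _ _ _ _ _ η hη.toIsHomLift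
  let c' : SigmaCat p F := SigmaCat.mk (b.map ≫ u) (F.comp_mem _ _ b.mem hu) b.fib
  let η' : b ⟶ c' := SigmaHom.mk u (𝟙 _) (Category.id_comp _).symm (𝟙 b.fib.1)
    (IsHomLift.id b.fib.2)
  have h₁ : IsIso (SigmaHom.top η') := inferInstanceAs (IsIso (𝟙 _))
  have h₂ : IsIso (SigmaHom.fib η') := inferInstanceAs (IsIso (𝟙 _))
  have hη' : (sigmaFib p F).IsStronglyCocartesian u η' := isStronglyCocartesian_of_isIso η'
  obtain ⟨i, -, rfl⟩ := exists_vertical_iso_of_isStronglyCocartesian η' η hη' hη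
  have key (ψ : (unit p hI).obj x ⟶ b) : ψ ≫ η' ≫ i.hom = φ ↔ ψ ≫ η' = φ ≫ i.inv := by
    rw [Iso.eq_comp_inv, Category.assoc]
  simp only [key]
  generalize φ ≫ i.inv = φ'
  obtain ⟨f, s, w, χ, hχ⟩ := φ'
  change p.obj x ⟶ b.dom at s
  change 𝟙 _ ≫ f = s ≫ b.map ≫ u at w
  change x ⟶ b.fib.1 at χ
  let ψ : (unit p hI).obj x ⟶ b := SigmaHom.mk (s ≫ b.map) s (Category.id_comp _) χ hχ
  refine ⟨ψ, SigmaHom.ext ?_ (Category.comp_id _) (Category.comp_id _), ?_⟩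
  · exact (Category.assoc _ _ _).trans (w.symm.trans (Category.id_comp _))
  · rintro ⟨f', s', w', χ', hχ'⟩ h
    obtain rfl : s' = s := (Category.comp_id _).symm.trans (congrArg SigmaHom.top h)
    obtain rfl : χ' = χ := (Category.comp_id _).symm.trans (congrArg SigmaHom.fib h)
    exact SigmaHom.ext ((Category.id_comp _).symm.trans w') rfl rfl

end SigmaCat

end SigmaUnits

/-! ### A Gödel fibration is a Dialectica fibration. -/

section Subfibrations

variable {B : Type u₁} [Category.{v₁} B] {E : Type u₂} [Category.{v₂} E] {p : E ⥤ B}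

lemma isStronglyCartesian_of_map {D : Type u₃} [Category.{v₃} D] {q : D ⥤ B} {K : D ⥤ E}
    (hK : K ⋙ p = q) [K.Full] [K.Faithful] {I J : B} {f : I ⟶ J} {X Y : D} {φ : X ⟶ Y}
    (h : p.IsStronglyCartesian f (K.map φ)) : q.IsStronglyCartesian f φ where
  toIsHomLift := (isHomLift_map_iff hK φ).1 h.toIsHomLift
  universal_property' := by
    subst hK
    intro Z g ψ hψ
    have hψ' := (isHomLift_map_iff (K := K) (p := p) rfl ψ).2 hψ
    obtain ⟨χ, ⟨hχ, hχ'⟩, hu⟩ := Functor.IsStronglyCartesian.universal_property p f (K.map φ) g _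
      rfl (K.map ψ)
    obtain ⟨χ, rfl⟩ := K.map_surjective χ
    refine ⟨χ, ⟨(isHomLift_map_iff (K := K) rfl χ).1 hχ,
      K.map_injective ((K.map_comp _ _).trans hχ')⟩, ?_⟩
    rintro χ' ⟨h₁, rfl⟩
    exact K.map_injective (hu _ ⟨(isHomLift_map_iff (K := K) rfl χ').2 h₁, (K.map_comp _ _).symm⟩)

/-- It is enough that each base map has one lifting whose image is cartesian: it is then cartesian
in `D` as well, and all others are isomorphic to it. -/
lemma isCartesianFunctor_of_exists {D : Type u₃} [Category.{v₃} D] {q : D ⥤ B} {K : D ⥤ E}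
    (hK : K ⋙ p = q) [K.Full] [K.Faithful]
    (H : ∀ {I : B} (Y : D) (f : I ⟶ p.obj (K.obj Y)), ∃ (X : D) (φ : X ⟶ Y),
      p.IsStronglyCartesian f (K.map φ)) : IsCartesianFunctor K q p where
  comp := hK
  map_cart {I J f X Y} φ hφ := by
    obtain rfl : p.obj (K.obj Y) = J :=
      (Functor.congr_obj hK Y).trans (IsHomLift.codomain_eq q f φ)
    obtain ⟨X', φ', hφ'⟩ := H Y f
    obtain ⟨i, hi, rfl⟩ := exists_vertical_iso_of_isStronglyCartesian φ φ' hφ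
      (isStronglyCartesian_of_map hK hφ')
    have := (isHomLift_map_iff hK i.hom).2 hi
    rw [K.map_comp]
    exact isStronglyCartesian_comp (Category.id_comp f) (.of_isIso p (𝟙 I) (K.map i.hom)) hφ'

lemma IsCartesianFunctor.comp_functor {D : Type u₃} [Category.{v₃} D] {q : D ⥤ B} {K : D ⥤ E}
    (hK : IsCartesianFunctor K q p) {C : Type*} [Category* C] {r : C ⥤ B} {M : C ⥤ D}
    (hM : IsCartesianFunctor M r q) : IsCartesianFunctor (M ⋙ K) r p where
  comp := by rw [Functor.assoc, hK.comp, hM.comp]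
  map_cart φ hφ := hK.map_cart _ (hM.map_cart φ hφ)

lemma restrict_isCartesianFunctor [p.IsFibered] {P : ObjectProperty E}
    (hP : ∀ {I J : B} (f : I ⟶ J) (a : p.Fiber J), P a.1 → P ((reindex p f).obj a).1) :
    IsCartesianFunctor P.ι (restrict p P) p :=
  isCartesianFunctor_of_exists rfl fun Y f =>
    ⟨⟨_, hP f ⟨Y.1, rfl⟩ Y.2⟩, P.homMk (cartLift p f ⟨Y.1, rfl⟩),
      cartLift_isStronglyCartesian f ⟨Y.1, rfl⟩⟩

lemma IsProdCone.exists_of_apex_iso {L J : B} {v : L ⟶ J} {c c' b e : E} {κ : e ⟶ c} {ε : e ⟶ b}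
    (h : IsProdCone p v κ ε) (i : c' ≅ c) (hi : p.IsHomLift (𝟙 J) i.hom) :
    ∃ κ' : e ⟶ c', IsProdCone p v κ' ε := by
  have hi' := IsHomLift.inv_vertical i hi
  have hid : p.IsHomLift (𝟙 L) (𝟙 e) := IsHomLift.id (haveI := h.cart; IsHomLift.domain_eq p v κ)
  have := h.of_iso i hi (κ' := κ ≫ i.inv) (isStronglyCartesian_comp (Category.comp_id v) h.cart
    (.of_isIso p (𝟙 J) i.inv)) (j := 𝟙 e) hid (by simp)
  rw [Category.id_comp] at this
  exact ⟨_, this⟩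

variable [p.IsFibered] {F : MorphismProperty B}

lemma coprodQFSub_isCartesianFunctor (hC : HasFibredCoproducts p F) :
    IsCartesianFunctor (coprodQFProp hC).ι (coprodQFSub hC) p :=
  restrict_isCartesianFunctor fun f a ha =>
    (coprodQFProp_iff hC _).2 (((coprodQFProp_iff hC a).1 ha).reindex f)

lemma prodQFSub_isCartesianFunctor (hP : HasFibredProducts p F) :
    IsCartesianFunctor (prodQFProp hP).ι (prodQFSub hP) p :=
  restrict_isCartesianFunctor fun f a ha =>
    (prodQFProp_iff hP _).2 (((prodQFProp_iff hP a).1 ha).reindex f)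

lemma IsCoprodQF.isCoprodSplitting {hC : HasFibredCoproducts p F} {A : B} {a : p.Fiber A}
    (ha : IsCoprodQF hC a) : IsCoprodSplitting hC a :=
  (ha (𝟙 A)).of_iso ((reindexId p A).app a)

lemma IsProdQF.isProdSplitting {hP : HasFibredProducts p F} {A : B} {a : p.Fiber A}
    (ha : IsProdQF hP a) : IsProdSplitting hP a :=
  (ha (𝟙 A)).of_iso ((reindexId p A).app a)

lemma IsCoprodQF.of_iso {hC : HasFibredCoproducts p F} {A : B} {a a' : p.Fiber A} (i : a ≅ a')
    (ha : IsCoprodQF hC a) : IsCoprodQF hC a' :=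
  fun _ f => (ha f).of_iso ((DepDialectica.reindex p f).mapIso i)

/-- Two recognition steps. `R` identifies `Π_F` of the quantifier-free part with the subfibration of
`(F, ∐)`-quantifier-free objects; composed with the inclusion into `p`, it is a system of generators
to which the criterion for `Σ_F` applies. -/
theorem IsGoedel.nonempty_fibredEquivalence [IsDisplayMapClass F] (hG : IsGoedel p F) :
    Nonempty (FibredEquivalence (dial hG.quantifierFree F) p) := by
  have hC := hG.hasCoproducts
  have hP := hG.sub_hasProducts
  have hK := prodQFSub_isCartesianFunctor hP
  obtain ⟨R, hR⟩ : ∃ R, IsOverEquivalence R (piFib hG.quantifierFree F) (coprodQFSub hC) :=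
    exists_pi_isOverEquivalence (F := F) hK
    (fun v hv b hb => ⟨_, _, _, _, hP.isProdCone v hv ⟨b, hb⟩⟩)
    (fun x => (isProdSplitting_iff hP).1 (IsProdQF.isProdSplitting x.2))
    (fun Y => by
      -- The witness `hP'` bundled in "enough" is interchangeable with `hP` by proof irrelevance;
      -- likewise `hC'` and `hC` below.
      obtain ⟨hP', H⟩ := hG.enoughProd
      obtain ⟨A, f, hf, b, hb, ⟨i⟩⟩ := H ⟨Y, rfl⟩
      obtain ⟨κ, hκ⟩ := (hP'.isProdCone f hf b).exists_of_apex_iso (isoOfFiberIso i) i.hom.2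
      exact ⟨A, f, hf, ⟨b.1, (prodQFProp_iff hP b).2 hb⟩, _, κ, _, hκ⟩)
  have := hR.full
  have := hR.faithful
  have hK' : (R ⋙ (coprodQFProp hC).ι) ⋙ p = piFib hG.quantifierFree F := hR.comp
  obtain ⟨S, hS⟩ : ∃ S, IsOverEquivalence S (dial hG.quantifierFree F) p :=
    exists_sigma_isOverEquivalence (F := F) hK'
    (fun u hu _ hb => hC.exists_isStronglyCocartesian u hu hb)
    (fun x => (isCoprodSplitting_iff hC).1 (IsCoprodQF.isCoprodSplitting (R.obj x).2))
    (fun Y => by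
      obtain ⟨hC', H⟩ := hG.enough
      obtain ⟨A, f, hf, b, hb, ⟨i⟩⟩ := H ⟨Y, rfl⟩
      obtain ⟨X, j, hj⟩ := hR.surj ⟨b.1, (coprodQFProp_iff hC b).2 hb⟩
      have hj' : p.IsHomLift (𝟙 A) j.hom.hom :=
        isHomLift_id_of_obj_eq _ b.2 ((restrict_isHomLift j.hom).1 hj)
      have hi : p.IsHomLift (𝟙 _) (isoOfFiberIso i).inv := i.inv.2
      refine ⟨A, f, hf, X, j.hom.hom ≫ unitMap (coprodAdj hC' f hf) b ≫ (isoOfFiberIso i).inv, ?_⟩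
      have h₁ : IsIso j.hom.hom := inferInstanceAs (IsIso ((coprodQFProp hC).ι.map j.hom))
      exact isStronglyCocartesian_comp (Category.id_comp f) (.of_isIso p (𝟙 A) _)
        (isStronglyCocartesian_comp (Category.comp_id f) (unitMap_isStronglyCocartesian _ b)
          (.of_isIso p (𝟙 _) _)))
  exact hS.nonempty_fibredEquivalence

end Subfibrations

/-! ### Quantifier-free objects in the presence of generators. -/

section Generators

variable {B : Type u₁} [Category.{v₁} B] {E : Type u₂} [Category.{v₂} E] {p : E ⥤ B}
  {F : MorphismProperty B} {D : Type u₃} [Category.{v₃} D] {q : D ⥤ B}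

lemma CoprodOrth.of_iso {a a' : E} (h : CoprodOrth p F a) (i : a ≅ a') : CoprodOrth p F a' := by
  intro K J u hu b c η hη φ
  obtain ⟨ψ, hψ, hψ'⟩ := h u hu η hη (i.hom ≫ φ)
  refine ⟨i.inv ≫ ψ, (Category.assoc _ _ _).trans (by rw [hψ, Iso.inv_hom_id_assoc]), fun ψ' h' => ?_⟩
  rw [Iso.eq_inv_comp]
  exact hψ' _ ((Category.assoc _ _ _).trans (congrArg (i.hom ≫ ·) h'))

lemma CoprodOrth.of_map {G : E ⥤ D} (hG : IsOverEquivalence G p q) {a : E}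
    (h : CoprodOrth q F (G.obj a)) : CoprodOrth p F a := by
  intro K J u hu b c η hη φ
  have := hG.full
  have := hG.faithful
  obtain ⟨ψ, hψ, hψ'⟩ := h u hu (G.map η) (hG.map_isStronglyCocartesian η hη) (G.map φ)
  obtain ⟨ψ, rfl⟩ := G.map_surjective ψ
  refine ⟨ψ, G.map_injective ((G.map_comp _ _).trans hψ), fun ψ' h' => G.map_injective (hψ' _ ?_)⟩
  rw [← h', G.map_comp]

variable [p.IsFibered] [IsDisplayMapClass F]

lemma ProdOrth.isProdQF (hP : HasFibredProducts p F) {A : B} {a : p.Fiber A}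
    (h : ∀ {I : B} (f : I ⟶ A), ProdOrth p F (reindexObj p f a).1) : IsProdQF hP a :=
  fun _ f => (isProdSplitting_iff hP).2 (h f)

/-- Cones on quantifier-free objects are determined on quantifier-free test objects. -/
lemma IsProdCone.of_restrict (hC : HasFibredCoproducts p F) (hE : HasEnoughCoprodQF p F) {L J : B}
    {v : L ⟶ J} {c b e : (coprodQFProp hC).FullSubcategory} {κ : e ⟶ c} {ε : e ⟶ b}
    (h : IsProdCone (coprodQFSub hC) v κ ε) : IsProdCone p v κ.hom ε.hom := by
  have hcart : p.IsStronglyCartesian v κ.hom :=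
    (coprodQFSub_isCartesianFunctor hC).map_cart κ h.cart
  have hvert : p.IsHomLift (𝟙 L) ε.hom := (restrict_isHomLift ε).1 h.vert
  refine ⟨hcart, hvert, fun {K I u g f} sq {d e'} κ' hκ' φ hφ => ?_⟩
  obtain ⟨hC', hE⟩ := hE
  -- The test object `d` is covered by a quantifier-free `β` through a cocartesian `η`, and the cone
  -- can be tested on `β`.
  obtain ⟨A, y, hy, β, hβ, ⟨i⟩⟩ := hE ⟨d, IsHomLift.codomain_eq p u κ'⟩
  let η : β.1 ⟶ d := unitMap (coprodAdj hC' y hy) β ≫ (isoOfFiberIso i).inv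
  have hη : p.IsStronglyCocartesian y η := isStronglyCocartesian_comp (Category.comp_id y)
    (unitMap_isStronglyCocartesian _ β)
    (haveI : p.IsHomLift (𝟙 I) (isoOfFiberIso i).inv := i.inv.2; .of_isIso p (𝟙 I) _)
  have sqy := pb_isPullback hy u
  have sq' : IsPullback (pbTop hy u) (pbBase hy u ≫ g) (y ≫ f) v :=
    (sqy.flip.paste_horiz sq.flip).flip
  let β' := (reindex p (pbTop hy u)).obj β
  let γ : β'.1 ⟶ β.1 := cartLift p (pbTop hy u) β
  have hγ : p.IsStronglyCartesian (pbTop hy u) γ := cartLift_isStronglyCartesian _ β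
  obtain ⟨η', hη', hη''⟩ := exists_fac_of_isStronglyCartesian hκ' (γ ≫ η) sqy.w.symm inferInstance
  -- By Beck-Chevalley the cover `η'` of `e'` is cocartesian too. Maps out of `d` and `e'` are thus
  -- determined by their restrictions to `β` and `β'`, so existence and uniqueness descend.
  have hηc := hC.base_change sqy.flip hy (pbBase_mem hy u) hη hγ hκ' hη' hη''
  let β₁ : (coprodQFProp hC).FullSubcategory := ⟨β.1, (coprodQFProp_iff hC β).2 hβ⟩
  let β₂ : (coprodQFProp hC).FullSubcategory := ⟨β'.1, (coprodQFProp_iff hC β').2 (hβ.reindex _)⟩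
  have hγ' : (coprodQFSub hC).IsStronglyCartesian (pbTop hy u) (ObjectProperty.homMk γ : β₂ ⟶ β₁) :=
    isStronglyCartesian_of_map (K := (coprodQFProp hC).ι) rfl hγ
  have hηφ : p.IsHomLift (pbBase hy u ≫ g) (η' ≫ φ) := inferInstance
  obtain ⟨m', ⟨hm', n', hn', h₁, h₂⟩, hu⟩ := h.existsUnique sq' _ hγ'
    (ObjectProperty.homMk (η' ≫ φ) : β₂ ⟶ b) ((restrict_isHomLift _).2 hηφ)
  have hm'' : p.IsHomLift (y ≫ f) m'.hom := (restrict_isHomLift m').1 hm'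
  have hn'' : p.IsHomLift (pbBase hy u ≫ g) n'.hom := (restrict_isHomLift n').1 hn'
  replace h₁ : n'.hom ≫ κ.hom = γ ≫ m'.hom := congrArg (·.hom) h₁
  replace h₂ : n'.hom ≫ ε.hom = η' ≫ φ := congrArg (·.hom) h₂
  obtain ⟨m, ⟨hm, hηm⟩, -⟩ := Functor.IsStronglyCocartesian.universal_property p y η f _ rfl m'.hom
  obtain ⟨n, hn, hnκ⟩ := exists_fac_of_isStronglyCartesian hcart (κ' ≫ m) sq.w.symm inferInstance
  refine ⟨m, ⟨hm, n, hn, hnκ, ?_⟩, ?_⟩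
  · have e₁ : η' ≫ n = n'.hom := by
      refine Functor.IsStronglyCartesian.ext p v κ.hom (pbBase hy u ≫ g) ?_
      rw [Category.assoc, hnκ, h₁, ← hηm, ← Category.assoc, hη'', Category.assoc]
    refine Functor.IsStronglyCocartesian.ext p (pbBase hy u) η' g ?_
    rw [← Category.assoc, e₁, h₂]
  · rintro m₂ ⟨hm₂, n₂, hn₂, h₃, h₄⟩
    have hηm₂ : p.IsHomLift (y ≫ f) (η ≫ m₂) := inferInstance
    have hηn₂ : p.IsHomLift (pbBase hy u ≫ g) (η' ≫ n₂) := inferInstance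
    have e := hu (ObjectProperty.homMk (η ≫ m₂) : β₁ ⟶ c) ⟨(restrict_isHomLift _).2 hηm₂,
      (ObjectProperty.homMk (η' ≫ n₂) : β₂ ⟶ e), (restrict_isHomLift _).2 hηn₂, ?_, ?_⟩
    · replace e : η ≫ m₂ = m'.hom := congrArg (·.hom) e
      exact Functor.IsStronglyCocartesian.ext p y η f (e.trans hηm.symm)
    · ext
      change (η' ≫ n₂) ≫ κ.hom = γ ≫ η ≫ m₂
      rw [Category.assoc, h₃, ← Category.assoc, hη'', Category.assoc]
    · ext
      change (η' ≫ n₂) ≫ ε.hom = η' ≫ φ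
      rw [Category.assoc, h₄]

/-- The product computed among quantifier-free objects is also one in `p`, hence isomorphic to the
product of `p`, and its apex is quantifier-free by construction. -/
lemma HasEnoughCoprodQF.prod_isCoprodQF (hE : HasEnoughCoprodQF p F) (hC : HasFibredCoproducts p F)
    (hP : HasFibredProducts p F) (hP' : HasFibredProducts (coprodQFSub hC) F) {I J : B}
    (f : I ⟶ J) (hf : F f) {a : p.Fiber I} (ha : IsCoprodQF hC a) :
    IsCoprodQF hC ((prod hP f hf).obj a) := by
  let a' : (coprodQFSub hC).Fiber I := ⟨⟨a.1, (coprodQFProp_iff hC a).2 ha⟩, a.2⟩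
  have h₁ := (hP'.isProdCone f hf a').of_restrict hC hE
  obtain ⟨i, -, hi, -⟩ := h₁.exists_iso (hP.isProdCone f hf a)
  let c : p.Fiber J := ⟨((prod hP' f hf).obj a').1.1, ((prod hP' f hf).obj a').2⟩
  have hc : IsCoprodQF hC c := (coprodQFProp_iff hC c).1 ((prod hP' f hf).obj a').1.2
  exact hc.of_iso (fiberIso i hi)

/-- A fully faithful cartesian functor whose values are orthogonal to the cocartesian maps over
display maps, and generate under these. -/
structure GeneratesCoprod (K : D ⥤ E) (q : D ⥤ B) (p : E ⥤ B) (F : MorphismProperty B) : Prop where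
  isCartesianFunctor : IsCartesianFunctor K q p
  full : K.Full
  faithful : K.Faithful
  orth : ∀ x, CoprodOrth p F (K.obj x)
  gen : ∀ Y : E, ∃ (A : B) (f : A ⟶ p.obj Y) (_ : F f) (x : D) (η : K.obj x ⟶ Y),
      p.IsStronglyCocartesian f η

namespace GeneratesCoprod

variable [q.IsFibered] {K : D ⥤ E}

/-- Being quantifier-free concerns all reindexings. As `K` preserves cartesian maps, the reindexings
of a generator are again generators up to isomorphism, hence orthogonal. -/
lemma coprodQFProp_obj (hK : GeneratesCoprod K q p F) (hC : HasFibredCoproducts p F)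
    (x : D) : coprodQFProp hC (K.obj x) := by
  intro I f
  have hx : q.obj x = p.obj (K.obj x) := (Functor.congr_obj hK.isCartesianFunctor.comp x).symm
  obtain ⟨x', φ, hφ⟩ := exists_isStronglyCartesian q f hx
  obtain ⟨i, -, -⟩ := exists_vertical_iso_of_isStronglyCartesian (K.map φ) _
    (hK.isCartesianFunctor.map_cart φ hφ) (cartLift_isStronglyCartesian f ⟨K.obj x, rfl⟩)
  exact (isCoprodSplitting_iff hC).2 ((hK.orth x').of_iso i)

lemma hasEnoughCoprodQF (hK : GeneratesCoprod K q p F) (hC : HasFibredCoproducts p F) :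
    HasEnoughCoprodQF p F := by
  refine ⟨hC, ?_⟩
  rintro I ⟨Y, rfl⟩
  obtain ⟨A, f, hf, x, η, hη⟩ := hK.gen Y
  let b : p.Fiber A := ⟨K.obj x, IsHomLift.domain_eq p f η⟩
  obtain ⟨i, hi, -⟩ := exists_vertical_iso_of_isStronglyCocartesian η _ hη
    (unitMap_isStronglyCocartesian (coprodAdj hC f hf) b)
  exact ⟨A, f, hf, b, (coprodQFProp_iff hC b).1 (hK.coprodQFProp_obj hC x), ⟨fiberIso i hi⟩⟩

/-- For a presentation `η : K x ⟶ Y` over `f`, orthogonality of `Y` lifts the identity through `η`,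
over a section `g` of `f`. Then `Y` is the reindexing of `K x` along `g`, which `K` attains. -/
lemma exists_iso_of_coprodQFProp (hK : GeneratesCoprod K q p F) (hC : HasFibredCoproducts p F)
    {Y : E} (hY : coprodQFProp hC Y) :
    ∃ (x : D) (i : K.obj x ≅ Y), p.IsHomLift (𝟙 (p.obj Y)) i.hom := by
  have hY' : CoprodOrth p F Y := (isCoprodSplitting_iff hC).1 (IsCoprodQF.isCoprodSplitting hY)
  obtain ⟨A, f, hf, x, η, hη⟩ := hK.gen Y
  obtain ⟨ψ, hψ, -⟩ := hY' f hf η hη (𝟙 Y)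
  have hA : p.obj (K.obj x) = A := IsHomLift.domain_eq p f η
  obtain ⟨g, hg⟩ := exists_isHomLift p rfl hA ψ
  have hgf : g ≫ f = 𝟙 (p.obj Y) := isHomLift_unique p (𝟙 Y)
    (hψ ▸ IsHomLift.of_comp_eq rfl ψ η hg hη.toIsHomLift) (IsHomLift.id rfl)
  obtain ⟨x', φ, hφ⟩ := exists_isStronglyCartesian q g
    ((Functor.congr_obj hK.isCartesianFunctor.comp x).symm.trans hA)
  have hKφ := hK.isCartesianFunctor.map_cart φ hφ
  obtain ⟨ψ', hψ', rfl⟩ := exists_fac_of_isStronglyCartesian hKφ ψ (Category.id_comp g) hg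
  have hη' := hη.toIsHomLift
  have hv : p.IsHomLift (𝟙 (p.obj Y)) (K.map φ ≫ η) :=
    IsHomLift.of_comp_eq hgf _ _ hKφ.toIsHomLift hη'
  refine ⟨x', ⟨K.map φ ≫ η, ψ', ?_, (Category.assoc _ _ _).symm.trans hψ⟩, hv⟩
  have hid : p.IsHomLift (𝟙 (p.obj Y)) (𝟙 (K.obj x')) :=
    IsHomLift.id (IsHomLift.domain_eq p g (K.map φ))
  -- One composite is the identity by the choice of the lift. For the other, two lifts of `K.map φ ≫
  -- η` through `η` are compared by orthogonality of the generator `K x'`.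
  refine Functor.IsStronglyCartesian.ext p g (K.map φ) (𝟙 (p.obj Y)) ?_
  refine (hK.orth x' f hf η hη (K.map φ ≫ η)).unique ?_ ?_
  · simp only [Category.assoc] at hψ ⊢
    rw [hψ, Category.comp_id]
  · simp

lemma lift_isOverEquivalence (hK : GeneratesCoprod K q p F) (hC : HasFibredCoproducts p F) :
    IsOverEquivalence ((coprodQFProp hC).lift K (hK.coprodQFProp_obj hC)) q (coprodQFSub hC) := by
  have := hK.full
  have := hK.faithful
  refine ⟨hK.isCartesianFunctor.comp, inferInstance, inferInstance, fun Y => ?_⟩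
  obtain ⟨x, i, hi⟩ := hK.exists_iso_of_coprodQFProp hC Y.2
  exact ⟨x, ObjectProperty.isoMk _ i, (restrict_isHomLift _).2 hi⟩

end GeneratesCoprod

end Generators

/-! ### A Dialectica fibration is Gödel. -/

section Converse

variable {B : Type u₁} [Category.{v₁} B] {E : Type u₂} [Category.{v₂} E] {p : E ⥤ B}
  {F : MorphismProperty B} {D : Type u₃} [Category.{v₃} D] {q : D ⥤ B}

lemma IsOverEquivalence.isCartesianFunctor {K : D ⥤ E} (hK : IsOverEquivalence K q p) :
    IsCartesianFunctor K q p :=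
  ⟨hK.comp, fun φ hφ => hK.map_isStronglyCartesian φ hφ⟩

lemma isHomLift_id_codomain {I : B} {X Y : E} {φ : X ⟶ Y} (h : p.IsHomLift (𝟙 I) φ) :
    p.IsHomLift (𝟙 (p.obj Y)) φ := by
  obtain rfl := IsHomLift.codomain_eq p (𝟙 I) φ
  exact h

/-- An equivalence with a `Σ_F`-completion is generated by the objects over identities. -/
lemma FibredEquivalence.generatesCoprod [F.IsStableUnderComposition] (hI : ∀ I, F (𝟙 I))
    (e : FibredEquivalence (sigmaFib q F) p) :
    GeneratesCoprod (SigmaCat.unit q hI ⋙ e.functor) q p F := by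
  have he := e.isOverEquivalence
  have := he.full
  have := he.faithful
  refine ⟨he.isCartesianFunctor.comp_functor (SigmaCat.unit_isCartesianFunctor hI), inferInstance,
    inferInstance, fun x => ?_, fun Y => ?_⟩
  -- Orthogonality is reflected along the inverse equivalence, which takes the object back to an
  -- object over an identity, up to the unit.
  · exact .of_map e.inverse_isOverEquivalence ((SigmaCat.coprodOrth_unit hI x).of_iso
      (e.unitIso.app ((SigmaCat.unit q hI).obj x)))
  · obtain ⟨X, i, hi⟩ := he.surj Y
    obtain ⟨η, hη⟩ := SigmaCat.exists_unit_isStronglyCocartesian hI X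
    have hη' := he.map_isStronglyCocartesian η hη
    have hX : X.base = p.obj Y :=
      (Functor.congr_obj he.comp X).symm.trans (IsHomLift.domain_eq p (𝟙 (p.obj Y)) i.hom)
    obtain ⟨v, hv, x⟩ := X
    subst hX
    exact ⟨_, v, hv, x.1, e.functor.map η ≫ i.hom,
      isStronglyCocartesian_comp (Category.comp_id v) hη' (.of_isIso p (𝟙 (p.obj Y)) i.hom)⟩

variable [p.IsFibered] [q.IsFibered] [IsDisplayMapClass F] [F.IsStableUnderComposition]

/-- Products in `Π_F(q)` are given by composing display maps, and cones are preserved by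
equivalences. -/
lemma hasFibredProducts_of_piFib {K : PiCat q F ⥤ E}
    (hK : IsOverEquivalence K (piFib q F) p) : HasFibredProducts p F := by
  refine hasFibredProducts_of_isProdCone fun L J v hv b => ?_
  obtain ⟨X, i, hi⟩ := hK.surj b.1
  obtain rfl : X.base = L := (Functor.congr_obj hK.comp X).symm.trans
    ((IsHomLift.domain_eq p (𝟙 _) i.hom).trans b.2)
  obtain ⟨c, e, κ, ε, h⟩ := X.exists_isProdCone v (F.comp_mem _ _ X.mem hv)
  exact ⟨_, _, _, _, (h.map hK).comp_iso i (isHomLift_id_of_obj_eq _ b.2 hi)⟩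

/-- The images of the objects over identities serve: they are orthogonal, their class is closed
under reindexing up to isomorphism, and every object of `Π_F(q)` is a product of one of them along
its own display map. -/
lemma hasEnoughProdQF_of_piFib (hI : ∀ I, F (𝟙 I)) {K : PiCat q F ⥤ E}
    (hK : IsOverEquivalence K (piFib q F) p) : HasEnoughProdQF p F := by
  have hP := hasFibredProducts_of_piFib hK
  obtain ⟨G, hG, i, j, hi, hj⟩ := hK.exists_inverse
  have hG' : IsOverEquivalence G p (piFib q F) := .of_iso hG j.symm i.symm
    (fun X => IsHomLift.inv_vertical (i.app X) (hi X))
  have horth (x : D) : ProdOrth p F (K.obj (PiCat.unit hI x)) :=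
    .of_map hG' ((PiCat.prodOrth_unit hI x).of_iso (i.app (PiCat.unit hI x)) 
      (isHomLift_id_codomain (hi _)))
  have hqf (x : D) : IsProdQF hP (⟨K.obj (PiCat.unit hI x), rfl⟩ : p.Fiber _) := by
    refine ProdOrth.isProdQF hP fun {I} f => ?_
    have hx : q.obj x = p.obj (K.obj (PiCat.unit hI x)) :=
      (Functor.congr_obj hK.comp (PiCat.unit hI x)).symm
    obtain ⟨x', φ, hφ⟩ := exists_isStronglyCartesian q f hx
    obtain ⟨m, hm⟩ := PiCat.exists_unit_isStronglyCartesian hI φ hφ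
    obtain ⟨k, hk, -⟩ := exists_vertical_iso_of_isStronglyCartesian (K.map m) _
      (hK.map_isStronglyCartesian m hm)
      (cartLift_isStronglyCartesian f ⟨K.obj (PiCat.unit hI x), rfl⟩)
    exact (horth x').of_iso k (isHomLift_id_codomain hk)
  refine ⟨hP, ?_⟩
  rintro I ⟨Y, rfl⟩
  obtain ⟨X, k, hk⟩ := hK.surj Y
  obtain ⟨e, κ, ε, h⟩ := PiCat.exists_isProdCone_unit hI X
  have hX : X.base = p.obj Y :=
    (Functor.congr_obj hK.comp X).symm.trans (IsHomLift.domain_eq p (𝟙 (p.obj Y)) k.hom)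
  obtain @⟨_, A, v, hv, x⟩ := X
  subst hX
  obtain ⟨κ', h'⟩ := (h.map hK).exists_of_apex_iso k.symm (IsHomLift.inv_vertical k hk)
  have hε := h'.vert
  let b : p.Fiber A := ⟨K.obj (PiCat.unit hI x.1), IsHomLift.codomain_eq p (𝟙 _) (K.map ε)⟩
  obtain ⟨l, -, hl, -⟩ := h'.exists_iso (hP.isProdCone v hv b)
  exact ⟨_, v, hv, b, (prodQFProp_iff hP b).1 (hqf x.1), ⟨fiberIso l hl⟩⟩

/-- The fibration `Π_F(p')`, embedded in `p` through the equivalence, generates it under coproducts,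
and is therefore equivalent to the subfibration of `(F, ∐)`-quantifier-free objects. The conditions
on products are then inherited from `Π_F(p')`. -/
theorem FibredEquivalence.isGoedel {p' : D ⥤ B} [p'.IsFibered] (hI : ∀ I, F (𝟙 I))
    (hP : HasFibredProducts p F) (hC : HasFibredCoproducts p F) (hB : HasDependentProducts F)
    (e : FibredEquivalence (dial p' F) p) : IsGoedel p F := by
  have hK : GeneratesCoprod (SigmaCat.unit (piFib p' F) hI ⋙ e.functor) (piFib p' F) p F :=
    FibredEquivalence.generatesCoprod hI e
  have hE := hK.hasEnoughCoprodQF hC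
  have hK' := hK.lift_isOverEquivalence hC
  exact
    { hasDependentProducts := hB
      hasProducts := hP
      hasCoproducts := hC
      enough := hE
      stable := fun _ _ f hf _ ha =>
        hE.prod_isCoprodQF hC hP (hasFibredProducts_of_piFib hK') f hf ha
      enoughProd := hasEnoughProdQF_of_piFib hI hK' }

end Converse

end DepDialectica

theorem mainTheorem1 {B : Type u₁} [Category.{v₁} B] (F : MorphismProperty B)
    [DepDialectica.IsDisplayMapClass F] [F.IsStableUnderComposition]
    (hunits : MorphismProperty.isomorphisms B ≤ F)
    {E : Type u₂} [Category.{v₂} E] (p : E ⥤ B) [p.IsFibered]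
    (hP : DepDialectica.HasFibredProducts p F) (hC : DepDialectica.HasFibredCoproducts p F)
    (hB : DepDialectica.HasDependentProducts F) :
    ((∃ (E' : Type u₂) (_ : Category.{v₂} E') (p' : E' ⥤ B) (_ : p'.IsFibered),
        Nonempty (DepDialectica.FibredEquivalence (DepDialectica.dial p' F) p)) ↔
      DepDialectica.IsGoedel p F) ∧
    ∀ hG : DepDialectica.IsGoedel p F,
      Nonempty (DepDialectica.FibredEquivalence (DepDialectica.dial hG.quantifierFree F) p) := by
  have hI (I : B) : F (𝟙 I) := hunits _ (MorphismProperty.isomorphisms.infer_property _)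
  refine ⟨⟨?_, fun hG => ⟨_, _, hG.quantifierFree, inferInstance, hG.nonempty_fibredEquivalence⟩⟩,
    fun hG => hG.nonempty_fibredEquivalence⟩
  rintro ⟨E', _, p', _, ⟨e⟩⟩
  exact e.isGoedel hI hP hC hB
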